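/- Let $G$ be a compact, simple and simply connected Lie group (simple meaning that its Lie algebra is simple), let $\rho\colon G\to M_n(\mathbb C)$ be a continuous faithful matrix representation, identify $G$ with $\rho(G)$, and let $\mathfrak g_0\subset M_n(\mathbb C)$ be the Lie algebra of $G$, i.e. the image of $d\rho$. For a finite-dimensional real normed space $V$, let $W^{s,p}(S^1,V)$ be the completion of $C^\infty(S^1,V)$ for the norm $\|f\|_{s,p}=\|\Delta^{s/2}f\|_p+\|f\|_p$, where $\Delta=-d^2/d\theta^2$; it is a space of ($L^p$-classes of) functions $S^1\to V$. Let $$W^{s,p}(S^1,G)=\{f\in W^{s,p}(S^1,M_n(\mathbb C)) : f(\theta)\in G \text{ for a.e. } \theta\},$$ with the topology of $W^{s,p}(S^1,M_n(\mathbb C))$. Theorem. Suppose that $1<p<\infty$ and $1<sp<\infty$. Then $W^{s,p}(S^1,G)$ is a group under pointwise multiplication and, with the given topology, it is a real-analytic Banach Lie group modelled on $W^{s,p}(S^1,\mathfrak g_0)$, for which the inclusion into $W^{s,p}(S^1,M_n(\mathbb C))$ is analytic. The derivative of this inclusion at the identity identifies its Lie algebra with $W^{s,p}(S^1,\mathfrak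 g_0)$, with the pointwise bracket. Moreover, $C^\infty(S^1,G)$ is contained and dense in $W^{s,p}(S^1,G)$, and $W^{s,p}(S^1,G)$ is connected. -/

import Mathlib

open MeasureTheory
open scoped Manifold ContDiff Matrix.Norms.L2Operator

namespace SobolevLoops

/-- The circle `ℝ / 2πℤ`. -/
abbrev S1 : Type := AddCircle (2 * Real.pi)

instance instFactTwoPiPos : Fact (0 < 2 * Real.pi) := ⟨Real.two_pi_pos⟩

/-- The normalized Haar measure `dθ / 2π` on the circle. -/
noncomputable abbrev dθ : Measure S1 := AddCircle.haarAddCircle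

section Sobolev

variable {V : Type*} [NormedAddCommGroup V] [NormedSpace ℝ V]

/-- `f : S¹ → V` is a `C^∞` function. -/
def IsSmooth (f : S1 → V) : Prop := ContDiff ℝ ∞ (fun x : ℝ => f (x : S1))

theorem IsSmooth.continuous {f : S1 → V} (hf : IsSmooth f) : Continuous f :=
  isQuotientMap_quotient_mk'.continuous_iff.2 (ContDiff.continuous hf)

/-- The `k`-th Fourier mode `(1/2π) ∫ cos (k (θ - t)) f(t) dt` of `f` at `θ`. The sum of the modes
`k` and `-k` (the mode `0` itself if `k = 0`) is the component of `f` in the eigenspace of the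
Laplacian `Δ = - d²/dθ²` for the eigenvalue `k²`. -/
noncomputable def mode (f : S1 → V) (k : ℤ) (θ : S1) : V :=
  ∫ t : S1, (fourier k (θ - t)).re • f t ∂dθ

/-- `g = Δ^{s/2} f`: the Fourier series of `f` with the modes `k` and `-k` multiplied by
`|k|^s = (k²)^{s/2}` converges to `g` at every point. -/
def HasFracLaplacian (s : ℝ) (f g : S1 → V) : Prop :=
  ∀ θ : S1, HasSum (fun k : ℤ => (|(k : ℝ)| ^ s) • mode f k θ) (g θ)

theorem integrable_mode {f : S1 → V} (hf : IsSmooth f) (k : ℤ) (θ : S1) :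
    Integrable (fun t : S1 => (fourier k (θ - t)).re • f t) dθ := by
  have hc : Continuous (fun t : S1 => (fourier k (θ - t)).re • f t) :=
    (Complex.continuous_re.comp ((fourier k).continuous.comp (by fun_prop))).smul hf.continuous
  exact hc.integrable_of_hasCompactSupport (HasCompactSupport.of_compactSpace _)

theorem HasFracLaplacian.add {s : ℝ} {f f' g g' : S1 → V} (hf : IsSmooth f) (hf' : IsSmooth f')
    (h : HasFracLaplacian s f g) (h' : HasFracLaplacian s f' g') :
    HasFracLaplacian s (f + f') (g + g') := by
  intro θ
  refine ((h θ).add (h' θ)).congr_fun ?_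
  intro k
  simp only [mode, Pi.add_apply, smul_add]
  rw [integral_add (integrable_mode hf k θ) (integrable_mode hf' k θ), smul_add]

theorem HasFracLaplacian.const_smul {s : ℝ} {f g : S1 → V} (c : ℝ)
    (h : HasFracLaplacian s f g) : HasFracLaplacian s (c • f) (c • g) := by
  intro θ
  refine ((h θ).const_smul c).congr_fun ?_
  intro k
  simp only [mode, Pi.smul_apply]
  simp_rw [smul_comm _ c]
  rw [integral_smul, smul_comm]

variable (V) in
/-- The graph `{(f, Δ^{s/2} f) : f ∈ C^∞(S¹, V)}` inside `L^p(S¹, V) × L^p(S¹, V)`, the latter with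
the norm `‖f‖_p + ‖g‖_p`. -/
noncomputable def smoothGraph (s : ℝ) (p : ENNReal) [Fact (1 ≤ p)] :
    Submodule ℝ (WithLp 1 (Lp V p dθ × Lp V p dθ)) where
  carrier := {x | ∃ f g : S1 → V, IsSmooth f ∧ HasFracLaplacian s f g ∧
    x.fst =ᵐ[dθ] f ∧ x.snd =ᵐ[dθ] g}
  add_mem' := by
    rintro x y ⟨f, g, hf, hg, h1, h2⟩ ⟨f', g', hf', hg', h1', h2'⟩
    refine ⟨f + f', g + g', ContDiff.add hf hf', hg.add hf hf' hg', ?_, ?_⟩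
    · exact (Lp.coeFn_add x.fst y.fst).trans (h1.add h1')
    · exact (Lp.coeFn_add x.snd y.snd).trans (h2.add h2')
  zero_mem' := by
    refine ⟨0, 0, contDiff_const, ?_, Lp.coeFn_zero _ _ _, Lp.coeFn_zero _ _ _⟩
    intro θ
    simp [mode]
  smul_mem' := by
    rintro c x ⟨f, g, hf, hg, h1, h2⟩
    refine ⟨c • f, c • g, ContDiff.const_smul c hf, hg.const_smul c, ?_, ?_⟩
    · exact (Lp.coeFn_smul c x.fst).trans (h1.const_smul c)
    · exact (Lp.coeFn_smul c x.snd).trans (h2.const_smul c)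

variable (V) in
/-- The Sobolev space `W^{s,p}(S¹, V)`: the completion of `C^∞(S¹, V)` for the norm
`‖f‖_{s,p} = ‖Δ^{s/2} f‖_p + ‖f‖_p`. As `f ↦ (f, Δ^{s/2} f)` embeds `C^∞(S¹, V)` with this norm
isometrically in the Banach space `L^p × L^p` with the sum norm, the completion is the closure of
the graph of `Δ^{s/2}`, that is, the graph of the closure of `Δ^{s/2}`. -/
def W (s : ℝ) (p : ENNReal) [Fact (1 ≤ p)] : Type _ :=
  ↥((smoothGraph V s p).topologicalClosure)

variable {s : ℝ} {p : ENNReal} [Fact (1 ≤ p)]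

noncomputable instance W.instNormedAddCommGroup : NormedAddCommGroup (W V s p) :=
  inferInstanceAs (NormedAddCommGroup ↥((smoothGraph V s p).topologicalClosure))

noncomputable instance W.instNormedSpace : NormedSpace ℝ (W V s p) :=
  inferInstanceAs (NormedSpace ℝ ↥((smoothGraph V s p).topologicalClosure))

/-- The function in `L^p(S¹, V)` (defined almost everywhere) given by an element of
`W^{s,p}(S¹, V)`. -/
noncomputable def W.fn (f : W V s p) : S1 → V := f.1.fst

/-- `W^{s,p}(S¹, V)` is a Banach space when `V` is finite dimensional. -/
instance W.instCompleteSpace [FiniteDimensional ℝ V] : CompleteSpace (W V s p) := by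
  have : CompleteSpace V := FiniteDimensional.complete ℝ V
  exact (smoothGraph V s p).isClosed_topologicalClosure.completeSpace_coe

/-- The norm of `W^{s,p}(S¹, V)` on a smooth function is `‖Δ^{s/2} f‖_p + ‖f‖_p`. -/
theorem W.norm_eq (F : W V s p) {f g : S1 → V}
    (hf : F.1.fst =ᵐ[dθ] f)
    (hg : F.1.snd =ᵐ[dθ] g) :
    ‖F‖ = (eLpNorm g p dθ).toReal + (eLpNorm f p dθ).toReal := by
  change ‖F.1‖ = _
  rw [WithLp.prod_norm_eq_of_L1, Lp.norm_def, Lp.norm_def,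
    eLpNorm_congr_ae hf, eLpNorm_congr_ae hg, add_comm]

variable (s p) in
/-- `W^{s,p}(S¹, M)`, for a subset `M` of `V`: the `f ∈ W^{s,p}(S¹, V)` with `f(θ) ∈ M` for almost
every `θ`, with the topology of `W^{s,p}(S¹, V)`. -/
abbrev WMaps (M : Set V) : Type _ := {f : W V s p // ∀ᵐ θ ∂dθ, f.fn θ ∈ M}

end Sobolev

section LieGroup

/-- The smoothness that Mathlib asks for in order to define the bracket of a Lie group. -/
instance instLieGroupMinSmoothness {E H G : Type*} [NormedAddCommGroup E] [NormedSpace ℝ E]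
    [TopologicalSpace H] (I : ModelWithCorners ℝ E H) [TopologicalSpace G] [ChartedSpace H G]
    [Group G] [LieGroup I ∞ G] : LieGroup I (minSmoothness ℝ 3) G := by
  rw [minSmoothness_of_isRCLikeNormedField]
  infer_instance

variable {d n : ℕ} {G : Type*} [TopologicalSpace G] [Group G]
  [ChartedSpace (EuclideanSpace ℝ (Fin d)) G]

variable (d) in
/-- `γ : S¹ → G` is a `C^∞` loop in `G`. -/
def IsSmoothLoop (γ : S1 → G) : Prop := ContMDiff 𝓘(ℝ, ℝ) (𝓡 d) ∞ (fun x : ℝ => γ (x : S1))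

variable (d) in
/-- The derivative `dρ : 𝔤₀ = T₁G → M_n(ℂ)` of a matrix representation `ρ` of `G`. -/
noncomputable def dRep (ρ : G →* Matrix (Fin n) (Fin n) ℂ) :
    GroupLieAlgebra (𝓡 d) G →L[ℝ] Matrix (Fin n) (Fin n) ℂ :=
  mfderiv (𝓡 d) 𝓘(ℝ, Matrix (Fin n) (Fin n) ℂ) ρ (1 : G)

variable (d) in
/-- The Lie algebra `𝔤₀` of `G` as a real vector space of matrices, for a faithful matrix
representation `ρ` of `G`: the image of `dρ`. Its Lie bracket is the commutator of matrices. -/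
noncomputable def repLieAlgebra (ρ : G →* Matrix (Fin n) (Fin n) ℂ) :
    Submodule ℝ (Matrix (Fin n) (Fin n) ℂ) :=
  LinearMap.range (dRep d ρ).toLinearMap

end LieGroup

end SobolevLoops

open SobolevLoops

/-!
For `1 < p < ∞` and `sp > 1` the space `W^{s,p}(S¹, 𝔸)` of functions with values in the algebra `𝔸`
of matrices consists of continuous functions and is itself a Banach algebra up to an equivalent
norm. Once this is known, the loop group is treated like a closed subgroup of a finite-dimensional
linear group: the charts are given by the exponential map and the logarithm of that algebra, applied
pointwise.

*Analysis on the circle.* A smooth `f` with mean zero is `Γ(s)⁻¹ ∫ t^{s-1} P_t Δ^{s/2} f dt`, where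
`P_t` acts on the mode `k ≠ 0` as `e^{-t|k|}` (`hasIntegral_poisSmooth`). With elementary bounds for
the Poisson kernel this bounds the `m`-th differences of `f` in `C` and in `L^p` by the Sobolev norm
(`exists_norm_diff_pow_le`), and in particular gives the embedding in `C` (`exists_norm_le_sobNorm`)
and the continuous representative `ev`. In the other direction `Δ^{s/2}` is a singular integral of
the differences `(2 - τ_y - τ_{-y})^m f` (`hasIntegral_fracLap`). These differences obey a Leibniz
rule up to a defect that is of order `y^σ` in `L^p` for some `σ > s`, so that the defect of the
Leibniz rule for `Δ^{s/2}` is in `L^p`, and the Sobolev norm is submultiplicative up to a constant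
(`exists_sobNorm_pmul_le`). No interpolation and no multiplier theorem is needed. As the modes of
`Δ^{s/2} f` are determined by those of `f`, a Sobolev function is determined by its continuous
representative (`ev_injective`), so algebraic identities can be checked pointwise.

*The matrix group.* A continuous representation `ρ` of `G` is smooth (`contMDiff_rep`), being the
convolution of `ρ` with a bump function up to an invertible factor. It is an immersion if it is
faithful, and matrices near `1` in its image are the exponentials of small elements of the Lie
algebra. The inverse of the elements of the image is given by a linear map
(`exists_linear_inverse`), by averaging a Hermitian form, so inversion of loops is the restriction
of a bounded linear map. The notion `IsLinearGroup` collects what is used of the image.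

*The loop group.* The chart at a loop `f` is `g ↦ log(f⁻¹ g)` (`loopChart`). The inclusion in the
algebra is analytic, and maps to the loop group are analytic if they are so as maps to the algebra
(`contMDiff_of_val_comp`), which gives the Lie group axioms (`lieGroup_loop`). The bracket is
pointwise since the inclusion is multiplicative (`mfderiv_bracket`).

*Density and connectedness.* A smooth function near a Sobolev loop is projected to the group in a
tubular neighbourhood `X + Y ↦ exp(X)(1 + Y)`, both in the Sobolev norm (`dense_isSmooth_loop`) and
uniformly (`exists_isSmooth_near`). Two uniformly close smooth loops `f`, `g` are joined by the path
`f exp(t log(f⁻¹ g))`. As `G` is simply connected, a smooth loop is homotopic to a constant through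
continuous loops; replacing these by smooth loops nearby shows that it is in the component of `1`
(`mem_connectedComponent_of_homotopy`). So this component is dense, and it is closed.
-/

namespace SobolevLoops

/-! ### Translations and convolutions of continuous functions on the circle -/

section Convolution

variable {V : Type*} [NormedAddCommGroup V] [NormedSpace ℝ V]

/-- The translation operator `f ↦ f(· + y)` on `C(S¹, V)`. -/
noncomputable def trans (y : S1) : C(S1, V) →L[ℝ] C(S1, V) :=
  LinearMap.mkContinuous
    { toFun := fun f => f.comp ⟨fun θ => θ + y, by fun_prop⟩
      map_add' := fun _ _ => rfl
      map_smul' := fun _ _ => rfl } 1 (by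
    intro f
    rw [one_mul, ContinuousMap.norm_le _ (norm_nonneg _)]
    exact fun θ => f.norm_coe_le_norm _)

@[simp] theorem trans_apply (y : S1) (f : C(S1, V)) (θ : S1) : trans y f θ = f (θ + y) := rfl

theorem norm_trans_le (y : S1) (f : C(S1, V)) : ‖trans y f‖ ≤ ‖f‖ := by
  rw [ContinuousMap.norm_le _ (norm_nonneg _)]
  exact fun θ => f.norm_coe_le_norm _

theorem trans_trans (y z : S1) (f : C(S1, V)) : trans y (trans z f) = trans (y + z) f := by
  ext θ
  simp [add_assoc]

theorem trans_zero : (trans 0 : C(S1, V) →L[ℝ] C(S1, V)) = 1 := by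
  ext f θ
  simp

theorem continuous_trans (f : C(S1, V)) : Continuous fun y => trans y f :=
  (ContinuousMap.curry ⟨fun x : S1 × S1 => f (x.2 + x.1), by fun_prop⟩).continuous

theorem continuous_convIntegrand (κ : C(S1, ℝ)) (f : C(S1, V)) :
    Continuous fun t : S1 => κ t • trans (-t) f :=
  κ.continuous.smul ((continuous_trans f).comp continuous_neg)

theorem integrable_of_continuous {E : Type*} [NormedAddCommGroup E] {u : S1 → E}
    (hu : Continuous u) : Integrable u dθ :=
  hu.integrable_of_hasCompactSupport (HasCompactSupport.of_compactSpace _)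

theorem norm_integral_smul_trans_le {Z : Type*} [NormedAddCommGroup Z] [NormedSpace ℝ Z]
    (Y : C(S1, V) →L[ℝ] Z) {f : C(S1, V)} {C : ℝ}
    (hY : ∀ y, ‖Y (trans y f)‖ ≤ C) (κ : C(S1, ℝ)) :
    ‖∫ t, κ t • Y (trans (-t) f) ∂dθ‖ ≤ (∫ t, |κ t| ∂dθ) * C := by
  rw [← integral_mul_const]
  refine norm_integral_le_of_norm_le ((integrable_of_continuous (by fun_prop)).mul_const _) ?_
  refine Filter.Eventually.of_forall fun t => ?_
  rw [norm_smul, Real.norm_eq_abs]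
  exact mul_le_mul_of_nonneg_left (hY _) (abs_nonneg _)

theorem integral_abs_le_norm (κ : C(S1, ℝ)) : ∫ t, |κ t| ∂dθ ≤ ‖κ‖ := by
  have h := integral_mono (μ := (dθ : Measure S1)) (f := fun t => |κ t|) (g := fun _ => ‖κ‖)
    (integrable_of_continuous (by fun_prop)) (integrable_const _) (fun t => κ.norm_coe_le_norm t)
  simpa using h

variable [CompleteSpace V]

/-- The convolution `κ * f = ∫ κ(t) f(· - t) dt` of a real function with a `V`-valued function,
as a continuous bilinear map. -/
noncomputable def conv : C(S1, ℝ) →L[ℝ] C(S1, V) →L[ℝ] C(S1, V) :=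
  LinearMap.mkContinuous₂
    (LinearMap.mk₂ ℝ (fun κ f => ∫ t : S1, κ t • trans (-t) f ∂dθ)
      (fun κ κ' f => by
        rw [← integral_add (integrable_of_continuous (continuous_convIntegrand κ f))
          (integrable_of_continuous (continuous_convIntegrand κ' f))]
        simp [add_smul])
      (fun c κ f => by
        rw [← integral_smul]
        simp [mul_smul])
      (fun κ f f' => by
        rw [← integral_add (integrable_of_continuous (continuous_convIntegrand κ f))
          (integrable_of_continuous (continuous_convIntegrand κ f'))]
        simp)
      (fun c κ f => by
        rw [← integral_smul]
        simp [smul_comm c])) 1 (by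
    intro κ f
    rw [one_mul]
    refine (norm_integral_smul_trans_le (ContinuousLinearMap.id ℝ _) (f := f) (C := ‖f‖)
      (fun y => norm_trans_le y f) κ).trans ?_
    gcongr
    exact integral_abs_le_norm κ)

theorem conv_eq (κ : C(S1, ℝ)) (f : C(S1, V)) :
    conv κ f = ∫ t : S1, κ t • trans (-t) f ∂dθ := rfl

theorem map_conv {Z : Type*} [NormedAddCommGroup Z] [NormedSpace ℝ Z] [CompleteSpace Z]
    (Y : C(S1, V) →L[ℝ] Z) (κ : C(S1, ℝ)) (f : C(S1, V)) :
    Y (conv κ f) = ∫ t : S1, κ t • Y (trans (-t) f) ∂dθ := by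
  rw [conv_eq, ← ContinuousLinearMap.integral_comp_comm _
    (integrable_of_continuous (continuous_convIntegrand κ f))]
  simp

theorem conv_apply (κ : C(S1, ℝ)) (f : C(S1, V)) (θ : S1) :
    conv κ f θ = ∫ t : S1, κ t • f (θ - t) ∂dθ := by
  rw [conv_eq, ContinuousMap.integral_apply
    (integrable_of_continuous (continuous_convIntegrand κ f))]
  simp [sub_eq_add_neg]

theorem conv_apply' (κ : C(S1, ℝ)) (f : C(S1, V)) (θ : S1) :
    conv κ f θ = ∫ t : S1, κ (θ - t) • f t ∂dθ := by
  rw [conv_apply, ← integral_sub_left_eq_self _ _ θ]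
  simp

/-- Young's inequality for a translation invariant seminorm `‖Y ·‖`. -/
theorem norm_map_conv_le {Z : Type*} [NormedAddCommGroup Z] [NormedSpace ℝ Z] [CompleteSpace Z]
    (Y : C(S1, V) →L[ℝ] Z) (hY : ∀ y f, ‖Y (trans y f)‖ ≤ ‖Y f‖) (κ : C(S1, ℝ)) (f : C(S1, V)) :
    ‖Y (conv κ f)‖ ≤ (∫ t, |κ t| ∂dθ) * ‖Y f‖ := by
  rw [map_conv]
  exact norm_integral_smul_trans_le Y (fun y => hY y f) κ

theorem trans_conv (y : S1) (κ : C(S1, ℝ)) (f : C(S1, V)) :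
    trans y (conv κ f) = conv (trans y κ) f := by
  ext θ
  simp only [trans_apply, conv_apply']
  congr 1 with t
  congr 2
  abel

theorem conv_trans (y : S1) (κ : C(S1, ℝ)) (f : C(S1, V)) :
    conv κ (trans y f) = trans y (conv κ f) := by
  ext θ
  simp only [trans_apply, conv_apply]
  congr 1 with t
  congr 2
  abel

theorem conv_conv_comm (κ κ' : C(S1, ℝ)) (f : C(S1, V)) :
    conv κ (conv κ' f) = conv κ' (conv κ f) := by
  rw [map_conv (conv κ) κ' f, conv_eq κ']
  simp_rw [conv_trans]

theorem conv_conv (κ κ' : C(S1, ℝ)) (f : C(S1, V)) :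
    conv κ (conv κ' f) = conv (conv κ' κ) f := by
  have h := map_conv (conv.flip f) κ' κ
  simp only [ContinuousLinearMap.flip_apply] at h
  rw [h, conv_conv_comm, conv_eq κ' (conv κ f)]
  simp_rw [trans_conv]

end Convolution

/-! ### Fourier modes -/

section Modes

/-- The real part `cos (kθ)` of the `k`-th Fourier monomial. -/
noncomputable def cosk (k : ℤ) : C(S1, ℝ) :=
  ⟨fun θ => (fourier k θ).re, Complex.continuous_re.comp (fourier k).continuous⟩

theorem cosk_apply (k : ℤ) (θ : S1) : cosk k θ = (fourier k θ).re := rfl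

theorem fourier_coe_eq (k : ℤ) (x : ℝ) :
    fourier k (x : S1) = Complex.exp ((k * x : ℝ) * Complex.I) := by
  rw [fourier_coe_apply]
  congr 1
  have : (Real.pi : ℂ) ≠ 0 := by exact_mod_cast Real.pi_ne_zero
  push_cast
  field_simp

theorem cosk_coe (k : ℤ) (x : ℝ) : cosk k (x : S1) = Real.cos (k * x) := by
  rw [cosk_apply, fourier_coe_eq, Complex.exp_ofReal_mul_I_re]

theorem cosk_neg (k : ℤ) : cosk (-k) = cosk k := by
  ext θ
  rw [cosk_apply, cosk_apply, fourier_neg, Complex.conj_re]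

theorem abs_cosk_le (k : ℤ) (θ : S1) : |cosk k θ| ≤ 1 := by
  induction θ using QuotientAddGroup.induction_on with
  | H x => exact (cosk_coe k x).symm ▸ Real.abs_cos_le_one _

theorem norm_cosk_le (k : ℤ) : ‖cosk k‖ ≤ 1 :=
  (ContinuousMap.norm_le _ zero_le_one).2 (abs_cosk_le k)

theorem integral_fourier (n : ℤ) : ∫ t : S1, fourier n t ∂dθ = if n = 0 then 1 else 0 := by
  split_ifs with h
  · subst h
    simp
  · have h1 := integral_add_right_eq_self (μ := (dθ : Measure S1)) (fun t => fourier n t)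
      (↑(2 * Real.pi / 2 / n) : S1)
    simp_rw [fourier_add_half_inv_index h Real.two_pi_pos] at h1
    rw [integral_neg] at h1
    have h2 : (2 : ℂ) * ∫ t : S1, fourier n t ∂dθ = 0 := by linear_combination -h1
    simpa using h2

/-- The convolution of two modes: they are orthogonal unless they are equal up to sign. -/
theorem conv_cosk_cosk (k l : ℤ) :
    conv (cosk k) (cosk l) =
      ((if l = k then (1 / 2 : ℝ) else 0) + (if l = -k then (1 / 2 : ℝ) else 0)) • cosk k := by
  ext θ
  rw [conv_apply]
  have h : ∀ t : S1, cosk k t • cosk l (θ - t) =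
      ((1 / 2 : ℂ) * fourier l θ * (fourier (k - l) t + fourier (-k - l) t)).re := by
    intro t
    have e1 : fourier l (θ - t) = fourier l θ * fourier (-l) t := by
      simp only [fourier_apply, ← AddCircle.toCircle_add, ← Circle.coe_mul]
      congr 3
      simp [sub_eq_add_neg]
    have e2 : (fourier k t).re = ((1 / 2 : ℂ) * (fourier k t + fourier (-k) t)).re := by
      rw [fourier_neg, Complex.add_conj]; simp
    have e3 : ((1 / 2 : ℂ) * (fourier k t + fourier (-k) t)).im = 0 := by
      rw [fourier_neg, Complex.add_conj]; simp
    rw [cosk_apply, cosk_apply, e2, smul_eq_mul, sub_eq_add_neg k, sub_eq_add_neg (-k),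
      fourier_add, fourier_add, ← add_mul]
    have : ((1 / 2 : ℂ) * fourier l θ * ((fourier k t + fourier (-k) t) * fourier (-l) t)) =
      ((1 / 2 : ℂ) * (fourier k t + fourier (-k) t)) * fourier l (θ - t) := by
      rw [e1]; ring
    rw [this, Complex.mul_re ((1 / 2 : ℂ) * (fourier k t + fourier (-k) t)), e3]
    ring
  simp_rw [h]
  have hint : ∀ n : ℤ, Integrable (fun t : S1 => (fourier n t : ℂ)) dθ := fun n =>
    integrable_of_continuous (fourier n).continuous
  have h2 := integral_re (μ := (dθ : Measure S1)) (𝕜 := ℂ)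
    (f := fun t : S1 => (1 / 2 : ℂ) * fourier l θ * (fourier (k - l) t + fourier (-k - l) t))
    (((hint _).add (hint _)).const_mul _)
  simp only [RCLike.re_to_complex] at h2
  rw [h2, integral_const_mul, integral_add (hint _) (hint _), integral_fourier, integral_fourier]
  have hk : (k - l = 0) ↔ l = k := by omega
  have hk' : (-k - l = 0) ↔ l = -k := by omega
  simp only [hk, hk', ContinuousMap.smul_apply, smul_eq_mul]
  by_cases h3 : l = k
  · subst h3
    by_cases h4 : l = -l
    · simp [← h4, cosk_apply]; ring
    · simp [h4, cosk_apply]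
  · by_cases h4 : l = -k
    · subst h4
      rw [← cosk_neg]
      simp [h3, cosk_apply]
    · simp [h3, h4]

variable {V : Type*} [NormedAddCommGroup V] [NormedSpace ℝ V] [CompleteSpace V]

/-- The `k`-th Fourier mode as an operator on `C(S¹, V)`. -/
noncomputable def modeC (k : ℤ) : C(S1, V) →L[ℝ] C(S1, V) := conv (cosk k)

theorem modeC_apply (k : ℤ) (f : C(S1, V)) (θ : S1) : modeC k f θ = mode f k θ := by
  rw [modeC, conv_apply']
  rfl

theorem norm_modeC_le (k : ℤ) (f : C(S1, V)) : ‖modeC k f‖ ≤ ‖f‖ := by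
  refine (norm_map_conv_le (ContinuousLinearMap.id ℝ _) (fun y f => norm_trans_le y f)
    (cosk k) f).trans ?_
  refine mul_le_of_le_one_left (norm_nonneg _) ?_
  exact (integral_abs_le_norm _).trans (norm_cosk_le k)

/-- A pair of opposite translations acts on the modes `±k` as the scalar `2 cos (k y)`. -/
theorem trans_add_trans_modeC (y : ℝ) (k : ℤ) (f : C(S1, V)) :
    trans (y : S1) (modeC k f) + trans (-y : S1) (modeC k f) =
      (2 * Real.cos (k * y)) • modeC k f := by
  rw [modeC, trans_conv, trans_conv, ← add_apply, ← map_add,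
    ← smul_apply, ← map_smul]
  congr 2
  ext θ
  induction θ using QuotientAddGroup.induction_on with
  | H x =>
    have h1 : (x : S1) + (y : S1) = ((x + y : ℝ) : S1) := rfl
    have h2 : (x : S1) + -(y : S1) = ((x - y : ℝ) : S1) := by
      rw [sub_eq_add_neg]; rfl
    simp only [ContinuousMap.add_apply, trans_apply, ContinuousMap.smul_apply, smul_eq_mul]
    change cosk k ((x : S1) + (y : S1)) + cosk k ((x : S1) + -(y : S1)) = _ * cosk k (x : S1)
    rw [h1, h2, cosk_coe, cosk_coe, cosk_coe, mul_add, mul_sub, Real.cos_add, Real.cos_sub]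
    ring

theorem trans_modeC_zero (y : S1) (f : C(S1, V)) : trans y (modeC 0 f) = modeC 0 f := by
  rw [modeC, trans_conv]
  congr 2
  ext θ
  simp [cosk_apply]

end Modes

/-! ### Smooth functions and their Fourier series -/

section Smooth

variable {V : Type*} [NormedAddCommGroup V] [NormedSpace ℝ V]

theorem IsSmooth.exists_deriv {f : S1 → V} (hf : IsSmooth f) :
    ∃ f' : S1 → V, IsSmooth f' ∧ ∀ x : ℝ, HasDerivAt (fun x : ℝ => f x) (f' x) x := by
  have hper : Function.Periodic (deriv fun x : ℝ => f (x : S1)) (2 * Real.pi) := by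
    intro x
    rw [← deriv_comp_add_const]
    congr 1
    ext y
    simp
  have hcd : ContDiff ℝ ∞ (deriv fun x : ℝ => f (x : S1)) :=
    ((contDiff_infty_iff_deriv (f := fun x : ℝ => f (x : S1))).1 hf).2
  refine ⟨hper.lift, ?_, fun x => ?_⟩
  · have : (fun x : ℝ => hper.lift (x : S1)) = deriv fun x : ℝ => f (x : S1) := by
      ext x
      exact hper.lift_coe x
    rw [IsSmooth, this]
    exact hcd
  · rw [hper.lift_coe]
    exact ((hf : ContDiff ℝ ∞ _).differentiable (by simp) x).hasDerivAt

theorem integral_eq_interval (f : S1 → V) :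
    ∫ t : S1, f t ∂dθ = (2 * Real.pi)⁻¹ • ∫ x in (0 : ℝ)..(2 * Real.pi), f (x : S1) := by
  have h := AddCircle.intervalIntegral_preimage (2 * Real.pi) 0 f
  rw [zero_add] at h
  rw [h, AddCircle.volume_eq_smul_haarAddCircle, integral_smul_measure, smul_smul,
    ENNReal.toReal_ofReal Real.two_pi_pos.le, inv_mul_cancel₀ Real.two_pi_pos.ne', one_smul]

/-- Integration by parts: the second derivative acts on the `k`-th mode as `-k²`. -/
theorem mode_deriv_deriv [CompleteSpace V] {f f' f'' : S1 → V} (hf'' : IsSmooth f'')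
    (h1 : ∀ x : ℝ, HasDerivAt (fun x : ℝ => f x) (f' x) x)
    (h2 : ∀ x : ℝ, HasDerivAt (fun x : ℝ => f' x) (f'' x) x) (k : ℤ) (θ : S1) :
    mode f'' k θ = -((k : ℝ) ^ 2 • mode f k θ) := by
  induction θ using QuotientAddGroup.induction_on with
  | H x =>
    have hf : Continuous fun t : ℝ => f t :=
      continuous_iff_continuousAt.2 fun t => (h1 t).continuousAt
    have hfc'' : Continuous fun t : ℝ => f'' t := (show ContDiff ℝ ∞ _ from hf'').continuous
    have hcos : ∀ t : ℝ, (fourier k ((x : S1) - (t : S1))).re = Real.cos (k * (x - t)) := by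
      intro t
      rw [← cosk_coe, cosk_apply]
      rfl
    rw [mode, mode, integral_eq_interval, integral_eq_interval]
    change _ • ∫ t in _.._, (fourier k ((x : S1) - (t : S1))).re • _ =
      -(_ • _ • ∫ t in _.._, (fourier k ((x : S1) - (t : S1))).re • _)
    simp_rw [hcos]
    rw [smul_comm ((k : ℝ) ^ 2), ← smul_neg, ← intervalIntegral.integral_smul ((k : ℝ) ^ 2)]
    congr 1
    rw [← sub_eq_zero, sub_neg_eq_add, ← intervalIntegral.integral_add]
    · have hd : ∀ t ∈ Set.uIcc 0 (2 * Real.pi), HasDerivAt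
          (fun t : ℝ => Real.cos (k * (x - t)) • f' t - (k * Real.sin (k * (x - t))) • f t)
          (Real.cos (k * (x - t)) • f'' t + (k : ℝ) ^ 2 • Real.cos (k * (x - t)) • f t) t := by
        intro t _
        have hl : HasDerivAt (fun t : ℝ => (k : ℝ) * (x - t)) (-k) t := by
          simpa using ((hasDerivAt_const t x).sub (hasDerivAt_id t)).const_mul (k : ℝ)
        refine ((hl.cos.smul (h2 t)).sub ((hl.sin.const_mul (k : ℝ)).smul (h1 t))).congr_deriv ?_
        module
      rw [intervalIntegral.integral_eq_sub_of_hasDerivAt hd]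
      · have e : ((2 * Real.pi : ℝ) : S1) = ((0 : ℝ) : S1) := by
          simp
        have hs : Real.sin (k * (x - 2 * Real.pi)) = Real.sin (k * x) := by
          rw [mul_sub, Real.sin_sub_int_mul_two_pi]
        have hc : Real.cos (k * (x - 2 * Real.pi)) = Real.cos (k * x) := by
          rw [mul_sub, Real.cos_sub_int_mul_two_pi]
        simp only [e, hs, hc, sub_zero, sub_self]
      · apply Continuous.intervalIntegrable
        exact ((Real.continuous_cos.comp (by fun_prop)).smul hfc'').add
          (((Real.continuous_cos.comp (by fun_prop)).smul hf).const_smul ((k : ℝ) ^ 2))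
    · apply Continuous.intervalIntegrable
      exact (Real.continuous_cos.comp (by fun_prop)).smul hfc''
    · apply Continuous.intervalIntegrable
      exact ((Real.continuous_cos.comp (by fun_prop)).smul hf).const_smul ((k : ℝ) ^ 2)

/-- By repeated integration by parts, `k^{2n}` times the `k`-th mode is bounded. -/
theorem IsSmooth.exists_norm_modeC_le [CompleteSpace V] (n : ℕ) :
    ∀ f : C(S1, V), IsSmooth f → ∃ C, ∀ k : ℤ, ((k : ℝ) ^ 2) ^ n * ‖modeC k f‖ ≤ C := by
  induction n with
  | zero =>
    intro f _
    exact ⟨‖f‖, fun k => by simpa using norm_modeC_le k f⟩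
  | succ n ih =>
    intro f hf
    obtain ⟨f', hf', h1⟩ := hf.exists_deriv
    obtain ⟨f'', hf'', h2⟩ := hf'.exists_deriv
    obtain ⟨C, hC⟩ := ih ⟨f'', hf''.continuous⟩ hf''
    refine ⟨C, fun k => (le_of_eq ?_).trans (hC k)⟩
    have h : modeC k ⟨f'', hf''.continuous⟩ = -((k : ℝ) ^ 2 • modeC k f) := by
      ext θ
      rw [modeC_apply]
      refine (mode_deriv_deriv hf'' h1 h2 k θ).trans ?_
      rw [ContinuousMap.neg_apply, ContinuousMap.smul_apply, modeC_apply]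
    rw [h, norm_neg, norm_smul, Real.norm_of_nonneg (sq_nonneg _)]
    ring

/-- The Fourier modes of a smooth function decay faster than any power. -/
theorem IsSmooth.summable_modeC [CompleteSpace V] {f : C(S1, V)} (hf : IsSmooth f) (r : ℝ) :
    Summable fun k : ℤ => |(k : ℝ)| ^ r * ‖modeC k f‖ := by
  obtain ⟨n, hn⟩ := exists_nat_ge (r + 2)
  obtain ⟨C, hC⟩ := hf.exists_norm_modeC_le n
  have hs : Summable fun k : ℤ => C * |(k : ℝ)| ^ (-2 : ℝ) := by
    refine Summable.mul_left _ ?_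
    exact (Real.summable_abs_int_rpow (b := 2) (by norm_num))
  refine Summable.of_norm_bounded_eventually hs ?_
  rw [Filter.eventually_cofinite]
  refine (Set.finite_singleton (0 : ℤ)).subset fun k hk => ?_
  by_contra hk0
  apply hk
  have h1 : 1 ≤ |(k : ℝ)| := by exact_mod_cast Int.one_le_abs hk0
  have h0 : 0 < |(k : ℝ)| := by linarith
  rw [Real.norm_of_nonneg (by positivity), Real.rpow_neg h0.le, ← div_eq_mul_inv,
    le_div_iff₀ (by positivity)]
  refine le_trans ?_ (hC k)
  rw [← sq_abs, ← pow_mul, mul_right_comm, ← Real.rpow_add h0]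
  gcongr
  rw [← Real.rpow_natCast]
  apply Real.rpow_le_rpow_of_exponent_le h1
  push_cast
  nlinarith [n.cast_nonneg (α := ℝ)]

@[simp] theorem compLeft_apply {V' : Type*} [NormedAddCommGroup V'] [NormedSpace ℝ V']
    (T : V →L[ℝ] V') (f : C(S1, V)) (θ : S1) : T.compLeftContinuous ℝ S1 f θ = T (f θ) := rfl

theorem conv_compLeft [CompleteSpace V] {V' : Type*} [NormedAddCommGroup V'] [NormedSpace ℝ V']
    [CompleteSpace V'] (T : V →L[ℝ] V') (κ : C(S1, ℝ)) (f : C(S1, V)) :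
    conv κ (T.compLeftContinuous ℝ S1 f) = T.compLeftContinuous ℝ S1 (conv κ f) := by
  ext θ
  rw [conv_apply', compLeft_apply, conv_apply', ← ContinuousLinearMap.integral_comp_comm]
  · simp only [map_smul]
    rfl
  · exact integrable_of_continuous (by fun_prop)

theorem IsSmooth.compLeft {V' : Type*} [NormedAddCommGroup V'] [NormedSpace ℝ V']
    (T : V →L[ℝ] V') {f : S1 → V} (hf : IsSmooth f) : IsSmooth fun θ => T (f θ) :=
  T.contDiff.comp hf

/-- Comparison of the real modes with the Fourier series of Mathlib. -/
theorem modeC_real_eq (u : C(S1, ℝ)) (k : ℤ) (θ : S1) :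
    modeC k u θ = (fourierCoeff (fun t => (u t : ℂ)) k * fourier k θ).re := by
  rw [modeC_apply, mode, fourierCoeff, ← integral_mul_const]
  have h := integral_re (μ := (dθ : Measure S1)) (𝕜 := ℂ)
    (f := fun t : S1 => fourier (-k) t • (u t : ℂ) * fourier k θ)
    (integrable_of_continuous (by fun_prop))
  simp only [RCLike.re_to_complex] at h
  rw [← h]
  congr 1 with t
  have e1 : fourier k (θ - t) = fourier k θ * fourier (-k) t := by
    simp only [fourier_apply, ← Circle.coe_mul, ← AddCircle.toCircle_add]
    congr 2
    simp [sub_eq_add_neg]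
  have e2 : fourier (-k) t • (u t : ℂ) * fourier k θ = u t • fourier k (θ - t) := by
    rw [e1, Complex.real_smul, smul_eq_mul]
    ring
  rw [e2, Complex.smul_re, smul_eq_mul, smul_eq_mul, mul_comm]

theorem norm_fourierCoeff_le (u : C(S1, ℝ)) {k : ℤ} (hk : k ≠ 0) :
    ‖fourierCoeff (fun t => (u t : ℂ)) k‖ ≤ ‖modeC k u‖ + ‖modeC k u‖ := by
  refine (Complex.norm_le_abs_re_add_abs_im _).trans (add_le_add ?_ ?_)
  · refine le_trans (le_of_eq ?_) ((modeC k u).norm_coe_le_norm 0)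
    rw [modeC_real_eq]
    simp
  · refine le_trans (le_of_eq ?_) ((modeC k u).norm_coe_le_norm ((Real.pi / 2 / k : ℝ) : S1))
    have hk' : (k : ℝ) ≠ 0 := by exact_mod_cast hk
    rw [modeC_real_eq, fourier_coe_eq, mul_div_cancel₀ _ hk']
    push_cast
    rw [Complex.exp_pi_div_two_mul_I, Complex.mul_I_re, norm_neg, Real.norm_eq_abs]

/-- A smooth function is the sum of its Fourier modes, uniformly. -/
theorem IsSmooth.hasSum_modeC [CompleteSpace V] {f : C(S1, V)} (hf : IsSmooth f) :
    HasSum (fun k : ℤ => modeC k f) f := by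
  have hs : Summable fun k : ℤ => ‖modeC k f‖ := by simpa using hf.summable_modeC 0
  obtain ⟨h, hh⟩ := hs.of_norm
  suffices h = f from this ▸ hh
  ext θ
  rw [SeparatingDual.eq_iff_forall_dual_eq (R := ℝ)]
  intro l
  set u : C(S1, ℝ) := l.compLeftContinuous ℝ S1 f with hu
  have hus : IsSmooth u := IsSmooth.compLeft l hf
  have h1 : HasSum (fun k : ℤ => modeC k u θ) (l (h θ)) := by
    refine (l.hasSum (ContinuousMap.hasSum_apply hh θ)).congr_fun fun k => ?_
    rw [hu, modeC, conv_compLeft]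
    rfl
  have hsum : Summable fun k : ℤ => fourierCoeff (fun t => (u t : ℂ)) k := by
    have h0 : Summable fun k : ℤ => ‖modeC k u‖ := by simpa using hus.summable_modeC 0
    refine Summable.of_norm_bounded_eventually (h0.add h0) ?_
    rw [Filter.eventually_cofinite]
    refine (Set.finite_singleton (0 : ℤ)).subset fun k hk => ?_
    by_contra hk0
    exact hk (norm_fourierCoeff_le u hk0)
  have h2 := hasSum_fourier_series_of_summable
    (f := ⟨fun t => (u t : ℂ), Complex.continuous_ofReal.comp u.continuous⟩) hsum
  have h3 := Complex.hasSum_re (ContinuousMap.hasSum_apply h2 θ)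
  refine h1.unique ?_
  exact h3.congr_fun fun k => modeC_real_eq u k θ

end Smooth

section FracLap

variable {V : Type*} [NormedAddCommGroup V] [NormedSpace ℝ V] [CompleteSpace V]

/-- The fractional Laplacian `Δ^{s/2} f = ∑ |k|^s mode_k f` of a smooth function `f`, as a uniformly
convergent series. -/
noncomputable def fracLap (s : ℝ) (f : C(S1, V)) : C(S1, V) := ∑' k : ℤ, |(k : ℝ)| ^ s • modeC k f

theorem IsSmooth.hasSum_fracLap {f : C(S1, V)} (hf : IsSmooth f) (s : ℝ) :
    HasSum (fun k : ℤ => |(k : ℝ)| ^ s • modeC k f) (fracLap s f) := by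
  apply Summable.hasSum
  apply Summable.of_norm
  refine (hf.summable_modeC s).congr fun k => ?_
  rw [norm_smul, Real.norm_of_nonneg (by positivity)]

theorem IsSmooth.hasFracLaplacian {f : C(S1, V)} (hf : IsSmooth f) (s : ℝ) :
    HasFracLaplacian s f (fracLap s f) := by
  intro θ
  refine (ContinuousMap.hasSum_apply (hf.hasSum_fracLap s) θ).congr_fun fun k => ?_
  rw [ContinuousMap.smul_apply, modeC_apply]

end FracLap

/-! ### The Poisson kernel -/

section Poisson

/-- The Poisson kernel `∑ r^|k| cos (kθ)` for `0 ≤ r < 1`. -/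
noncomputable def pois (r : ℝ) : C(S1, ℝ) := ∑' k : ℤ, r ^ k.natAbs • cosk k

variable {r : ℝ}

theorem summable_pow_natAbs (h0 : 0 ≤ r) (h1 : r < 1) : Summable fun k : ℤ => r ^ k.natAbs := by
  have h := summable_geometric_of_lt_one h0 h1
  refine Summable.of_nat_of_neg ?_ ?_ <;> simpa using h

theorem hasSum_pois (h0 : 0 ≤ r) (h1 : r < 1) :
    HasSum (fun k : ℤ => r ^ k.natAbs • cosk k) (pois r) := by
  apply Summable.hasSum
  refine Summable.of_norm_bounded (summable_pow_natAbs h0 h1) fun k => ?_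
  rw [norm_smul, Real.norm_of_nonneg (by positivity)]
  exact mul_le_of_le_one_right (by positivity) (norm_cosk_le k)

theorem norm_sub_smul_pos (h0 : 0 ≤ r) (h1 : r < 1) (θ : S1) :
    1 - r ≤ ‖(1 : ℂ) - r * fourier 1 θ‖ := by
  have h := norm_sub_norm_le (1 : ℂ) (r * fourier 1 θ)
  rw [norm_mul, fourier_apply, Circle.norm_coe, mul_one, norm_one, Complex.norm_real,
    Real.norm_of_nonneg h0, ← fourier_apply] at h
  exact h

theorem pois_apply (h0 : 0 ≤ r) (h1 : r < 1) (θ : S1) :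
    pois r θ = (1 - r ^ 2) / ‖(1 : ℂ) - r * fourier 1 θ‖ ^ 2 := by
  set z : ℂ := fourier 1 θ with hz
  have hz1 : ‖z‖ = 1 := by rw [hz, fourier_apply, Circle.norm_coe]
  have hrz : ‖(r : ℂ) * z‖ < 1 := by
    rwa [norm_mul, hz1, mul_one, Complex.norm_real, Real.norm_of_nonneg h0]
  have hpow : ∀ n : ℕ, fourier (n : ℤ) θ = z ^ n := by
    intro n
    rw [hz, fourier_apply, fourier_apply, one_smul, natCast_zsmul, AddCircle.toCircle_nsmul]
    simp
  have hg := hasSum_geometric_of_norm_lt_one hrz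
  have hA : HasSum (fun n : ℕ => (r ^ (n : ℤ).natAbs • cosk n) θ) ((1 - (r : ℂ) * z)⁻¹).re := by
    refine (Complex.hasSum_re hg).congr_fun fun n => ?_
    rw [ContinuousMap.smul_apply, cosk_apply, hpow, Int.natAbs_natCast, mul_pow,
      ← Complex.ofReal_pow, Complex.re_ofReal_mul, smul_eq_mul]
  have hB : HasSum (fun n : ℕ => (r ^ (-((n : ℤ) + 1)).natAbs • cosk (-((n : ℤ) + 1))) θ)
      ((r * z) * (1 - (r : ℂ) * z)⁻¹).re := by
    refine (Complex.hasSum_re (hg.mul_left (r * z))).congr_fun fun n => ?_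
    have e : (n : ℤ) + 1 = ((n + 1 : ℕ) : ℤ) := by push_cast; rfl
    rw [ContinuousMap.smul_apply, cosk_neg, e, cosk_apply, hpow, Int.natAbs_neg,
      Int.natAbs_natCast, ← pow_succ', mul_pow, ← Complex.ofReal_pow, Complex.re_ofReal_mul,
      smul_eq_mul]
  have h := (ContinuousMap.hasSum_apply (hasSum_pois h0 h1) θ).unique
    (HasSum.of_nat_of_neg_add_one hA hB)
  have hpos := norm_sub_smul_pos h0 h1 θ
  rw [← hz] at hpos
  have hne : (1 : ℂ) - r * z ≠ 0 := by
    intro h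
    rw [h, norm_zero] at hpos
    linarith
  rw [h, ← Complex.add_re]
  have e1 : (1 - (r : ℂ) * z)⁻¹ + r * z * (1 - (r : ℂ) * z)⁻¹ = (1 + r * z) / (1 - r * z) := by
    field_simp
  have hsq : z.re ^ 2 + z.im ^ 2 = 1 := by
    have := Complex.sq_norm z
    rw [hz1, Complex.normSq_apply] at this
    linarith
  rw [e1, Complex.div_re, ← Complex.normSq_eq_norm_sq, ← add_div]
  congr 1
  simp only [Complex.add_re, Complex.one_re, Complex.re_ofReal_mul, Complex.sub_re,
    Complex.add_im, Complex.one_im, Complex.im_ofReal_mul, Complex.sub_im]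
  linear_combination (-r ^ 2) * hsq

theorem pois_nonneg (h0 : 0 ≤ r) (h1 : r < 1) (θ : S1) : 0 ≤ pois r θ := by
  rw [pois_apply h0 h1]
  have : 0 ≤ 1 - r ^ 2 := by nlinarith
  positivity

theorem pois_le (h0 : 0 ≤ r) (h1 : r < 1) (θ : S1) : pois r θ ≤ 2 / (1 - r) := by
  have h2 := norm_sub_smul_pos h0 h1 θ
  have h3 : 0 < 1 - r := by linarith
  have h5 : 0 < ‖(1 : ℂ) - r * fourier 1 θ‖ := by linarith
  rw [pois_apply h0 h1, div_le_div_iff₀ (by positivity) h3]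
  have h4 : (1 - r) ^ 2 ≤ ‖(1 : ℂ) - r * fourier 1 θ‖ ^ 2 := by gcongr
  nlinarith

theorem modeC_pois (h0 : 0 ≤ r) (h1 : r < 1) (k : ℤ) :
    modeC k (pois r) = r ^ k.natAbs • cosk k := by
  have h := (modeC k).hasSum (hasSum_pois h0 h1)
  simp only [map_smul] at h
  simp only [modeC, conv_cosk_cosk, smul_smul] at h
  refine h.unique ?_
  have h2 : ∀ j : ℤ, j.natAbs = k.natAbs → HasSum (fun l : ℤ =>
      (r ^ l.natAbs * (if l = j then (1 / 2 : ℝ) else 0)) • cosk k)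
      ((r ^ k.natAbs * (1 / 2)) • cosk k) := by
    intro j hj
    have := hasSum_single (f := fun l : ℤ =>
      (r ^ l.natAbs * (if l = j then (1 / 2 : ℝ) else 0)) • cosk k) j (by
        intro l hl
        simp [hl])
    simpa [hj] using this
  have h3 := (h2 k rfl).add (h2 (-k) (Int.natAbs_neg k))
  refine (h3.congr_fun fun l => ?_).trans_eq ?_
  · rw [← add_smul, mul_add]
  · rw [← add_smul]
    congr 1
    ring

theorem integral_pois (h0 : 0 ≤ r) (h1 : r < 1) : ∫ t : S1, pois r t ∂dθ = 1 := by
  have h := congrArg (fun u => u (0 : S1)) (modeC_pois h0 h1 0)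
  simp only [modeC] at h
  rw [conv_apply'] at h
  simpa [cosk_apply] using h

theorem integral_abs_pois (h0 : 0 ≤ r) (h1 : r < 1) : ∫ t : S1, |pois r t| ∂dθ = 1 := by
  simp_rw [abs_of_nonneg (pois_nonneg h0 h1 _)]
  exact integral_pois h0 h1

/-- Harnack's inequality for the Poisson kernel. -/
theorem pois_harnack (h0 : 0 ≤ r) (h1 : r < 1) (θ : S1) (y : ℝ) :
    pois r (θ + y) ≤ (1 + |y| / (1 - r)) ^ 2 * pois r θ := by
  have h2 := norm_sub_smul_pos h0 h1 (θ + y)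
  have h2' := norm_sub_smul_pos h0 h1 θ
  have h3 : 0 < 1 - r := by linarith
  have h4 : ‖(1 : ℂ) - r * fourier 1 θ‖ ≤
      (1 + |y| / (1 - r)) * ‖(1 : ℂ) - r * fourier 1 (θ + (y : S1))‖ := by
    have e : (1 : ℂ) - r * fourier 1 θ =
        ((1 : ℂ) - r * fourier 1 (θ + (y : S1))) +
          r * fourier 1 θ * (Complex.exp (Complex.I * y) - 1) := by
      have : fourier 1 (θ + (y : S1)) = fourier 1 θ * Complex.exp (Complex.I * y) := by
        have e2 := fourier_coe_eq 1 y
        rw [Int.cast_one, one_mul] at e2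
        rw [mul_comm Complex.I, ← e2]
        simp only [fourier_apply, ← Circle.coe_mul, ← AddCircle.toCircle_add, smul_add]
      rw [this]
      ring
    have h5 : ‖(r : ℂ) * fourier 1 θ * (Complex.exp (Complex.I * y) - 1)‖ ≤ |y| := by
      rw [norm_mul, norm_mul, Complex.norm_real, fourier_apply, Circle.norm_coe, mul_one,
        Real.norm_of_nonneg h0, ← Real.norm_eq_abs]
      have := Real.norm_exp_I_mul_ofReal_sub_one_le (x := y)
      nlinarith [norm_nonneg (Complex.exp (Complex.I * y) - 1), norm_nonneg y]
    rw [e]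
    refine (norm_add_le _ _).trans ?_
    have h6 : |y| ≤ |y| / (1 - r) * ‖(1 : ℂ) - r * fourier 1 (θ + (y : S1))‖ := by
      rw [div_mul_eq_mul_div, le_div_iff₀ h3]
      gcongr
    linarith
  have h9 : 0 < ‖(1 : ℂ) - r * fourier 1 θ‖ := by linarith
  have h10 : 0 < ‖(1 : ℂ) - r * fourier 1 (θ + (y : S1))‖ := by linarith
  rw [pois_apply h0 h1, pois_apply h0 h1, ← mul_div_assoc, div_le_div_iff₀
    (by positivity) (by positivity)]
  have h7 : 0 ≤ 1 - r ^ 2 := by nlinarith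
  have h8 := mul_le_mul_of_nonneg_left (pow_le_pow_left₀ (norm_nonneg _) h4 2) h7
  rw [mul_pow] at h8
  linarith

theorem abs_trans_pois_sub_le (h0 : 0 ≤ r) (h1 : r < 1) (θ : S1) (y : ℝ) :
    |pois r (θ + y) - pois r θ| ≤ (2 * (|y| / (1 - r)) + (|y| / (1 - r)) ^ 2) * pois r θ := by
  have h3 : 0 < 1 - r := by linarith
  set u := |y| / (1 - r) with hu
  have hu0 : 0 ≤ u := by positivity
  have h2 := pois_harnack h0 h1 θ y
  have h4 := pois_harnack h0 h1 (θ + y) (-y)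
  rw [abs_neg, ← hu] at h4
  rw [← hu] at h2
  have e : θ + (y : S1) + ((-y : ℝ) : S1) = θ := by
    rw [AddCircle.coe_neg, add_neg_cancel_right]
  rw [e] at h4
  have h5 := pois_nonneg h0 h1 θ
  rw [abs_le]
  constructor
  · have h6 : (1 - (2 * u + u ^ 2)) * pois r θ ≤ pois r (θ + y) := by
      by_cases h7 : 1 - (2 * u + u ^ 2) ≤ 0
      · exact (mul_nonpos_of_nonpos_of_nonneg h7 h5).trans (pois_nonneg h0 h1 _)
      · push Not at h7
        have h8 := mul_le_mul_of_nonneg_left h4 h7.le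
        have h9 : (1 - (2 * u + u ^ 2)) * (1 + u) ^ 2 ≤ 1 := by
          nlinarith [sq_nonneg (2 * u + u ^ 2)]
        have h10 := mul_le_mul_of_nonneg_right h9 (pois_nonneg h0 h1 (θ + y))
        linarith
    linarith
  · linarith

/-- The modulus of continuity in `L¹` of the Poisson kernel, a consequence of Harnack's inequality.
-/
theorem integral_abs_trans_pois_sub_le (h0 : 0 ≤ r) (h1 : r < 1) (y : ℝ) :
    ∫ t : S1, |(trans (y : S1) (pois r) - pois r) t| ∂dθ ≤ 2 * min 1 (2 * (|y| / (1 - r))) := by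
  have h3 : 0 < 1 - r := by linarith
  have hu0 : 0 ≤ |y| / (1 - r) := by positivity
  have h2 : ∫ t : S1, |(trans (y : S1) (pois r) - pois r) t| ∂dθ ≤ 2 := by
    have e : (2 : ℝ) = ∫ t : S1, (pois r (t + y) + pois r t) ∂dθ := by
      rw [integral_add (integrable_of_continuous (by fun_prop))
        (integrable_of_continuous (by fun_prop)),
        integral_add_right_eq_self (fun t => pois r t), integral_pois h0 h1]
      norm_num
    refine le_of_le_of_eq ?_ e.symm
    refine integral_mono (integrable_of_continuous (by fun_prop))
      (integrable_of_continuous (by fun_prop)) fun t => ?_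
    have e1 := pois_nonneg h0 h1 (t + y)
    have e2 := pois_nonneg h0 h1 t
    simp only [ContinuousMap.sub_apply, trans_apply]
    rw [abs_le]
    constructor <;> linarith
  have h4 : ∫ t : S1, |(trans (y : S1) (pois r) - pois r) t| ∂dθ ≤
      2 * (|y| / (1 - r)) + (|y| / (1 - r)) ^ 2 := by
    have e : 2 * (|y| / (1 - r)) + (|y| / (1 - r)) ^ 2 =
        ∫ t : S1, (2 * (|y| / (1 - r)) + (|y| / (1 - r)) ^ 2) * pois r t ∂dθ := by
      rw [integral_const_mul, integral_pois h0 h1, mul_one]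
    rw [e]
    exact integral_mono (integrable_of_continuous (by fun_prop))
      (integrable_of_continuous (by fun_prop)) fun t => abs_trans_pois_sub_le h0 h1 t y
  rw [mul_min_of_nonneg _ _ zero_le_two, le_min_iff]
  refine ⟨by linarith, ?_⟩
  by_cases h : |y| / (1 - r) ≤ 1
  · nlinarith
  · push Not at h
    linarith

/-- The Poisson kernel minus its mean decays as `r → 0`. -/
theorem integral_abs_pois_sub_one_le (h0 : 0 ≤ r) (h1 : r < 1) :
    ∫ t : S1, |(pois r - cosk 0) t| ∂dθ ≤ 4 * r := by
  have hc : ∀ t, cosk 0 t = 1 := fun t => by simp [cosk_apply]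
  by_cases hr : 1 / 2 ≤ r
  · have e : (2 : ℝ) = ∫ t : S1, (pois r t + 1) ∂dθ := by
      rw [integral_add (integrable_of_continuous (by fun_prop)) (integrable_const _),
        integral_pois h0 h1]
      simp
      norm_num
    refine le_trans ?_ (show (2 : ℝ) ≤ 4 * r by linarith)
    refine le_of_le_of_eq ?_ e.symm
    refine integral_mono (integrable_of_continuous (by fun_prop))
      (integrable_of_continuous (by fun_prop)) fun t => ?_
    have e2 := pois_nonneg h0 h1 t
    simp only [ContinuousMap.sub_apply, hc]
    rw [abs_le]
    constructor <;> linarith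
  · push Not at hr
    refine (integral_abs_le_norm _).trans ?_
    rw [ContinuousMap.norm_le _ (by linarith)]
    intro θ
    have h2 := norm_sub_smul_pos h0 h1 θ
    have hz1 : ‖fourier 1 θ‖ = 1 := by rw [fourier_apply, Circle.norm_coe]
    have h5 : ‖(1 : ℂ) - r * fourier 1 θ‖ ≤ 1 + r := by
      refine (norm_sub_le _ _).trans ?_
      rw [norm_mul, hz1, norm_one, Complex.norm_real, Real.norm_of_nonneg h0, mul_one]
    have h6 : ‖(1 : ℂ) - r * fourier 1 θ‖ ^ 2 ≤ (1 + r) ^ 2 := by gcongr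
    have h7 : (1 - r) ^ 2 ≤ ‖(1 : ℂ) - r * fourier 1 θ‖ ^ 2 := by
      have : 0 ≤ 1 - r := by linarith
      gcongr
    have h8 : 0 < ‖(1 : ℂ) - r * fourier 1 θ‖ ^ 2 := by
      have : 0 < ‖(1 : ℂ) - r * fourier 1 θ‖ := by linarith
      positivity
    rw [ContinuousMap.sub_apply, hc, pois_apply h0 h1, Real.norm_eq_abs, abs_le]
    constructor
    · have : 1 - 4 * r ≤ (1 - r ^ 2) / ‖(1 : ℂ) - r * fourier 1 θ‖ ^ 2 := by
        rw [le_div_iff₀ h8]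
        by_cases h9 : 0 ≤ 1 - 4 * r
        · nlinarith [mul_le_mul_of_nonneg_left h6 h9, sq_nonneg r]
        · nlinarith
      linarith
    · have : (1 - r ^ 2) / ‖(1 : ℂ) - r * fourier 1 θ‖ ^ 2 ≤ 1 + 4 * r := by
        rw [div_le_iff₀ h8]
        nlinarith [mul_le_mul_of_nonneg_left h7 (show 0 ≤ 1 + 4 * r by linarith),
          mul_nonneg (mul_nonneg h0 (show 0 ≤ 1 - r by linarith)) (show 0 ≤ 1 - 2 * r by linarith)]
      linarith

variable {V : Type*} [NormedAddCommGroup V] [NormedSpace ℝ V] [CompleteSpace V]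

theorem conv_pois_modeC (h0 : 0 ≤ r) (h1 : r < 1) (k : ℤ) (f : C(S1, V)) :
    conv (pois r) (modeC k f) = r ^ k.natAbs • modeC k f := by
  rw [modeC, conv_conv, ← modeC, modeC_pois h0 h1, map_smul, smul_apply]

theorem conv_pois_sub_modeC (h0 : 0 ≤ r) (h1 : r < 1) {k : ℤ} (hk : k ≠ 0) (f : C(S1, V)) :
    conv (pois r - cosk 0) (modeC k f) = r ^ k.natAbs • modeC k f := by
  have h : conv (cosk 0) (modeC k f) = 0 := by
    rw [modeC, conv_conv, conv_cosk_cosk]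
    simp [hk.symm, Ne.symm (neg_ne_zero.2 hk)]
  rw [map_sub, sub_apply, h, conv_pois_modeC h0 h1, sub_zero]

end Poisson

/-! ### Smoothing estimates for differences -/

section Differences

variable {V : Type*} [NormedAddCommGroup V] [NormedSpace ℝ V]

/-- The difference operator `f ↦ f(· + y) - f`. -/
noncomputable def diff (y : S1) : C(S1, V) →L[ℝ] C(S1, V) := trans y - 1

theorem diff_apply (y : S1) (f : C(S1, V)) : diff y f = trans y f - f := rfl

/-- A continuous linear map `Y` whose seminorm `‖Y ·‖` is invariant under translations. -/
def TransInvariant {Z : Type*} [NormedAddCommGroup Z] [NormedSpace ℝ Z]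
    (Y : C(S1, V) →L[ℝ] Z) : Prop := ∀ y f, ‖Y (trans y f)‖ ≤ ‖Y f‖

variable {Z : Type*} [NormedAddCommGroup Z] [NormedSpace ℝ Z]

theorem TransInvariant.norm_diff_le {Y : C(S1, V) →L[ℝ] Z} (hY : TransInvariant Y) (y : S1)
    (f : C(S1, V)) : ‖Y (diff y f)‖ ≤ 2 * ‖Y f‖ := by
  rw [diff_apply, map_sub]
  refine (norm_sub_le _ _).trans ?_
  linarith [hY y f]

theorem TransInvariant.norm_diff_pow_le {Y : C(S1, V) →L[ℝ] Z} (hY : TransInvariant Y) (y : S1)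
    (n : ℕ) (f : C(S1, V)) : ‖Y ((diff y ^ n) f)‖ ≤ 2 ^ n * ‖Y f‖ := by
  induction n with
  | zero => simp
  | succ n ih =>
    rw [pow_succ', mul_apply_eq_comp]
    refine (hY.norm_diff_le y _).trans ?_
    rw [pow_succ']
    linarith

variable [CompleteSpace V] [CompleteSpace Z]

theorem diff_conv (y : S1) (κ : C(S1, ℝ)) (f : C(S1, V)) :
    diff y (conv κ f) = conv (trans y κ - κ) f := by
  rw [diff_apply, trans_conv, map_sub, sub_apply]

theorem diff_pow_conv (y : S1) (n : ℕ) (κ : C(S1, ℝ)) (f : C(S1, V)) :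
    (diff y ^ n) (conv κ f) = conv κ ((diff y ^ n) f) := by
  induction n with
  | zero => simp
  | succ n ih =>
    rw [pow_succ', mul_apply_eq_comp, mul_apply_eq_comp, ih]
    rw [diff_apply, diff_apply, map_sub, conv_trans]

variable {r : ℝ}

theorem TransInvariant.norm_diff_conv_pois_le {Y : C(S1, V) →L[ℝ] Z} (hY : TransInvariant Y)
    (h0 : 0 ≤ r) (h1 : r < 1) (y : ℝ) (f : C(S1, V)) :
    ‖Y (diff (y : S1) (conv (pois r) f))‖ ≤ 2 * min 1 (2 * (|y| / (1 - r))) * ‖Y f‖ := by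
  rw [diff_conv]
  refine (norm_map_conv_le Y hY _ f).trans ?_
  gcongr
  exact integral_abs_trans_pois_sub_le h0 h1 y

/-- Each of `n` differences is absorbed by one of `n` Poisson kernels. -/
theorem TransInvariant.norm_diff_pow_conv_pois_le {Y : C(S1, V) →L[ℝ] Z} (hY : TransInvariant Y)
    (h0 : 0 ≤ r) (h1 : r < 1) (y : ℝ) (n : ℕ) (f : C(S1, V)) :
    ‖Y ((diff (y : S1) ^ n) ((conv (pois r) ^ n) f))‖ ≤
      (2 * min 1 (2 * (|y| / (1 - r)))) ^ n * ‖Y f‖ := by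
  induction n with
  | zero => simp
  | succ n ih =>
    rw [pow_succ', pow_succ', mul_apply_eq_comp, mul_apply_eq_comp,
      diff_pow_conv]
    refine (hY.norm_diff_conv_pois_le h0 h1 y _).trans ?_
    rw [pow_succ' (2 * min 1 (2 * (|y| / (1 - r)))), mul_assoc (2 * min 1 (2 * (|y| / (1 - r))))]
    have h3 : 0 < 1 - r := by linarith
    exact mul_le_mul_of_nonneg_left ih (by positivity)

omit [CompleteSpace V] [CompleteSpace Z] in
theorem min_one_pow_le {w a : ℝ} {m : ℕ} (hw : 0 ≤ w) (ha : 0 ≤ a) (ham : a ≤ m) :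
    (2 * min 1 w) ^ m ≤ 2 ^ m * w ^ a := by
  rw [mul_pow]
  gcongr
  by_cases h : w ≤ 1
  · rw [min_eq_right h, ← Real.rpow_natCast]
    rcases hw.eq_or_lt with rfl | hw'
    · by_cases hm : (m : ℝ) = 0
      · have : a = 0 := le_antisymm (hm ▸ ham) ha
        simp [this, hm]
      · rw [Real.zero_rpow hm]
        positivity
    · exact Real.rpow_le_rpow_of_exponent_ge hw' h ham
  · push Not at h
    rw [min_eq_left h.le, one_pow]
    exact Real.one_le_rpow h.le ha

/-- The regularization `P_t = (κ_r - 1) * κ_r * ⋯ * κ_r` by the Poisson kernel, with `m + 1` factors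
`κ_r` and `r = e^{-t/(m+2)}`, which acts on the modes `k ≠ 0` as `e^{-t|k|}`. -/
noncomputable def poisSmooth (V : Type*) [NormedAddCommGroup V] [NormedSpace ℝ V] [CompleteSpace V]
    (m : ℕ) (r : ℝ) : C(S1, V) →L[ℝ] C(S1, V) :=
  conv (pois r - cosk 0) * conv (pois r) ^ m * conv (pois r)

theorem poisSmooth_modeC (h0 : 0 ≤ r) (h1 : r < 1) (m : ℕ) {k : ℤ} (hk : k ≠ 0) (f : C(S1, V)) :
    poisSmooth V m r (modeC k f) = (r ^ (m + 2)) ^ k.natAbs • modeC k f := by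
  have h : ∀ n : ℕ, (conv (pois r) ^ n : C(S1, V) →L[ℝ] C(S1, V)) (modeC k f) =
      (r ^ k.natAbs) ^ n • modeC k f := by
    intro n
    induction n with
    | zero => simp
    | succ n ih =>
      rw [pow_succ', mul_apply_eq_comp, ih, map_smul, conv_pois_modeC h0 h1, smul_smul,
        pow_succ]
  rw [poisSmooth, mul_assoc, ← pow_succ, mul_apply_eq_comp, h, map_smul,
    conv_pois_sub_modeC h0 h1 hk, smul_smul, ← pow_succ, ← pow_mul, ← pow_mul,
    mul_comm k.natAbs]

/-- The decay and smoothing properties of `P_t`, with values in a seminorm `‖Y ·‖` that a single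
Poisson kernel controls by the seminorm `‖N ·‖`. -/
theorem norm_diff_pow_poisSmooth_le {Z' : Type*} [NormedAddCommGroup Z'] [NormedSpace ℝ Z']
    {Y : C(S1, V) →L[ℝ] Z} {N : C(S1, V) →L[ℝ] Z'} (hY : TransInvariant Y) {ν : ℝ}
    (hN : ∀ r : ℝ, 0 ≤ r → r < 1 → ∀ f, ‖Y (conv (pois r) f)‖ ≤ (2 / (1 - r)) ^ ν * ‖N f‖)
    (h0 : 0 ≤ r) (h1 : r < 1) {m : ℕ} {a : ℝ} (ha : 0 ≤ a) (ham : a ≤ m) (y : ℝ) (f : C(S1, V)) :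
    ‖Y ((diff (y : S1) ^ m) (poisSmooth V m r f))‖ ≤
      4 * r * (2 ^ m * (2 * (|y| / (1 - r))) ^ a) * (2 / (1 - r)) ^ ν * ‖N f‖ := by
  have h3 : 0 < 1 - r := by linarith
  rw [poisSmooth, mul_apply_eq_comp, mul_apply_eq_comp, diff_pow_conv]
  refine (norm_map_conv_le Y hY _ _).trans ?_
  refine (mul_le_mul_of_nonneg_right (integral_abs_pois_sub_one_le h0 h1) (norm_nonneg _)).trans ?_
  rw [mul_assoc (4 * r), mul_assoc (4 * r)]
  refine mul_le_mul_of_nonneg_left ?_ (by positivity)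
  refine (hY.norm_diff_pow_conv_pois_le h0 h1 y m _).trans ?_
  rw [mul_assoc]
  refine mul_le_mul (min_one_pow_le (by positivity) ha ham) (hN r h0 h1 f) (norm_nonneg _)
    (by positivity)

end Differences

section Subordination

variable {V : Type*} [NormedAddCommGroup V] [NormedSpace ℝ V] [CompleteSpace V]

open Set

/-- A series of functions that converges absolutely in `L¹` has an integrable sum; the terms may be
vector valued. -/
theorem integrable_of_hasSum {α ι E : Type*} [Countable ι] [MeasurableSpace α] {μ : Measure α}
    [NormedAddCommGroup E] [NormedSpace ℝ E] {F : ι → α → E} {f : α → E}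
    (hF : ∀ i, Integrable (F i) μ) (hsum : Summable fun i => ∫ a, ‖F i a‖ ∂μ)
    (hf : ∀ᵐ a ∂μ, HasSum (fun i => F i a) (f a)) : Integrable f μ := by
  refine ⟨aestronglyMeasurable_of_tendsto_ae Filter.atTop
    (f := fun (s : Finset ι) a => ∑ i ∈ s, F i a)
    (fun s => (integrable_finsetSum s fun i _ => hF i).1) hf, ?_⟩
  have h1 : ∫⁻ a, ‖f a‖ₑ ∂μ ≤ ∫⁻ a, ∑' i, ‖F i a‖ₑ ∂μ := by
    refine lintegral_mono_ae ?_
    filter_upwards [hf] with a ha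
    refine le_of_tendsto (ha.enorm) (Filter.Eventually.of_forall fun s => ?_)
    exact (enorm_sum_le _ _).trans (ENNReal.sum_le_tsum s)
  refine h1.trans_lt ?_
  rw [lintegral_tsum fun i => (hF i).1.enorm]
  have h2 : ∀ i, ∫⁻ a, ‖F i a‖ₑ ∂μ = ENNReal.ofReal (∫ a, ‖F i a‖ ∂μ) := fun i =>
    (ofReal_integral_norm_eq_lintegral_enorm (hF i)).symm
  simp_rw [h2]
  exact hsum.tsum_ofReal_lt_top

theorem integrableOn_rpow_mul_exp {s b : ℝ} (hs : 0 < s) (hb : 0 < b) :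
    IntegrableOn (fun t : ℝ => t ^ (s - 1) * Real.exp (-(b * t))) (Ioi 0) := by
  have h := integrableOn_rpow_mul_exp_neg_mul_rpow (s := s - 1) (p := 1) (b := b) (by linarith)
    zero_lt_one hb
  simpa using h

/-- The function `f` minus its mean is `Γ(s)⁻¹ ∫ t^{s-1} P_t (Δ^{s/2} f) dt`. -/
theorem hasIntegral_poisSmooth {f : C(S1, V)} (hf : IsSmooth f) {s : ℝ} (hs : 0 < s) (m : ℕ) :
    Real.Gamma s • (f - modeC 0 f) = ∫ t in Ioi (0 : ℝ),
      t ^ (s - 1) • poisSmooth V m (Real.exp (-(t / (m + 2)))) (fracLap s f) ∧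
    IntegrableOn (fun t : ℝ => t ^ (s - 1) •
      poisSmooth V m (Real.exp (-(t / (m + 2)))) (fracLap s f)) (Ioi 0) := by
  -- the contribution of the `k`-th mode to the integrand, integrated by the definition of `Γ`
  set F : ℤ → ℝ → C(S1, V) := fun k t =>
    (t ^ (s - 1) * Real.exp (-(|(k : ℝ)| * t))) • (|(k : ℝ)| ^ s • modeC k f) with hF
  have hk : ∀ k : ℤ, k ≠ 0 → 0 < |(k : ℝ)| := fun k h => abs_pos.2 (by exact_mod_cast h)
  have hF0 : F 0 = 0 := by
    ext t
    simp [hF, Real.zero_rpow hs.ne']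
  have hint : ∀ k : ℤ, IntegrableOn (F k) (Ioi 0) := by
    intro k
    by_cases h : k = 0
    · rw [h, hF0]
      exact integrableOn_zero
    · exact (integrableOn_rpow_mul_exp hs (hk k h)).smul_const _
  have hval : ∀ k : ℤ, k ≠ 0 → ∫ t in Ioi (0 : ℝ), t ^ (s - 1) * Real.exp (-(|(k : ℝ)| * t)) =
      (|(k : ℝ)| ^ s)⁻¹ * Real.Gamma s := by
    intro k h
    rw [Real.integral_rpow_mul_exp_neg_mul_Ioi hs (hk k h), one_div, Real.inv_rpow (hk k h).le]
  have hintF : ∀ k : ℤ, ∫ t in Ioi (0 : ℝ), F k t =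
      Real.Gamma s • (if k = 0 then 0 else modeC k f) := by
    intro k
    by_cases h : k = 0
    · simp [h, hF0]
    · rw [if_neg h]
      simp only [hF]
      rw [integral_smul_const, hval k h, smul_smul, mul_right_comm,
        inv_mul_cancel₀ (Real.rpow_pos_of_pos (hk k h) s).ne', one_mul]
  have hnorm : ∀ k : ℤ, ∫ t in Ioi (0 : ℝ), ‖F k t‖ =
      Real.Gamma s * (if k = 0 then 0 else ‖modeC k f‖) := by
    intro k
    by_cases h : k = 0
    · simp [h, hF0]
    · rw [if_neg h]
      have e : ∀ t ∈ Ioi (0 : ℝ), ‖F k t‖ =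
          (t ^ (s - 1) * Real.exp (-(|(k : ℝ)| * t))) * (|(k : ℝ)| ^ s * ‖modeC k f‖) := by
        intro t ht
        have ht' : (0 : ℝ) < t := ht
        simp only [hF]
        rw [norm_smul, norm_smul, Real.norm_of_nonneg (by positivity),
          Real.norm_of_nonneg (by positivity)]
      rw [setIntegral_congr_fun measurableSet_Ioi e, integral_mul_const, hval k h]
      have := (Real.rpow_pos_of_pos (hk k h) s).ne'
      field_simp
  have hs0 : Summable fun k : ℤ => ‖modeC k f‖ := by simpa using hf.summable_modeC 0
  have hsum : Summable fun k : ℤ => ∫ t in Ioi (0 : ℝ), ‖F k t‖ := by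
    simp_rw [hnorm]
    refine (Summable.of_nonneg_of_le ?_ ?_ hs0).mul_left _
    · intro k; split_ifs <;> positivity
    · intro k; split_ifs <;> simp
  have hpt : ∀ t ∈ Ioi (0 : ℝ), HasSum (fun k => F k t)
      (t ^ (s - 1) • poisSmooth V m (Real.exp (-(t / (m + 2)))) (fracLap s f)) := by
    intro t ht
    have ht' : (0 : ℝ) < t := ht
    have hr1 : Real.exp (-(t / (m + 2))) < 1 := by
      rw [Real.exp_lt_one_iff]
      have : 0 < t / (m + 2) := by positivity
      linarith
    have h1 := ((poisSmooth V m (Real.exp (-(t / (m + 2))))).hasSum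
      (hf.hasSum_fracLap s)).const_smul (t ^ (s - 1))
    refine h1.congr_fun fun k => ?_
    by_cases h : k = 0
    · rw [h, hF0]
      simp [Real.zero_rpow hs.ne']
    · rw [map_smul, poisSmooth_modeC (Real.exp_pos _).le hr1 m h]
      simp only [hF, smul_smul]
      congr 1
      rw [← Real.exp_nat_mul, ← Real.exp_nat_mul]
      have e : ((k.natAbs : ℕ) : ℝ) * (((m + 2 : ℕ) : ℝ) * -(t / (m + 2))) = -(|(k : ℝ)| * t) := by
        have : ((m : ℝ) + 2) ≠ 0 := by positivity
        rw [Nat.cast_natAbs]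
        push_cast
        field_simp
      rw [e]
      ring
  constructor
  · have h := hasSum_integral_of_summable_integral_norm hint hsum
    rw [← setIntegral_congr_fun measurableSet_Ioi fun t ht => (hpt t ht).tsum_eq]
    refine HasSum.unique ?_ h
    simp_rw [hintF]
    refine HasSum.const_smul _ ?_
    have h2 := hf.hasSum_modeC.sub (hasSum_ite_eq (0 : ℤ) (modeC 0 f))
    refine h2.congr_fun fun k => ?_
    split_ifs with h <;> simp [h]
  · refine integrable_of_hasSum hint hsum ((ae_restrict_mem measurableSet_Ioi).mono fun t ht => ?_)
    exact hpt t ht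

end Subordination

section Embedding

variable {V : Type*} [NormedAddCommGroup V] [NormedSpace ℝ V] [CompleteSpace V]

open Set

/-- The kernel `2 / (1 - r)` for `r = e^{-t/M}` is of order `1 + 1/t`. -/
theorem two_div_one_sub_exp_rpow_le {t M c : ℝ} (ht : 0 < t) (hM : 1 ≤ M) (hc : 0 ≤ c) :
    (2 / (1 - Real.exp (-(t / M)))) ^ c ≤ (4 * M) ^ c * (1 + t ^ (-c)) := by
  have hM0 : 0 < M := by linarith
  have hx : 0 < t / M := by positivity
  have h1 : Real.exp (-(t / M)) ≤ (1 + t / M)⁻¹ := by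
    rw [Real.exp_neg]
    apply inv_anti₀ (by positivity)
    linarith [Real.add_one_le_exp (t / M)]
  have h2 : (t / M) / (1 + t / M) ≤ 1 - Real.exp (-(t / M)) := by
    have : (t / M) / (1 + t / M) = 1 - (1 + t / M)⁻¹ := by field_simp; ring
    linarith
  have h3 : 2 / (1 - Real.exp (-(t / M))) ≤ 2 / ((t / M) / (1 + t / M)) := by
    gcongr
  have h4 : 2 / ((t / M) / (1 + t / M)) = 2 * (1 + M / t) := by field_simp; ring
  have h0 : 0 ≤ 2 / (1 - Real.exp (-(t / M))) := by
    have : 0 < (t / M) / (1 + t / M) := by positivity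
    exact div_nonneg zero_le_two (this.le.trans h2)
  rw [h4] at h3
  by_cases h : 1 ≤ t
  · have h5 : 2 / (1 - Real.exp (-(t / M))) ≤ 4 * M := by
      have : M / t ≤ M := div_le_self hM0.le h
      linarith
    calc _ ≤ (4 * M) ^ c := Real.rpow_le_rpow h0 h5 hc
      _ = (4 * M) ^ c * 1 := (mul_one _).symm
      _ ≤ _ := by
        gcongr
        linarith [Real.rpow_pos_of_pos ht (-c)]
  · push Not at h
    have h5 : 2 / (1 - Real.exp (-(t / M))) ≤ 4 * M * t⁻¹ := by
      have h6 : 1 ≤ M / t := by rw [le_div_iff₀ ht]; linarith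
      have : M / t = M * t⁻¹ := div_eq_mul_inv _ _
      linarith
    calc _ ≤ (4 * M * t⁻¹) ^ c := Real.rpow_le_rpow h0 h5 hc
      _ = (4 * M) ^ c * t ^ (-c) := by
        rw [Real.mul_rpow (by positivity) (by positivity), Real.inv_rpow ht.le, Real.rpow_neg ht.le]
      _ ≤ _ := by
        gcongr
        linarith

/-- Differences of order `m` of `f` are `O(|y|^a)` if `a ≤ m` and `a` is less than the smoothness
`s - ν` that remains in the seminorm `‖Y ·‖`. -/
theorem exists_norm_diff_pow_le {Z Z' : Type*} [NormedAddCommGroup Z] [NormedSpace ℝ Z]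
    [CompleteSpace Z] [NormedAddCommGroup Z'] [NormedSpace ℝ Z']
    {Y : C(S1, V) →L[ℝ] Z} {N : C(S1, V) →L[ℝ] Z'} (hY : TransInvariant Y) {ν : ℝ} (hν : 0 ≤ ν)
    (hN : ∀ r : ℝ, 0 ≤ r → r < 1 → ∀ f, ‖Y (conv (pois r) f)‖ ≤ (2 / (1 - r)) ^ ν * ‖N f‖)
    {m : ℕ} {a s : ℝ} (ha : 0 ≤ a) (ham : a ≤ m) (has : a + ν < s) :
    ∃ C, 0 ≤ C ∧ ∀ f : C(S1, V), IsSmooth f → ∀ y : ℝ,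
      ‖Y ((diff (y : S1) ^ m) (f - modeC 0 f))‖ ≤ C * |y| ^ a * ‖N (fracLap s f)‖ := by
  have hs : 0 < s := by linarith
  set c := a + ν with hc
  have hc0 : 0 ≤ c := by positivity
  set M : ℝ := m + 2 with hM
  have hM1 : 1 ≤ M := by rw [hM]; linarith [m.cast_nonneg (α := ℝ)]
  have hM0 : 0 < M := by linarith
  -- an integrable bound for the integrand, integrable at `0` as `s > a + ν`
  set H : ℝ → ℝ := fun t => t ^ (s - 1) * Real.exp (-(M⁻¹ * t)) +
    t ^ (s - c - 1) * Real.exp (-(M⁻¹ * t)) with hH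
  have hHint : IntegrableOn H (Ioi 0) :=
    (integrableOn_rpow_mul_exp hs (by positivity)).add
      (integrableOn_rpow_mul_exp (by linarith) (by positivity))
  have hH0 : 0 ≤ ∫ t in Ioi (0 : ℝ), H t :=
    setIntegral_nonneg measurableSet_Ioi fun t ht => by
      have : (0 : ℝ) < t := ht
      simp only [hH]
      positivity
  have hΓ := Real.Gamma_pos_of_pos hs
  refine ⟨(Real.Gamma s)⁻¹ * (4 * 2 ^ m * (4 * M) ^ c * ∫ t in Ioi (0 : ℝ), H t), by positivity,
    fun f hf y => ?_⟩
  obtain ⟨h1, h2⟩ := hasIntegral_poisSmooth hf hs m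
  rw [← hM] at h1 h2
  set T : C(S1, V) →L[ℝ] Z := Y.comp (diff (y : S1) ^ m) with hT
  have h3 : Real.Gamma s • T (f - modeC 0 f) = ∫ t in Ioi (0 : ℝ),
      t ^ (s - 1) • T (poisSmooth V m (Real.exp (-(t / M))) (fracLap s f)) := by
    rw [← map_smul, h1, ← ContinuousLinearMap.integral_comp_comm _ h2]
    simp_rw [map_smul]
  have h4 : ‖∫ t in Ioi (0 : ℝ),
      t ^ (s - 1) • T (poisSmooth V m (Real.exp (-(t / M))) (fracLap s f))‖ ≤
      ∫ t in Ioi (0 : ℝ), (4 * 2 ^ m * (4 * M) ^ c * |y| ^ a * ‖N (fracLap s f)‖) * H t := by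
    refine norm_integral_le_of_norm_le (hHint.const_mul _) ?_
    refine (ae_restrict_mem measurableSet_Ioi).mono fun t ht => ?_
    have ht' : (0 : ℝ) < t := ht
    have hr1 : Real.exp (-(t / M)) < 1 := by
      rw [Real.exp_lt_one_iff]
      have : 0 < t / M := by positivity
      linarith
    have h6 : 0 < 1 - Real.exp (-(t / M)) := by linarith
    have h5 := norm_diff_pow_poisSmooth_le hY hN (Real.exp_pos (-(t / M))).le hr1 ha ham y
      (fracLap s f)
    rw [norm_smul, Real.norm_of_nonneg (by positivity)]
    refine (mul_le_mul_of_nonneg_left h5 (by positivity)).trans ?_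
    have e1 : (2 * (|y| / (1 - Real.exp (-(t / M))))) ^ a =
        |y| ^ a * (2 / (1 - Real.exp (-(t / M)))) ^ a := by
      rw [← Real.mul_rpow (abs_nonneg _) (by positivity)]
      congr 1
      ring
    have e2 : (2 / (1 - Real.exp (-(t / M)))) ^ a * (2 / (1 - Real.exp (-(t / M)))) ^ ν =
        (2 / (1 - Real.exp (-(t / M)))) ^ c := by
      rw [hc, Real.rpow_add (by positivity)]
    have e3 := two_div_one_sub_exp_rpow_le ht' hM1 hc0
    have e4 : H t = t ^ (s - 1) * Real.exp (-(t / M)) * (1 + t ^ (-c)) := by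
      have : s - c - 1 = (s - 1) + -c := by ring
      simp only [hH]
      rw [this, Real.rpow_add ht', show M⁻¹ * t = t / M by ring]
      ring
    rw [e1, e4]
    calc _ = (t ^ (s - 1) * Real.exp (-(t / M)) * (4 * 2 ^ m) * |y| ^ a * ‖N (fracLap s f)‖) *
          ((2 / (1 - Real.exp (-(t / M)))) ^ a * (2 / (1 - Real.exp (-(t / M)))) ^ ν) := by ring
      _ ≤ (t ^ (s - 1) * Real.exp (-(t / M)) * (4 * 2 ^ m) * |y| ^ a * ‖N (fracLap s f)‖) *
          ((4 * M) ^ c * (1 + t ^ (-c))) := by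
        rw [e2]
        gcongr
      _ = _ := by ring
  rw [integral_const_mul, ← h3, norm_smul, Real.norm_of_nonneg hΓ.le] at h4
  change ‖T (f - modeC 0 f)‖ ≤ _
  rw [mul_assoc, mul_assoc, inv_mul_eq_div, le_div_iff₀ hΓ]
  linarith

variable (V) in
/-- The inclusion of `C(S¹, V)` in `L^p(S¹, V)`. -/
noncomputable def toLpC (p : ENNReal) [Fact (1 ≤ p)] : C(S1, V) →L[ℝ] Lp V p dθ :=
  ContinuousMap.toLp p dθ ℝ

variable {p : ENNReal} [Fact (1 ≤ p)]

omit [CompleteSpace V] in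
theorem norm_toLpC (f : C(S1, V)) : ‖toLpC V p f‖ = (eLpNorm f p dθ).toReal := by
  rw [Lp.norm_def]
  exact congrArg ENNReal.toReal
    (eLpNorm_congr_ae (ContinuousMap.coeFn_toLp (p := p) (𝕜 := ℝ) dθ f))

omit [CompleteSpace V] in
theorem norm_toLpC_le (f : C(S1, V)) : ‖toLpC V p f‖ ≤ ‖f‖ := by
  have h := ((toLpC V p).le_opNorm f).trans (mul_le_mul_of_nonneg_right
    (ContinuousMap.toLp_norm_le (E := V) (p := p) (𝕜 := ℝ) (dθ : Measure S1)) (norm_nonneg f))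
  simpa [measureUnivNNReal] using h

omit [CompleteSpace V] in
theorem transInvariant_toLpC : TransInvariant (toLpC V p) := by
  intro y f
  rw [norm_toLpC, norm_toLpC]
  have h := eLpNorm_comp_measurePreserving (p := p) (g := f) f.continuous.aestronglyMeasurable
    (measurePreserving_add_right (dθ : Measure S1) y)
  exact le_of_eq (congrArg ENNReal.toReal h)

omit [CompleteSpace V] in
theorem transInvariant_id : TransInvariant (ContinuousLinearMap.id ℝ C(S1, V)) :=
  fun y f => norm_trans_le y f

theorem norm_toLpC_conv_pois_le (r : ℝ) (h0 : 0 ≤ r) (h1 : r < 1) (f : C(S1, V)) :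
    ‖toLpC V p (conv (pois r) f)‖ ≤ (2 / (1 - r)) ^ (0 : ℝ) * ‖toLpC V p f‖ := by
  have h := norm_map_conv_le (toLpC V p) transInvariant_toLpC (pois r) f
  rwa [integral_abs_pois h0 h1, ← Real.rpow_zero (2 / (1 - r))] at h

/-- Hölder's inequality for the Poisson integral. -/
theorem norm_conv_pois_le (hp : 1 < p) (hp_top : p < ⊤) (r : ℝ) (h0 : 0 ≤ r) (h1 : r < 1)
    (f : C(S1, V)) :
    ‖conv (pois r) f‖ ≤ (2 / (1 - r)) ^ (1 / p.toReal) * ‖toLpC V p f‖ := by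
  have h3 : 0 < 1 - r := by linarith
  have hP : 1 < p.toReal := by
    rw [← ENNReal.toReal_one]
    exact (ENNReal.toReal_lt_toReal ENNReal.one_ne_top hp_top.ne).2 hp
  set P := p.toReal with hPdef
  set Q := P.conjExponent with hQdef
  have hPQ : P.HolderConjugate Q := Real.HolderConjugate.conjExponent hP
  rw [ContinuousMap.norm_le _ (by positivity)]
  intro θ
  rw [conv_apply']
  have hc1 : Continuous fun t : S1 => ‖f t‖ := by fun_prop
  have hc2 : Continuous fun t : S1 => pois r (θ - t) := by fun_prop
  have hmem : ∀ {u : S1 → ℝ} (_ : Continuous u) (q : ENNReal), MemLp u q dθ := fun hu q =>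
    hu.memLp_of_hasCompactSupport (HasCompactSupport.of_compactSpace _)
  have h4 := integral_mul_le_Lp_mul_Lq_of_nonneg (μ := (dθ : Measure S1)) hPQ
    (f := fun t => ‖f t‖) (g := fun t => pois r (θ - t))
    (Filter.Eventually.of_forall fun t => norm_nonneg _)
    (Filter.Eventually.of_forall fun t => pois_nonneg h0 h1 _) (hmem hc1 _) (hmem hc2 _)
  have h5 : ∫ t : S1, pois r (θ - t) ^ Q ∂dθ ≤ (2 / (1 - r)) ^ (Q - 1) := by
    have e : (2 / (1 - r)) ^ (Q - 1) =
        ∫ t : S1, (2 / (1 - r)) ^ (Q - 1) * pois r (θ - t) ∂dθ := by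
      rw [integral_const_mul, integral_sub_left_eq_self (fun t => pois r t), integral_pois h0 h1,
        mul_one]
    rw [e]
    refine integral_mono (integrable_of_continuous ?_) (integrable_of_continuous (by fun_prop)) ?_
    · exact hc2.rpow_const fun t => Or.inr hPQ.symm.nonneg
    · intro t
      have e2 := pois_nonneg h0 h1 (θ - t)
      have e3 : pois r (θ - t) ^ Q = pois r (θ - t) ^ (Q - 1) * pois r (θ - t) := by
        rcases e2.eq_or_lt with h | h
        · rw [← h, Real.zero_rpow hPQ.symm.pos.ne', mul_zero]
        · rw [← Real.rpow_add_one h.ne', sub_add_cancel]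
      simp only [e3]
      gcongr
      · exact sub_nonneg.2 hPQ.symm.lt.le
      · exact pois_le h0 h1 _
  have h6 : ‖toLpC V p f‖ = (∫ t : S1, ‖f t‖ ^ P ∂dθ) ^ (1 / P) := by
    rw [norm_toLpC, MemLp.eLpNorm_eq_integral_rpow_norm (zero_lt_one.trans hp).ne' hp_top.ne
      (f.continuous.memLp_of_hasCompactSupport (HasCompactSupport.of_compactSpace _)),
      ENNReal.toReal_ofReal (by positivity), one_div]
  calc ‖∫ t : S1, pois r (θ - t) • f t ∂dθ‖ ≤ ∫ t : S1, ‖f t‖ * pois r (θ - t) ∂dθ := by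
        refine norm_integral_le_of_norm_le (integrable_of_continuous (by fun_prop)) ?_
        refine Filter.Eventually.of_forall fun t => ?_
        rw [norm_smul, Real.norm_of_nonneg (pois_nonneg h0 h1 _), mul_comm]
    _ ≤ _ := h4
    _ ≤ (∫ t : S1, ‖f t‖ ^ P ∂dθ) ^ (1 / P) * ((2 / (1 - r)) ^ (Q - 1)) ^ (1 / Q) := by
        gcongr
        · exact integral_nonneg fun t => by
            have := pois_nonneg h0 h1 (θ - t)
            positivity
        · exact hPQ.symm.one_div_nonneg
    _ = _ := by
        rw [h6, mul_comm, ← Real.rpow_mul (by positivity)]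
        congr 2
        have := hPQ.inv_add_inv_eq_one
        have hQ0 := hPQ.symm.pos.ne'
        field_simp at this ⊢
        linarith

end Embedding

section SobolevNorm

variable {V : Type*} [NormedAddCommGroup V] [NormedSpace ℝ V] [CompleteSpace V]
  {p : ENNReal} [Fact (1 ≤ p)] {s : ℝ}

/-- The Sobolev norm `‖Δ^{s/2} f‖_p + ‖f‖_p` of a smooth function. -/
noncomputable def sobNorm (s : ℝ) (p : ENNReal) [Fact (1 ≤ p)] (f : C(S1, V)) : ℝ :=
  ‖toLpC V p (fracLap s f)‖ + ‖toLpC V p f‖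

theorem sobNorm_nonneg (f : C(S1, V)) : 0 ≤ sobNorm s p f := by
  unfold sobNorm
  positivity

theorem norm_toLpC_fracLap_le (f : C(S1, V)) : ‖toLpC V p (fracLap s f)‖ ≤ sobNorm s p f :=
  le_add_of_nonneg_right (norm_nonneg _)

theorem norm_toLpC_le_sobNorm (f : C(S1, V)) : ‖toLpC V p f‖ ≤ sobNorm s p f :=
  le_add_of_nonneg_left (norm_nonneg _)

theorem pois_zero : pois 0 = cosk 0 := by
  refine (hasSum_pois le_rfl zero_lt_one).unique ?_
  have h := hasSum_single (f := fun k : ℤ => (0 : ℝ) ^ k.natAbs • cosk k) 0 (by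
    intro k hk
    simp [hk])
  simpa using h

theorem diff_modeC_zero (y : S1) (f : C(S1, V)) : diff y (modeC 0 f) = 0 := by
  rw [diff_apply, trans_modeC_zero, sub_self]

theorem diff_pow_sub_modeC_zero (y : S1) {m : ℕ} (hm : m ≠ 0) (f : C(S1, V)) :
    (diff y ^ m) (f - modeC 0 f) = (diff y ^ m) f := by
  obtain ⟨n, rfl⟩ := Nat.exists_eq_succ_of_ne_zero hm
  rw [Nat.succ_eq_add_one, pow_succ, mul_apply_eq_comp, mul_apply_eq_comp, map_sub,
    diff_modeC_zero, sub_zero]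

/-- The Sobolev embedding `W^{s,p} ⊂ C` for `sp > 1`. -/
theorem exists_norm_le_sobNorm (V : Type*) [NormedAddCommGroup V] [NormedSpace ℝ V]
    [CompleteSpace V] (hp : 1 < p) (hp_top : p < ⊤) (hs : 1 / p.toReal < s) :
    ∃ C, 0 ≤ C ∧ ∀ f : C(S1, V), IsSmooth f → ‖f‖ ≤ C * sobNorm s p f := by
  obtain ⟨C, hC, h⟩ := exists_norm_diff_pow_le (V := V)
    (Y := ContinuousLinearMap.id ℝ C(S1, V)) (N := toLpC V p) (s := s) transInvariant_id
    (ν := 1 / p.toReal) (by positivity) (norm_conv_pois_le hp hp_top) (m := 0) (a := 0) le_rfl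
    (by simp) (by simpa using hs)
  -- no differences bound `f - modeC 0 f`, and the Poisson kernel for `r = 0` bounds the mean
  refine ⟨C + 2 ^ (1 / p.toReal), by positivity, fun f hf => ?_⟩
  have h1 := h f hf 0
  have h2 := norm_conv_pois_le hp hp_top 0 le_rfl zero_lt_one f
  simp only [pow_zero, ContinuousLinearMap.coe_id', id_eq, Real.rpow_zero, mul_one] at h1
  change ‖f - modeC 0 f‖ ≤ _ at h1
  rw [pois_zero, sub_zero, div_one] at h2
  change ‖modeC 0 f‖ ≤ _ at h2
  calc ‖f‖ = ‖(f - modeC 0 f) + modeC 0 f‖ := by rw [sub_add_cancel]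
    _ ≤ _ := norm_add_le _ _
    _ ≤ C * sobNorm s p f + 2 ^ (1 / p.toReal) * sobNorm s p f := by
      refine add_le_add (h1.trans ?_) (h2.trans ?_)
      · gcongr
        exact norm_toLpC_fracLap_le f
      · gcongr
        exact norm_toLpC_le_sobNorm f
    _ = _ := by ring

/-- The embedding of Sobolev functions in Hölder functions. -/
theorem exists_norm_diff_le_sobNorm (V : Type*) [NormedAddCommGroup V] [NormedSpace ℝ V]
    [CompleteSpace V] (hp : 1 < p) (hp_top : p < ⊤) {b : ℝ} (hb : 0 ≤ b) (hb1 : b ≤ 1)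
    (hbs : b + 1 / p.toReal < s) :
    ∃ C, 0 ≤ C ∧ ∀ f : C(S1, V), IsSmooth f → ∀ y : ℝ,
      ‖diff (y : S1) f‖ ≤ C * |y| ^ b * sobNorm s p f := by
  obtain ⟨C, hC, h⟩ := exists_norm_diff_pow_le (V := V)
    (Y := ContinuousLinearMap.id ℝ C(S1, V)) (N := toLpC V p) (s := s) transInvariant_id
    (ν := 1 / p.toReal) (by positivity) (norm_conv_pois_le hp hp_top) (m := 1) (a := b) hb
    (by simpa using hb1) hbs
  refine ⟨C, hC, fun f hf y => ?_⟩
  have h1 := h f hf y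
  rw [diff_pow_sub_modeC_zero _ one_ne_zero, pow_one] at h1
  refine h1.trans ?_
  gcongr
  exact norm_toLpC_fracLap_le f

/-- The embedding of `W^{s,p}` in a Besov space `B^a_{p,∞}` for `a < s`. -/
theorem exists_norm_toLpC_diff_pow_le_sobNorm (V : Type*) [NormedAddCommGroup V] [NormedSpace ℝ V]
    [CompleteSpace V] {m : ℕ} (hm : m ≠ 0) {a : ℝ} (ha : 0 ≤ a) (ham : a ≤ m) (has : a < s) :
    ∃ C, 0 ≤ C ∧ ∀ f : C(S1, V), IsSmooth f → ∀ y : ℝ,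
      ‖toLpC V p ((diff (y : S1) ^ m) f)‖ ≤ C * |y| ^ a * sobNorm s p f := by
  have : CompleteSpace (Lp V p (dθ : Measure S1)) := inferInstance
  obtain ⟨C, hC, h⟩ := exists_norm_diff_pow_le (V := V)
    (Y := toLpC V p) (N := toLpC V p) (s := s) transInvariant_toLpC
    (ν := 0) le_rfl norm_toLpC_conv_pois_le (m := m) (a := a) ha ham (by simpa using has)
  refine ⟨C, hC, fun f hf y => ?_⟩
  have h1 := h f hf y
  rw [diff_pow_sub_modeC_zero _ hm] at h1
  refine h1.trans ?_
  gcongr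
  exact norm_toLpC_fracLap_le f

end SobolevNorm

/-! ### The fractional Laplacian as a singular integral -/

section SingularIntegral

open Set

variable {V : Type*} [NormedAddCommGroup V] [NormedSpace ℝ V]

/-- The symmetric second difference `f ↦ 2 f - f(· + y) - f(· - y)`. -/
noncomputable def symDiff2 (y : S1) : C(S1, V) →L[ℝ] C(S1, V) := diff y * diff (-y)

theorem symDiff2_apply (y : S1) (f : C(S1, V)) :
    symDiff2 y f = (2 : ℝ) • f - (trans y f + trans (-y) f) := by
  rw [symDiff2, mul_apply_eq_comp, diff_apply, diff_apply, map_sub, trans_trans, add_neg_cancel,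
    trans_zero, one_apply_eq_self]
  module

theorem symDiff2_pow_modeC [CompleteSpace V] (y : ℝ) (m : ℕ) (k : ℤ) (f : C(S1, V)) :
    (symDiff2 (y : S1) ^ m) (modeC k f) = (2 - 2 * Real.cos (k * y)) ^ m • modeC k f := by
  induction m with
  | zero => simp
  | succ m ih =>
    rw [pow_succ', mul_apply_eq_comp, ih, map_smul, symDiff2_apply]
    change _ • (_ - (trans (y : S1) _ + trans (-(y : S1)) _)) = _
    rw [trans_add_trans_modeC, ← sub_smul, smul_smul, pow_succ]

/-- The constant `∫₀^∞ (2 - 2 cos y)^m y^{-1-s} dy`. -/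
noncomputable def singConst (m : ℕ) (s : ℝ) : ℝ :=
  ∫ y in Ioi (0 : ℝ), (2 - 2 * Real.cos y) ^ m * y ^ (-1 - s)

theorem two_sub_two_cos_nonneg (y : ℝ) : 0 ≤ 2 - 2 * Real.cos y := by
  linarith [Real.cos_le_one y]

theorem integrableOn_min_one_rpow {s σ : ℝ} (hs : 0 < s) (hσ : s < σ) :
    IntegrableOn (fun y : ℝ => y ^ (-1 - s) * min 1 (y ^ σ)) (Ioi 0) := by
  rw [← Ioc_union_Ioi_eq_Ioi zero_le_one, integrableOn_union]
  have hm : Measurable fun y : ℝ => y ^ (-1 - s) * min 1 (y ^ σ) := by fun_prop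
  constructor
  · have h1 : IntegrableOn (fun y : ℝ => y ^ (σ - s - 1)) (Ioc 0 1) := by
      rw [← intervalIntegrable_iff_integrableOn_Ioc_of_le zero_le_one]
      exact intervalIntegral.intervalIntegrable_rpow' (by linarith)
    refine h1.mono' hm.aestronglyMeasurable ?_
    refine (ae_restrict_mem measurableSet_Ioc).mono fun y hy => ?_
    have hy0 : 0 < y := hy.1
    rw [Real.norm_of_nonneg (by positivity)]
    calc y ^ (-1 - s) * min 1 (y ^ σ) ≤ y ^ (-1 - s) * y ^ σ := by
          gcongr; exact min_le_right _ _
      _ = _ := by rw [← Real.rpow_add hy0]; congr 1; ring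
  · have h1 : IntegrableOn (fun y : ℝ => y ^ (-1 - s)) (Ioi 1) :=
      integrableOn_Ioi_rpow_of_lt (by linarith) zero_lt_one
    refine h1.mono' hm.aestronglyMeasurable ?_
    refine (ae_restrict_mem measurableSet_Ioi).mono fun y hy => ?_
    have hy0 : 0 < y := zero_lt_one.trans hy
    rw [Real.norm_of_nonneg (by positivity)]
    exact mul_le_of_le_one_right (by positivity) (min_le_left _ _)

theorem integrableOn_singConst {m : ℕ} {s : ℝ} (hs : 0 < s) (hm : s < 2 * m) :
    IntegrableOn (fun y : ℝ => (2 - 2 * Real.cos y) ^ m * y ^ (-1 - s)) (Ioi 0) := by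
  refine ((integrableOn_min_one_rpow hs hm).const_mul (4 ^ m)).mono' (by fun_prop) ?_
  refine (ae_restrict_mem measurableSet_Ioi).mono fun y hy => ?_
  have hy0 : (0 : ℝ) < y := hy
  have h0 := two_sub_two_cos_nonneg y
  have h1 : (2 - 2 * Real.cos y) ^ m ≤ 4 ^ m * min 1 (y ^ (2 * m : ℝ)) := by
    rw [mul_min_of_nonneg _ _ (by positivity), le_min_iff]
    constructor
    · rw [mul_one]
      gcongr
      linarith [Real.neg_one_le_cos y]
    · have h2 : 2 - 2 * Real.cos y ≤ y ^ 2 := by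
        linarith [Real.one_sub_sq_div_two_le_cos (x := y)]
      calc (2 - 2 * Real.cos y) ^ m ≤ (y ^ 2) ^ m := by gcongr
        _ = 1 * y ^ (2 * m : ℝ) := by
          rw [← pow_mul, one_mul, ← Real.rpow_natCast]; push_cast; rfl
        _ ≤ _ := by
          gcongr
          exact one_le_pow₀ (by norm_num)
  rw [Real.norm_of_nonneg (by positivity)]
  calc _ ≤ 4 ^ m * min 1 (y ^ (2 * m : ℝ)) * y ^ (-1 - s) := by gcongr
    _ = _ := by ring

theorem singConst_pos {m : ℕ} {s : ℝ} (hs : 0 < s) (hm : s < 2 * m) : 0 < singConst m s := by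
  rw [singConst, setIntegral_pos_iff_support_of_nonneg_ae _ (integrableOn_singConst hs hm)]
  · have hsub : Ioo (0 : ℝ) 1 ⊆
        Function.support (fun y : ℝ => (2 - 2 * Real.cos y) ^ m * y ^ (-1 - s)) ∩ Ioi 0 := by
      intro y hy
      refine ⟨?_, hy.1⟩
      have h1 : Real.cos y < 1 := by
        have := Real.cos_lt_cos_of_nonneg_of_le_pi_div_two le_rfl
          (by linarith [hy.2, Real.pi_gt_three]) hy.1
        rwa [Real.cos_zero] at this
      have h2 : 0 < 2 - 2 * Real.cos y := by linarith
      have h3 : 0 < y := hy.1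
      rw [Function.mem_support]
      positivity
    refine lt_of_lt_of_le ?_ (measure_mono hsub)
    simp
  · refine (ae_restrict_mem measurableSet_Ioi).mono fun y hy => ?_
    have hy0 : (0 : ℝ) < y := hy
    have h0 := two_sub_two_cos_nonneg y
    simp only [Pi.zero_apply]
    positivity

/-- The singular integral acts on the `k`-th mode as a multiple of `|k|^s`, by scaling. -/
theorem integrableOn_singConst_mul {m : ℕ} {s : ℝ} (hs : 0 < s) (hm : s < 2 * m) (k : ℤ) :
    IntegrableOn (fun y : ℝ => (2 - 2 * Real.cos (k * y)) ^ m * y ^ (-1 - s)) (Ioi 0) ∧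
    ∫ y in Ioi (0 : ℝ), (2 - 2 * Real.cos (k * y)) ^ m * y ^ (-1 - s) =
      |(k : ℝ)| ^ s * singConst m s := by
  have hm0 : m ≠ 0 := by
    rintro rfl
    simp at hm
    linarith
  by_cases hk : k = 0
  · simp [hk, Real.zero_rpow hs.ne', hm0]
  have hk' : 0 < |(k : ℝ)| := abs_pos.2 (by exact_mod_cast hk)
  have e : EqOn (fun y : ℝ => (2 - 2 * Real.cos (k * y)) ^ m * y ^ (-1 - s))
      (fun y : ℝ => |(k : ℝ)| ^ (1 + s) *
        ((2 - 2 * Real.cos (|(k : ℝ)| * y)) ^ m * (|(k : ℝ)| * y) ^ (-1 - s))) (Ioi 0) := by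
    intro y hy
    have hy0 : (0 : ℝ) < y := hy
    have e1 : Real.cos (|(k : ℝ)| * y) = Real.cos (k * y) := by
      rcases abs_choice (k : ℝ) with h | h
      · rw [h]
      · rw [h, neg_mul, Real.cos_neg]
    have e2 : |(k : ℝ)| ^ (1 + s) * |(k : ℝ)| ^ (-1 - s) = 1 := by
      rw [← Real.rpow_add hk']
      simp
    simp only [e1]
    rw [Real.mul_rpow hk'.le hy0.le]
    linear_combination (-(2 - 2 * Real.cos (k * y)) ^ m * y ^ (-1 - s)) * e2
  have hI := (integrableOn_Ioi_comp_mul_left_iff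
    (fun y : ℝ => (2 - 2 * Real.cos y) ^ m * y ^ (-1 - s)) 0 hk').2
    (by rw [mul_zero]; exact integrableOn_singConst hs hm)
  constructor
  · exact (integrableOn_congr_fun e measurableSet_Ioi).2 (hI.const_mul _)
  · rw [setIntegral_congr_fun measurableSet_Ioi e, integral_const_mul,
      integral_comp_mul_left_Ioi (fun y : ℝ => (2 - 2 * Real.cos y) ^ m * y ^ (-1 - s)) 0 hk',
      mul_zero, smul_eq_mul, ← mul_assoc, singConst]
    congr 1
    rw [add_comm, Real.rpow_add_one hk'.ne', mul_assoc, mul_inv_cancel₀ hk'.ne', mul_one]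

/-- The fractional Laplacian is, up to a constant, `∫₀^∞ (2 - τ_y - τ_{-y})^m f y^{-1-s} dy`. -/
theorem hasIntegral_fracLap [CompleteSpace V] {f : C(S1, V)} (hf : IsSmooth f) {m : ℕ} {s : ℝ}
    (hs : 0 < s) (hm : s < 2 * m) :
    singConst m s • fracLap s f =
      ∫ y in Ioi (0 : ℝ), y ^ (-1 - s) • (symDiff2 (y : S1) ^ m) f ∧
    IntegrableOn (fun y : ℝ => y ^ (-1 - s) • (symDiff2 (y : S1) ^ m) f) (Ioi 0) := by
  set F : ℤ → ℝ → C(S1, V) := fun k y =>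
    ((2 - 2 * Real.cos (k * y)) ^ m * y ^ (-1 - s)) • modeC k f with hF
  have hint : ∀ k : ℤ, IntegrableOn (F k) (Ioi 0) := fun k =>
    (integrableOn_singConst_mul hs hm k).1.smul_const _
  have hintF : ∀ k : ℤ, ∫ y in Ioi (0 : ℝ), F k y =
      singConst m s • |(k : ℝ)| ^ s • modeC k f := by
    intro k
    simp only [hF]
    rw [integral_smul_const, (integrableOn_singConst_mul hs hm k).2, smul_smul,
      mul_comm (|(k : ℝ)| ^ s)]
  have hnorm : ∀ k : ℤ, ∫ y in Ioi (0 : ℝ), ‖F k y‖ =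
      singConst m s * (|(k : ℝ)| ^ s * ‖modeC k f‖) := by
    intro k
    have e : EqOn (fun y => ‖F k y‖)
        (fun y => ((2 - 2 * Real.cos (k * y)) ^ m * y ^ (-1 - s)) * ‖modeC k f‖) (Ioi 0) := by
      intro y hy
      have hy' : (0 : ℝ) < y := hy
      have h0 := two_sub_two_cos_nonneg (k * y)
      simp only [hF]
      rw [norm_smul, Real.norm_of_nonneg (by positivity)]
    rw [setIntegral_congr_fun measurableSet_Ioi e, integral_mul_const,
      (integrableOn_singConst_mul hs hm k).2]
    ring
  have hsum : Summable fun k : ℤ => ∫ y in Ioi (0 : ℝ), ‖F k y‖ := by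
    simp_rw [hnorm]
    exact (hf.summable_modeC s).mul_left _
  have hpt : ∀ y : ℝ, HasSum (fun k => F k y) (y ^ (-1 - s) • (symDiff2 (y : S1) ^ m) f) := by
    intro y
    refine (((symDiff2 (y : S1) ^ m).hasSum hf.hasSum_modeC).const_smul (y ^ (-1 - s))).congr_fun
      fun k => ?_
    rw [symDiff2_pow_modeC, smul_smul, mul_comm (y ^ (-1 - s))]
  constructor
  · have h := hasSum_integral_of_summable_integral_norm hint hsum
    simp_rw [fun y => (hpt y).tsum_eq] at h
    refine HasSum.unique ?_ h
    simp_rw [hintF]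
    exact (hf.hasSum_fracLap s).const_smul _
  · exact integrable_of_hasSum hint hsum (Filter.Eventually.of_forall hpt)

end SingularIntegral

/-! ### Products of smooth functions in the Sobolev norm -/

section Product

variable {V₁ V₂ V₃ : Type*} [NormedAddCommGroup V₁] [NormedSpace ℝ V₁]
  [NormedAddCommGroup V₂] [NormedSpace ℝ V₂] [NormedAddCommGroup V₃] [NormedSpace ℝ V₃]

/-- The pointwise product `B(f, g)` of continuous functions for a continuous bilinear map `B`. -/
noncomputable def pmul (B : V₁ →L[ℝ] V₂ →L[ℝ] V₃) :
    C(S1, V₁) →L[ℝ] C(S1, V₂) →L[ℝ] C(S1, V₃) :=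
  LinearMap.mkContinuous₂
    (LinearMap.mk₂ ℝ (fun f g => ⟨fun θ => B (f θ) (g θ), by fun_prop⟩)
      (fun f f' g => by ext; simp) (fun c f g => by ext; simp)
      (fun f g g' => by ext; simp) (fun c f g => by ext; simp)) ‖B‖ (by
    intro f g
    rw [ContinuousMap.norm_le _ (by positivity)]
    intro θ
    exact (B.le_opNorm₂ _ _).trans (by gcongr <;> exact ContinuousMap.norm_coe_le_norm _ _))

variable (B : V₁ →L[ℝ] V₂ →L[ℝ] V₃)

@[simp] theorem pmul_apply (f : C(S1, V₁)) (g : C(S1, V₂)) (θ : S1) :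
    pmul B f g θ = B (f θ) (g θ) := rfl

theorem norm_pmul_le (f : C(S1, V₁)) (g : C(S1, V₂)) : ‖pmul B f g‖ ≤ ‖B‖ * ‖f‖ * ‖g‖ := by
  rw [ContinuousMap.norm_le _ (by positivity)]
  intro θ
  exact (B.le_opNorm₂ _ _).trans (by gcongr <;> exact ContinuousMap.norm_coe_le_norm _ _)

theorem IsSmooth.pmul {f : C(S1, V₁)} {g : C(S1, V₂)} (hf : IsSmooth f) (hg : IsSmooth g) :
    IsSmooth (pmul B f g) :=
  (B.isBoundedBilinearMap.contDiff (n := ∞)).comp (ContDiff.prodMk hf hg)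

theorem trans_pmul (y : S1) (f : C(S1, V₁)) (g : C(S1, V₂)) :
    trans y (pmul B f g) = pmul B (trans y f) (trans y g) := rfl

theorem diff_pmul (y : S1) (f : C(S1, V₁)) (g : C(S1, V₂)) :
    diff y (pmul B f g) = pmul B f (diff y g) + pmul B (diff y f) (trans y g) := by
  simp only [diff_apply, trans_pmul, map_sub, sub_apply]
  abel

theorem commute_trans_diff {V : Type*} [NormedAddCommGroup V] [NormedSpace ℝ V] (y z : S1) :
    Commute (trans y : C(S1, V) →L[ℝ] C(S1, V)) (diff z) := by
  refine Commute.sub_right ?_ (Commute.one_right _)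
  ext f θ
  simp [add_right_comm]

/-- The Leibniz rule for differences. -/
theorem diff_pow_pmul (y : S1) (n : ℕ) : ∀ (f : C(S1, V₁)) (g : C(S1, V₂)),
    (diff y ^ n) (pmul B f g) = ∑ ij ∈ Finset.HasAntidiagonal.antidiagonal n, n.choose ij.1 •
      pmul B ((diff y ^ ij.1) f) ((trans y ^ ij.1) ((diff y ^ ij.2) g)) := by
  induction n with
  | zero => intro f g; simp
  | succ n ih =>
    intro f g
    have h := Finset.sum_antidiagonal_choose_succ_nsmul
      (fun i j => pmul B ((diff y ^ i) f) ((trans y ^ i) ((diff y ^ j) g))) n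
    rw [h, pow_succ, mul_apply_eq_comp, diff_pmul, map_add, ih, ih]
    congr 1
    · refine Finset.sum_congr rfl fun ij hij => ?_
      rw [Finset.HasAntidiagonal.mem_antidiagonal] at hij
      have h0 : n.choose ij.1 = n.choose ij.2 := Nat.choose_symm_of_eq_add hij.symm
      have h1 := ((commute_trans_diff (V := V₂) y y).pow_right ij.2).eq
      have h2 : (trans y ^ (ij.1 + 1)) ((diff y ^ ij.2) g) =
          (trans y ^ ij.1) ((diff y ^ ij.2) (trans y g)) := by
        rw [pow_succ, mul_apply_eq_comp, ← mul_apply_eq_comp (trans y), h1, mul_apply_eq_comp]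
      rw [h0, h2, pow_succ, mul_apply_eq_comp]

variable {p : ENNReal} [Fact (1 ≤ p)]

theorem norm_toLpC_le_mul {V V' : Type*} [NormedAddCommGroup V] [NormedSpace ℝ V]
    [NormedAddCommGroup V'] [NormedSpace ℝ V'] {h : C(S1, V)} {v : C(S1, V')} {K : ℝ}
    (hK : ∀ θ, ‖h θ‖ ≤ K * ‖v θ‖) : ‖toLpC V p h‖ ≤ K * ‖toLpC V' p v‖ := by
  refine Lp.norm_le_mul_norm_of_ae_le_mul ?_
  filter_upwards [ContinuousMap.coeFn_toLp (p := p) (𝕜 := ℝ) dθ h,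
    ContinuousMap.coeFn_toLp (p := p) (𝕜 := ℝ) dθ v] with θ h1 h2
  refine (congrArg norm h1).le.trans ((hK θ).trans_eq ?_)
  exact congrArg (fun x => K * ‖x‖) h2.symm

theorem norm_toLpC_pmul_le_left (f : C(S1, V₁)) (g : C(S1, V₂)) :
    ‖toLpC V₃ p (pmul B f g)‖ ≤ ‖B‖ * ‖toLpC V₁ p f‖ * ‖g‖ := by
  rw [mul_right_comm]
  refine norm_toLpC_le_mul fun θ => (B.le_opNorm₂ _ _).trans ?_
  rw [mul_right_comm]
  gcongr
  exact ContinuousMap.norm_coe_le_norm _ _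

theorem norm_toLpC_pmul_le_right (f : C(S1, V₁)) (g : C(S1, V₂)) :
    ‖toLpC V₃ p (pmul B f g)‖ ≤ ‖B‖ * ‖f‖ * ‖toLpC V₂ p g‖ := by
  refine norm_toLpC_le_mul fun θ => (B.le_opNorm₂ _ _).trans ?_
  gcongr
  exact ContinuousMap.norm_coe_le_norm _ _

section Powers

variable {V : Type*} [NormedAddCommGroup V] [NormedSpace ℝ V]
  {Z : Type*} [NormedAddCommGroup Z] [NormedSpace ℝ Z]

theorem TransInvariant.norm_trans_pow_le {Y : C(S1, V) →L[ℝ] Z} (hY : TransInvariant Y) (y : S1)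
    (n : ℕ) (f : C(S1, V)) : ‖Y ((trans y ^ n) f)‖ ≤ ‖Y f‖ := by
  induction n with
  | zero => simp
  | succ n ih =>
    rw [pow_succ', mul_apply_eq_comp]
    exact (hY y _).trans ih

theorem norm_trans_pow_sub_le (y : S1) (n : ℕ) (f : C(S1, V)) :
    ‖(trans y ^ n) f - f‖ ≤ n * ‖diff y f‖ := by
  induction n with
  | zero => simp
  | succ n ih =>
    have h : (trans y ^ (n + 1)) f - f = (trans y ^ n) (diff y f) + ((trans y ^ n) f - f) := by
      rw [pow_succ, mul_apply_eq_comp, diff_apply, map_sub]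
      abel
    rw [h]
    refine (norm_add_le _ _).trans ?_
    have h1 := transInvariant_id.norm_trans_pow_le y n (diff y f)
    simp only [ContinuousLinearMap.coe_id', id_eq] at h1
    rw [Nat.cast_add_one]
    linarith

theorem TransInvariant.norm_diff_pow_le_of_le {Y : C(S1, V) →L[ℝ] Z} (hY : TransInvariant Y)
    (y : S1) {n m : ℕ} (h : n ≤ m) (f : C(S1, V)) :
    ‖Y ((diff y ^ m) f)‖ ≤ 2 ^ (m - n) * ‖Y ((diff y ^ n) f)‖ := by
  obtain ⟨k, rfl⟩ := Nat.exists_eq_add_of_le h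
  rw [add_comm n k, pow_add, mul_apply_eq_comp, Nat.add_sub_cancel]
  exact hY.norm_diff_pow_le y k _

theorem symDiff2_pow (y : S1) (m : ℕ) :
    (symDiff2 y ^ m : C(S1, V) →L[ℝ] C(S1, V)) =
      (-1 : ℝ) ^ m • (trans (-y) ^ m * diff y ^ (2 * m)) := by
  have h1 : (diff (-y) : C(S1, V) →L[ℝ] C(S1, V)) = (-1 : ℝ) • (trans (-y) * diff y) := by
    ext f θ
    simp [diff_apply]
  have h2 : (symDiff2 y : C(S1, V) →L[ℝ] C(S1, V)) = (-1 : ℝ) • (trans (-y) * diff y ^ 2) := by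
    rw [symDiff2, h1, mul_smul_comm, ← mul_assoc, (commute_trans_diff (-y) y).eq.symm, mul_assoc,
      ← pow_two]
  rw [h2, smul_pow, ((commute_trans_diff (-y) y).pow_right 2).mul_pow, ← pow_mul]

theorem norm_symDiff2_pow_le (y : S1) (m : ℕ) (f : C(S1, V)) :
    ‖(symDiff2 y ^ m) f‖ ≤ 4 ^ m * ‖f‖ := by
  rw [symDiff2_pow, smul_apply, norm_smul, norm_pow, norm_neg, norm_one, one_pow,
    one_mul, mul_apply_eq_comp]
  refine (transInvariant_id.norm_trans_pow_le (-y) m _).trans ?_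
  refine (transInvariant_id.norm_diff_pow_le y (2 * m) f).trans ?_
  rw [pow_mul]
  norm_num

end Powers

/-- The defect of the Leibniz rule for `(2 - τ_y - τ_{-y})^m`. -/
noncomputable def leibnizDefect (m : ℕ) (y : S1) (f : C(S1, V₁)) (g : C(S1, V₂)) : C(S1, V₃) :=
  (symDiff2 y ^ m) (pmul B f g) - pmul B ((symDiff2 y ^ m) f) g - pmul B f ((symDiff2 y ^ m) g)

theorem norm_leibnizDefect_le (m : ℕ) (y : S1) (f : C(S1, V₁)) (g : C(S1, V₂)) :
    ‖leibnizDefect B m y f g‖ ≤ 3 * 4 ^ m * ‖B‖ * ‖f‖ * ‖g‖ := by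
  have h1 := norm_symDiff2_pow_le y m (pmul B f g)
  have h2 := norm_pmul_le B ((symDiff2 y ^ m) f) g
  have h3 := norm_pmul_le B f ((symDiff2 y ^ m) g)
  have h4 := norm_symDiff2_pow_le y m f
  have h5 := norm_symDiff2_pow_le y m g
  have h6 := norm_pmul_le B f g
  have h7 : ‖B‖ * ‖(symDiff2 y ^ m) f‖ * ‖g‖ ≤ ‖B‖ * (4 ^ m * ‖f‖) * ‖g‖ := by gcongr
  have h8 : ‖B‖ * ‖f‖ * ‖(symDiff2 y ^ m) g‖ ≤ ‖B‖ * ‖f‖ * (4 ^ m * ‖g‖) := by gcongr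
  have h9 : 4 ^ m * ‖pmul B f g‖ ≤ 4 ^ m * (‖B‖ * ‖f‖ * ‖g‖) := by gcongr
  rw [leibnizDefect]
  refine (norm_sub_le _ _).trans ?_
  have h10 := norm_sub_le ((symDiff2 y ^ m) (pmul B f g)) (pmul B ((symDiff2 y ^ m) f) g)
  linarith

/-- In the middle terms of the Leibniz rule one factor carries at least `m` differences and the
other at least one. -/
theorem norm_toLpC_leibniz_term_le {m i j : ℕ} (hm : 1 ≤ m) (hij : i + j = 2 * m) (hi : 1 ≤ i)
    (hj : 1 ≤ j) (y : S1) (f : C(S1, V₁)) (g : C(S1, V₂)) {P Q P' Q' : ℝ}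
    (hP : ‖toLpC V₁ p ((diff y ^ m) f)‖ ≤ P) (hQ : ‖diff y f‖ ≤ Q)
    (hP' : ‖toLpC V₂ p ((diff y ^ m) g)‖ ≤ P') (hQ' : ‖diff y g‖ ≤ Q') :
    ‖toLpC V₃ p (pmul B ((diff y ^ i) f) ((trans y ^ i) ((diff y ^ j) g)))‖ ≤
      16 ^ m * ‖B‖ * (P * Q' + Q * P') := by
  have hP0 := (norm_nonneg _).trans hP
  have hQ0 := (norm_nonneg _).trans hQ
  have hP0' := (norm_nonneg _).trans hP'
  have hQ0' := (norm_nonneg _).trans hQ'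
  have h4 : ∀ k : ℕ, k ≤ 2 * m → (2 : ℝ) ^ k ≤ 4 ^ m := by
    intro k hk
    calc (2 : ℝ) ^ k ≤ 2 ^ (2 * m) := pow_le_pow_right₀ (by norm_num) hk
      _ = 4 ^ m := by rw [pow_mul]; norm_num
  have h16 : (16 : ℝ) ^ m = 4 ^ m * 4 ^ m := by rw [← mul_pow]; norm_num
  rw [h16]
  rcases le_total m i with h | h
  · have h1 : ‖toLpC V₁ p ((diff y ^ i) f)‖ ≤ 4 ^ m * P := by
      refine (transInvariant_toLpC.norm_diff_pow_le_of_le y h f).trans ?_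
      gcongr
      exact h4 _ (by omega)
    have h2 : ‖(trans y ^ i) ((diff y ^ j) g)‖ ≤ 4 ^ m * Q' := by
      refine (transInvariant_id.norm_trans_pow_le y i _).trans ?_
      refine (transInvariant_id.norm_diff_pow_le_of_le y hj g).trans ?_
      gcongr
      · exact h4 _ (by omega)
      · rw [pow_one]; exact hQ'
    refine (norm_toLpC_pmul_le_left B _ _).trans ?_
    calc _ ≤ ‖B‖ * (4 ^ m * P) * (4 ^ m * Q') := by gcongr
      _ = 4 ^ m * 4 ^ m * ‖B‖ * (P * Q') := by ring
      _ ≤ _ := by gcongr; exact le_add_of_nonneg_right (by positivity)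
  · have h1 : ‖(diff y ^ i) f‖ ≤ 4 ^ m * Q := by
      refine (transInvariant_id.norm_diff_pow_le_of_le y hi f).trans ?_
      gcongr
      · exact h4 _ (by omega)
      · rw [pow_one]; exact hQ
    have h2 : ‖toLpC V₂ p ((trans y ^ i) ((diff y ^ j) g))‖ ≤ 4 ^ m * P' := by
      refine (transInvariant_toLpC.norm_trans_pow_le y i _).trans ?_
      refine (transInvariant_toLpC.norm_diff_pow_le_of_le y (by omega : m ≤ j) g).trans ?_
      gcongr
      exact h4 _ (by omega)
    refine (norm_toLpC_pmul_le_right B _ _).trans ?_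
    calc _ ≤ ‖B‖ * (4 ^ m * Q) * (4 ^ m * P') := by gcongr
      _ = 4 ^ m * 4 ^ m * ‖B‖ * (Q * P') := by ring
      _ ≤ _ := by gcongr; exact le_add_of_nonneg_left (by positivity)

theorem trans_neg_pow_trans_pow {V : Type*} [NormedAddCommGroup V] [NormedSpace ℝ V] (y : S1)
    (m : ℕ) (f : C(S1, V)) : (trans (-y) ^ m) ((trans y ^ m) f) = f := by
  have h : (trans (-y) * trans y : C(S1, V) →L[ℝ] C(S1, V)) = 1 := by
    ext f θ
    simp
  have hc : Commute (trans (-y) : C(S1, V) →L[ℝ] C(S1, V)) (trans y) := by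
    ext f θ
    simp
  rw [← mul_apply_eq_comp, ← hc.mul_pow, h, one_pow, one_apply_eq_self]

theorem trans_pow_pmul (y : S1) (m : ℕ) (f : C(S1, V₁)) (g : C(S1, V₂)) :
    (trans y ^ m) (pmul B f g) = pmul B ((trans y ^ m) f) ((trans y ^ m) g) := by
  induction m with
  | zero => simp
  | succ m ih =>
    rw [pow_succ', pow_succ', pow_succ', mul_apply_eq_comp, ih, trans_pmul]
    rfl

/-- The defect of the Leibniz rule, up to a translation the sum of the terms of the Leibniz rule for
`2m` differences other than the first and the last one. These two give the terms that the defect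
subtracts, up to translations of a factor. -/
theorem leibnizDefect_eq {m : ℕ} (hm : 1 ≤ m) (y : S1) (f : C(S1, V₁)) (g : C(S1, V₂)) :
    leibnizDefect B m y f g =
      pmul B ((symDiff2 y ^ m) f) ((trans y ^ m) g - g) +
      pmul B ((trans (-y) ^ m) f - f) ((symDiff2 y ^ m) g) +
      (-1 : ℝ) ^ m • (trans (-y) ^ m) (∑ ij ∈ (Finset.HasAntidiagonal.antidiagonal (2 * m)).filter
        (fun ij => 1 ≤ ij.1 ∧ 1 ≤ ij.2), (2 * m).choose ij.1 •
        pmul B ((diff y ^ ij.1) f) ((trans y ^ ij.1) ((diff y ^ ij.2) g))) := by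
  set F : ℕ × ℕ → C(S1, V₃) := fun ij => (2 * m).choose ij.1 •
        pmul B ((diff y ^ ij.1) f) ((trans y ^ ij.1) ((diff y ^ ij.2) g)) with hF
  have h1 : ∑ ij ∈ Finset.HasAntidiagonal.antidiagonal (2 * m), F ij =
      ∑ ij ∈ (Finset.HasAntidiagonal.antidiagonal (2 * m)).filter
        (fun ij => 1 ≤ ij.1 ∧ 1 ≤ ij.2), F ij +
      (F (0, 2 * m) + F (2 * m, 0)) := by
    rw [← Finset.sum_filter_add_sum_filter_not _ (fun ij : ℕ × ℕ => 1 ≤ ij.1 ∧ 1 ≤ ij.2)]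
    congr 1
    have : (Finset.HasAntidiagonal.antidiagonal (2 * m)).filter
        (fun ij : ℕ × ℕ => ¬(1 ≤ ij.1 ∧ 1 ≤ ij.2)) =
        {(0, 2 * m), (2 * m, 0)} := by
      ext ⟨i, j⟩
      simp only [Finset.mem_filter, Finset.HasAntidiagonal.mem_antidiagonal, Finset.mem_insert,
        Finset.mem_singleton, Prod.mk.injEq]
      omega
    rw [this, Finset.sum_pair]
    simp only [ne_eq, Prod.mk.injEq]
    omega
  have h2 : (symDiff2 y ^ m) (pmul B f g) = (-1 : ℝ) ^ m • (trans (-y) ^ m)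
      (∑ ij ∈ Finset.HasAntidiagonal.antidiagonal (2 * m), F ij) := by
    rw [symDiff2_pow, smul_apply, mul_apply_eq_comp, diff_pow_pmul]
  have h3 : (-1 : ℝ) ^ m • (trans (-y) ^ m) (F (0, 2 * m)) =
      pmul B ((trans (-y) ^ m) f) ((symDiff2 y ^ m) g) := by
    simp only [hF, Nat.choose_zero_right, one_smul, pow_zero, one_apply_eq_self]
    rw [trans_pow_pmul, ← map_smul, symDiff2_pow, smul_apply, mul_apply_eq_comp]
  have h4 : (-1 : ℝ) ^ m • (trans (-y) ^ m) (F (2 * m, 0)) =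
      pmul B ((symDiff2 y ^ m) f) ((trans y ^ m) g) := by
    simp only [hF, Nat.choose_self, one_smul, pow_zero, one_apply_eq_self]
    have e : (trans y ^ (2 * m) : C(S1, V₂) →L[ℝ] C(S1, V₂)) = trans y ^ m * trans y ^ m := by
      rw [← pow_add]
      congr 1
      omega
    rw [trans_pow_pmul, e, mul_apply_eq_comp, trans_neg_pow_trans_pow, ← smul_apply, ← map_smul,
      symDiff2_pow, smul_apply, mul_apply_eq_comp]
  rw [leibnizDefect, h2, h1, map_add, map_add, smul_add, smul_add, h3, h4]
  simp only [map_sub, sub_apply]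
  abel

theorem norm_diff_neg_le {V : Type*} [NormedAddCommGroup V] [NormedSpace ℝ V] (y : S1)
    (f : C(S1, V)) : ‖diff (-y) f‖ ≤ ‖diff y f‖ := by
  have : diff (-y) f = trans (-y) (-diff y f) := by
    ext θ
    simp [diff_apply]
  rw [this, ← norm_neg (diff y f)]
  exact norm_trans_le _ _

theorem norm_toLpC_symDiff2_pow_le {V : Type*} [NormedAddCommGroup V] [NormedSpace ℝ V] (y : S1)
    (m : ℕ) (f : C(S1, V)) :
    ‖toLpC V p ((symDiff2 y ^ m) f)‖ ≤ 4 ^ m * ‖toLpC V p ((diff y ^ m) f)‖ := by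
  rw [symDiff2_pow, smul_apply, map_smul, norm_smul, norm_pow, norm_neg, norm_one, one_pow,
    one_mul, mul_apply_eq_comp]
  refine (transInvariant_toLpC.norm_trans_pow_le (-y) m _).trans ?_
  refine (transInvariant_toLpC.norm_diff_pow_le_of_le y (by omega : m ≤ 2 * m) f).trans ?_
  gcongr
  calc (2 : ℝ) ^ (2 * m - m) ≤ 2 ^ (2 * m) := pow_le_pow_right₀ (by norm_num) (by omega)
    _ = 4 ^ m := by rw [pow_mul]; norm_num

/-- The defect of the Leibniz rule is small as in each of its terms one factor has `m` differences
and the other one has a difference. -/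
theorem norm_toLpC_leibnizDefect_le {m : ℕ} (hm : 1 ≤ m) (y : S1) (f : C(S1, V₁)) (g : C(S1, V₂))
    {P Q P' Q' : ℝ}
    (hP : ‖toLpC V₁ p ((diff y ^ m) f)‖ ≤ P) (hQ : ‖diff y f‖ ≤ Q)
    (hP' : ‖toLpC V₂ p ((diff y ^ m) g)‖ ≤ P') (hQ' : ‖diff y g‖ ≤ Q') :
    ‖toLpC V₃ p (leibnizDefect B m y f g)‖ ≤
      (4 ^ m * m + 4 ^ m * 16 ^ m) * ‖B‖ * (P * Q' + Q * P') := by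
  have hP0 := (norm_nonneg _).trans hP
  have hQ0 := (norm_nonneg _).trans hQ
  have hP0' := (norm_nonneg _).trans hP'
  have hQ0' := (norm_nonneg _).trans hQ'
  have h1 : ‖toLpC V₃ p (pmul B ((symDiff2 y ^ m) f) ((trans y ^ m) g - g))‖ ≤
      4 ^ m * m * ‖B‖ * (P * Q') := by
    refine (norm_toLpC_pmul_le_left B _ _).trans ?_
    calc _ ≤ ‖B‖ * (4 ^ m * P) * (m * Q') := by
          gcongr
          · exact (norm_toLpC_symDiff2_pow_le y m f).trans (by gcongr)
          · exact (norm_trans_pow_sub_le y m g).trans (by gcongr)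
      _ = _ := by ring
  have hneg : ‖diff (-y) f‖ ≤ Q := (norm_diff_neg_le y f).trans hQ
  have h2 : ‖toLpC V₃ p (pmul B ((trans (-y) ^ m) f - f) ((symDiff2 y ^ m) g))‖ ≤
      4 ^ m * m * ‖B‖ * (Q * P') := by
    refine (norm_toLpC_pmul_le_right B _ _).trans ?_
    calc _ ≤ ‖B‖ * (m * Q) * (4 ^ m * P') := by
          gcongr
          · exact (norm_trans_pow_sub_le (-y) m f).trans
              (mul_le_mul_of_nonneg_left hneg m.cast_nonneg)
          · exact (norm_toLpC_symDiff2_pow_le y m g).trans (by gcongr)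
      _ = _ := by ring
  rw [leibnizDefect_eq B hm, map_add, map_add, map_smul]
  refine (norm_add_le _ _).trans ?_
  have h3 := norm_add_le (toLpC V₃ p (pmul B ((symDiff2 y ^ m) f) ((trans y ^ m) g - g)))
    (toLpC V₃ p (pmul B ((trans (-y) ^ m) f - f) ((symDiff2 y ^ m) g)))
  have h4 : ‖(-1 : ℝ) ^ m • toLpC V₃ p ((trans (-y) ^ m)
      (∑ ij ∈ (Finset.HasAntidiagonal.antidiagonal (2 * m)).filter
        (fun ij => 1 ≤ ij.1 ∧ 1 ≤ ij.2), (2 * m).choose ij.1 •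
        pmul B ((diff y ^ ij.1) f) ((trans y ^ ij.1) ((diff y ^ ij.2) g))))‖ ≤
      4 ^ m * (16 ^ m * ‖B‖ * (P * Q' + Q * P')) := by
    rw [norm_smul, norm_pow, norm_neg, norm_one, one_pow, one_mul]
    refine (transInvariant_toLpC.norm_trans_pow_le (-y) m _).trans ?_
    rw [map_sum]
    refine (norm_sum_le _ _).trans ?_
    have h5 : (4 : ℝ) ^ m =
        ∑ ij ∈ Finset.HasAntidiagonal.antidiagonal (2 * m), ((2 * m).choose ij.1 : ℝ) := by
      rw [Finset.Nat.sum_antidiagonal_eq_sum_range_succ (fun i _ => ((2 * m).choose i : ℝ))]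
      have := Nat.sum_range_choose (2 * m)
      rw [← Nat.cast_sum, this, pow_mul]
      norm_num
    rw [h5, Finset.sum_mul]
    refine (Finset.sum_le_sum fun ij hij => ?_).trans
      (Finset.sum_le_sum_of_subset_of_nonneg (Finset.filter_subset _ _) fun ij _ _ => by positivity)
    rw [Finset.mem_filter, Finset.HasAntidiagonal.mem_antidiagonal] at hij
    rw [map_nsmul]
    refine (norm_nsmul_le).trans ?_
    gcongr
    exact norm_toLpC_leibniz_term_le B hm hij.1 hij.2.1 hij.2.2 y f g hP hQ hP' hQ'
  refine (add_le_add (h3.trans (add_le_add h1 h2)) h4).trans (le_of_eq ?_)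
  ring

end Product

section ProductEstimate

open Set

variable {V₁ V₂ V₃ : Type*} [NormedAddCommGroup V₁] [NormedSpace ℝ V₁] [CompleteSpace V₁]
  [NormedAddCommGroup V₂] [NormedSpace ℝ V₂] [CompleteSpace V₂]
  [NormedAddCommGroup V₃] [NormedSpace ℝ V₃] [CompleteSpace V₃]
  {p : ENNReal} [Fact (1 ≤ p)] {s : ℝ}

/-- The defect of the Leibniz rule is `O(y^σ)` in `L^p` for some `σ > s`. -/
theorem exists_norm_toLpC_leibnizDefect_le (B : V₁ →L[ℝ] V₂ →L[ℝ] V₃) (hp : 1 < p)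
    (hp_top : p < ⊤) (hs : 1 / p.toReal < s) {m : ℕ} (hm1 : 1 ≤ m) (hm : s ≤ m) :
    ∃ σ D, s < σ ∧ 0 ≤ D ∧ ∀ (f : C(S1, V₁)) (g : C(S1, V₂)), IsSmooth f → IsSmooth g →
      ∀ y : ℝ, 0 < y → ‖toLpC V₃ p (leibnizDefect B m (y : S1) f g)‖ ≤
        D * min 1 (y ^ σ) * (sobNorm s p f * sobNorm s p g) := by
  have hp0 : 0 ≤ 1 / p.toReal := by positivity
  -- functions are Hölder continuous with exponent `b`, and have `m`-th differences of order `y^a`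
  -- in `L^p`, where `a` is less than `s` but `a + b` is greater
  set b := min 1 (s - 1 / p.toReal) / 2 with hb
  have hmin : 0 < min 1 (s - 1 / p.toReal) := lt_min one_pos (by linarith)
  have hb0 : 0 < b := by positivity
  have hb1 : b ≤ 1 := by
    have := min_le_left 1 (s - 1 / p.toReal)
    linarith
  have hbs : b + 1 / p.toReal < s := by
    have := min_le_right 1 (s - 1 / p.toReal)
    linarith
  set a := s - b / 2 with ha
  have ha0 : 0 ≤ a := by linarith
  have has : a < s := by linarith
  have ham : a ≤ m := by linarith
  have hm0 : m ≠ 0 := by omega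
  obtain ⟨C₁, hC₁, h₁⟩ := exists_norm_toLpC_diff_pow_le_sobNorm (p := p) (s := s) V₁ hm0 ha0 ham has
  obtain ⟨C₁', hC₁', h₁'⟩ :=
    exists_norm_toLpC_diff_pow_le_sobNorm (p := p) (s := s) V₂ hm0 ha0 ham has
  obtain ⟨C₂, hC₂, h₂⟩ := exists_norm_diff_le_sobNorm V₁ hp hp_top hb0.le hb1 hbs
  obtain ⟨C₂', hC₂', h₂'⟩ := exists_norm_diff_le_sobNorm V₂ hp hp_top hb0.le hb1 hbs
  obtain ⟨C₃, hC₃, h₃⟩ := exists_norm_le_sobNorm V₁ hp hp_top hs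
  obtain ⟨C₃', hC₃', h₃'⟩ := exists_norm_le_sobNorm V₂ hp hp_top hs
  set D₁ : ℝ := 3 * 4 ^ m * ‖B‖ * C₃ * C₃' with hD₁
  set D₂ : ℝ := (4 ^ m * m + 4 ^ m * 16 ^ m) * ‖B‖ * (C₁ * C₂' + C₂ * C₁') with hD₂
  have hD₁0 : 0 ≤ D₁ := by positivity
  have hD₂0 : 0 ≤ D₂ := by positivity
  refine ⟨a + b, D₁ + D₂, by linarith, by positivity, fun f g hf hg y hy => ?_⟩
  have hS : 0 ≤ sobNorm s p f * sobNorm s p g := mul_nonneg (sobNorm_nonneg f) (sobNorm_nonneg g)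
  have e1 : ‖toLpC V₃ p (leibnizDefect B m (y : S1) f g)‖ ≤
      D₁ * (sobNorm s p f * sobNorm s p g) := by
    refine (norm_toLpC_le _).trans ((norm_leibnizDefect_le B m y f g).trans ?_)
    calc _ ≤ 3 * 4 ^ m * ‖B‖ * (C₃ * sobNorm s p f) * (C₃' * sobNorm s p g) := by
          have hSf := sobNorm_nonneg (s := s) (p := p) f
          gcongr
          · exact h₃ f hf
          · exact h₃' g hg
      _ = _ := by rw [hD₁]; ring
  have e2 : ‖toLpC V₃ p (leibnizDefect B m (y : S1) f g)‖ ≤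
      D₂ * y ^ (a + b) * (sobNorm s p f * sobNorm s p g) := by
    refine (norm_toLpC_leibnizDefect_le B hm1 y f g (h₁ f hf y) (h₂ f hf y) (h₁' g hg y)
      (h₂' g hg y)).trans (le_of_eq ?_)
    rw [abs_of_pos hy, Real.rpow_add hy, hD₂]
    ring
  rw [mul_min_of_nonneg _ _ (by positivity), min_mul_of_nonneg _ _ hS, le_min_iff]
  constructor
  · refine e1.trans ?_
    gcongr
    linarith
  · refine e2.trans ?_
    gcongr
    linarith

/-- The Sobolev norm is submultiplicative up to a constant when `sp > 1`. -/
theorem exists_sobNorm_pmul_le (B : V₁ →L[ℝ] V₂ →L[ℝ] V₃) (hp : 1 < p)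
    (hp_top : p < ⊤) (hs : 1 / p.toReal < s) :
    ∃ C, 0 ≤ C ∧ ∀ (f : C(S1, V₁)) (g : C(S1, V₂)), IsSmooth f → IsSmooth g →
      sobNorm s p (pmul B f g) ≤ C * sobNorm s p f * sobNorm s p g := by
  have hp0 : 0 ≤ 1 / p.toReal := by positivity
  have hs0 : 0 < s := by linarith
  obtain ⟨m, hm1, hm⟩ : ∃ m : ℕ, 1 ≤ m ∧ s ≤ m := by
    refine ⟨⌈s⌉₊, ?_, Nat.le_ceil s⟩
    exact Nat.one_le_iff_ne_zero.2 (Nat.ceil_pos.2 hs0).ne'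
  have hm2 : s < 2 * m := by
    have : (1 : ℝ) ≤ m := by exact_mod_cast hm1
    linarith
  obtain ⟨σ, D, hσ, hD, h⟩ := exists_norm_toLpC_leibnizDefect_le B hp hp_top hs hm1 hm
  obtain ⟨C₃, hC₃, h₃⟩ := exists_norm_le_sobNorm V₁ hp hp_top hs
  obtain ⟨C₃', hC₃', h₃'⟩ := exists_norm_le_sobNorm V₂ hp hp_top hs
  have hc := singConst_pos hs0 hm2
  set c := singConst m s with hcdef
  set I : ℝ := ∫ y in Ioi (0 : ℝ), y ^ (-1 - s) * min 1 (y ^ σ) with hI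
  have hI0 : 0 ≤ I := setIntegral_nonneg measurableSet_Ioi fun y hy => by
    have : (0 : ℝ) < y := hy
    positivity
  refine ⟨‖B‖ * C₃' + ‖B‖ * C₃ + c⁻¹ * (D * I) + ‖B‖ * C₃, by positivity, fun f g hf hg => ?_⟩
  have hSf := sobNorm_nonneg (s := s) (p := p) f
  have hSg := sobNorm_nonneg (s := s) (p := p) g
  obtain ⟨k1, i1⟩ := hasIntegral_fracLap (hf.pmul B hg) hs0 hm2
  obtain ⟨k2, i2⟩ := hasIntegral_fracLap hf hs0 hm2
  obtain ⟨k3, i3⟩ := hasIntegral_fracLap hg hs0 hm2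
  have k2' : c • pmul B (fracLap s f) g =
      ∫ y in Ioi (0 : ℝ), y ^ (-1 - s) • pmul B ((symDiff2 (y : S1) ^ m) f) g := by
    have := ContinuousLinearMap.integral_comp_comm ((pmul B).flip g) i2
    simp only [map_smul, ContinuousLinearMap.flip_apply] at this
    rw [this, ← k2, map_smul, smul_apply]
  have i2' : IntegrableOn (fun y : ℝ => y ^ (-1 - s) • pmul B ((symDiff2 (y : S1) ^ m) f) g)
      (Ioi 0) := by
    have := ContinuousLinearMap.integrable_comp ((pmul B).flip g) i2
    simp only [map_smul, ContinuousLinearMap.flip_apply] at this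
    exact this
  have k3' : c • pmul B f (fracLap s g) =
      ∫ y in Ioi (0 : ℝ), y ^ (-1 - s) • pmul B f ((symDiff2 (y : S1) ^ m) g) := by
    have := ContinuousLinearMap.integral_comp_comm (pmul B f) i3
    simp only [map_smul] at this
    rw [this, ← k3, map_smul]
  have i3' : IntegrableOn (fun y : ℝ => y ^ (-1 - s) • pmul B f ((symDiff2 (y : S1) ^ m) g))
      (Ioi 0) := by
    have := ContinuousLinearMap.integrable_comp (pmul B f) i3
    simp only [map_smul] at this
    exact this
  -- the defect of the Leibniz rule for `Δ^{s/2}` is the singular integral of that for differences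
  have k4 : c • (fracLap s (pmul B f g) - pmul B (fracLap s f) g - pmul B f (fracLap s g)) =
      ∫ y in Ioi (0 : ℝ), y ^ (-1 - s) • leibnizDefect B m (y : S1) f g := by
    have e := integral_sub (i1.sub i2') i3'
    simp only [Pi.sub_apply] at e
    rw [smul_sub, smul_sub, k1, k2', k3', ← integral_sub i1 i2', ← e]
    simp only [leibnizDefect, smul_sub]
  have i4 : IntegrableOn (fun y : ℝ => y ^ (-1 - s) • leibnizDefect B m (y : S1) f g) (Ioi 0) := by
    refine ((i1.sub i2').sub i3').congr (Filter.Eventually.of_forall fun y => ?_)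
    simp only [leibnizDefect, smul_sub, Pi.sub_apply]
  have k5 : c * ‖toLpC V₃ p (fracLap s (pmul B f g) - pmul B (fracLap s f) g -
      pmul B f (fracLap s g))‖ ≤ D * I * (sobNorm s p f * sobNorm s p g) := by
    rw [← Real.norm_of_nonneg hc.le, ← norm_smul, ← map_smul, k4,
      ← ContinuousLinearMap.integral_comp_comm _ i4]
    have e : D * I * (sobNorm s p f * sobNorm s p g) = ∫ y in Ioi (0 : ℝ),
        (D * (sobNorm s p f * sobNorm s p g)) * (y ^ (-1 - s) * min 1 (y ^ σ)) := by
      rw [integral_const_mul]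
      ring
    rw [e]
    refine norm_integral_le_of_norm_le ((integrableOn_min_one_rpow hs0 hσ).const_mul _) ?_
    refine (ae_restrict_mem measurableSet_Ioi).mono fun y hy => ?_
    have hy0 : (0 : ℝ) < y := hy
    rw [map_smul, norm_smul, Real.norm_of_nonneg (by positivity)]
    calc _ ≤ y ^ (-1 - s) * (D * min 1 (y ^ σ) * (sobNorm s p f * sobNorm s p g)) := by
          gcongr
          exact h f g hf hg y hy0
      _ = _ := by ring
  have k6 : ‖toLpC V₃ p (fracLap s (pmul B f g) - pmul B (fracLap s f) g -
      pmul B f (fracLap s g))‖ ≤ c⁻¹ * (D * I) * (sobNorm s p f * sobNorm s p g) := by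
    rw [mul_assoc, inv_mul_eq_div, le_div_iff₀ hc, mul_comm]
    exact k5
  have k7 : ‖toLpC V₃ p (pmul B (fracLap s f) g)‖ ≤
      ‖B‖ * C₃' * (sobNorm s p f * sobNorm s p g) := by
    refine (norm_toLpC_pmul_le_left B _ _).trans ?_
    calc _ ≤ ‖B‖ * sobNorm s p f * (C₃' * sobNorm s p g) := by
          gcongr
          · exact norm_toLpC_fracLap_le f
          · exact h₃' g hg
      _ = _ := by ring
  have k8 : ‖toLpC V₃ p (pmul B f (fracLap s g))‖ ≤
      ‖B‖ * C₃ * (sobNorm s p f * sobNorm s p g) := by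
    refine (norm_toLpC_pmul_le_right B _ _).trans ?_
    calc _ ≤ ‖B‖ * (C₃ * sobNorm s p f) * sobNorm s p g := by
          gcongr
          · exact h₃ f hf
          · exact norm_toLpC_fracLap_le g
      _ = _ := by ring
  have k9 : ‖toLpC V₃ p (pmul B f g)‖ ≤ ‖B‖ * C₃ * (sobNorm s p f * sobNorm s p g) := by
    refine (norm_toLpC_pmul_le_right B _ _).trans ?_
    calc _ ≤ ‖B‖ * (C₃ * sobNorm s p f) * sobNorm s p g := by
          gcongr
          · exact h₃ f hf
          · exact norm_toLpC_le_sobNorm g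
      _ = _ := by ring
  have k10 : ‖toLpC V₃ p (fracLap s (pmul B f g))‖ ≤
      ‖toLpC V₃ p (fracLap s (pmul B f g) - pmul B (fracLap s f) g - pmul B f (fracLap s g))‖ +
      ‖toLpC V₃ p (pmul B (fracLap s f) g)‖ + ‖toLpC V₃ p (pmul B f (fracLap s g))‖ := by
    refine le_trans (le_of_eq ?_) (norm_add₃_le)
    rw [← map_add, ← map_add]
    congr 2
    abel
  rw [sobNorm]
  calc _ ≤ (c⁻¹ * (D * I) * (sobNorm s p f * sobNorm s p g) +
        ‖B‖ * C₃' * (sobNorm s p f * sobNorm s p g) +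
        ‖B‖ * C₃ * (sobNorm s p f * sobNorm s p g)) +
        ‖B‖ * C₃ * (sobNorm s p f * sobNorm s p g) := by linarith
    _ = _ := by ring

end ProductEstimate

/-! ### Density of smooth functions, and functions with vanishing modes -/

section Density

variable {V : Type*} [NormedAddCommGroup V] [NormedSpace ℝ V] [CompleteSpace V]

open scoped Convolution in
/-- Uniform approximation by smooth functions, by mollification on the universal cover. -/
theorem exists_isSmooth_dist_le (f : C(S1, V)) {ε : ℝ} (hε : 0 < ε) :
    ∃ g : C(S1, V), IsSmooth g ∧ ‖g - f‖ ≤ ε := by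
  have hcoe : Continuous fun x : ℝ => (x : S1) := AddCircle.continuous_mk' _
  obtain ⟨δ, hδ, h⟩ := Metric.uniformContinuous_iff.1
    (CompactSpace.uniformContinuous_of_continuous f.continuous) ε hε
  set F : ℝ → V := fun x => f (x : S1) with hF
  have hFc : Continuous F := f.continuous.comp hcoe
  let φ : ContDiffBump (0 : ℝ) := ⟨δ / 2, δ, by positivity, by linarith⟩
  set u : ℝ → V := (φ.normed volume ⋆[ContinuousLinearMap.lsmul ℝ ℝ, volume] F) with hu
  have hus : ContDiff ℝ ∞ u := φ.hasCompactSupport_normed.contDiff_convolution_left _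
    φ.contDiff_normed hFc.locallyIntegrable
  have hper : Function.Periodic u (2 * Real.pi) := by
    intro x
    simp only [hu, convolution, hF]
    congr 1
    ext t
    have : ((x + 2 * Real.pi - t : ℝ) : S1) = ((x - t : ℝ) : S1) := by
      rw [show x + 2 * Real.pi - t = (x - t) + 2 * Real.pi by ring]
      exact AddCircle.coe_add_period (2 * Real.pi) (x - t)
    rw [this]
  have hs : IsSmooth (hper.lift : S1 → V) := by
    have : (fun x : ℝ => (hper.lift : S1 → V) (x : S1)) = u := by
      ext x
      exact Function.Periodic.lift_coe hper x
    unfold IsSmooth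
    rwa [this]
  refine ⟨⟨hper.lift, hs.continuous⟩, hs, ?_⟩
  rw [ContinuousMap.norm_le _ hε.le]
  intro θ
  obtain ⟨x, rfl⟩ := QuotientAddGroup.mk_surjective θ
  rw [ContinuousMap.sub_apply, ← dist_eq_norm]
  have h1 : (hper.lift : S1 → V) (x : S1) = u x := Function.Periodic.lift_coe hper x
  change dist ((hper.lift : S1 → V) (x : S1)) (F x) ≤ ε
  rw [h1]
  refine φ.dist_normed_convolution_le hFc.aestronglyMeasurable fun y hy => ?_
  refine (h ?_).le
  refine lt_of_le_of_lt ?_ (Metric.mem_ball.1 hy)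
  rw [dist_eq_norm, dist_eq_norm, ← AddCircle.coe_sub, Real.norm_eq_abs]
  exact QuotientAddGroup.norm_mk_le_norm

theorem dense_isSmooth : Dense {f : C(S1, V) | IsSmooth f} := by
  rw [Metric.dense_iff]
  intro f r hr
  obtain ⟨g, hg, h⟩ := exists_isSmooth_dist_le f (half_pos hr)
  refine ⟨g, ?_, hg⟩
  rw [Metric.mem_ball, dist_eq_norm]
  linarith

theorem ae_eq_zero_of_forall_integral_continuous {G : S1 → V} (hG : Integrable G dθ)
    (h : ∀ φ : C(S1, ℝ), ∫ t, φ t • G t ∂dθ = 0) : G =ᵐ[dθ] 0 := by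
  refine ae_eq_zero_of_forall_setIntegral_isClosed_eq_zero hG fun s hs => ?_
  have hpos : ∀ n : ℕ, (0 : ℝ) < 1 / ((n : ℝ) + 1) := fun n => Nat.one_div_pos_of_nat
  have hlim := thickenedIndicator_tendsto_indicator_closure hpos
    tendsto_one_div_add_atTop_nhds_zero_nat s
  rw [hs.closure_eq, tendsto_pi_nhds] at hlim
  have hc : ∀ n, Continuous fun t => ((thickenedIndicator (hpos n) s t : NNReal) : ℝ) := fun n =>
    NNReal.continuous_coe.comp (thickenedIndicator (hpos n) s).continuous
  have key : Filter.Tendsto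
      (fun n => ∫ t, ((thickenedIndicator (hpos n) s t : NNReal) : ℝ) • G t ∂dθ)
      Filter.atTop (nhds (∫ t, s.indicator G t ∂dθ)) := by
    refine tendsto_integral_of_dominated_convergence (fun t => ‖G t‖)
      (fun n => (hc n).aestronglyMeasurable.smul hG.aestronglyMeasurable) hG.norm
      (fun n => Filter.Eventually.of_forall fun t => ?_) (Filter.Eventually.of_forall fun t => ?_)
    · rw [norm_smul, NNReal.norm_eq]
      refine mul_le_of_le_one_left (norm_nonneg _) ?_
      exact_mod_cast thickenedIndicator_le_one (hpos n) s t
    · have h1 := ((NNReal.continuous_coe.tendsto _).comp (hlim t)).smul_const (G t)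
      have h2 : s.indicator G t = ((s.indicator (fun _ => (1 : NNReal)) t : NNReal) : ℝ) • G t := by
        by_cases ht : t ∈ s <;> simp [ht]
      rw [h2]
      exact h1
  rw [← integral_indicator hs.measurableSet]
  refine tendsto_nhds_unique key ?_
  have h0 : ∀ n, ∫ t, ((thickenedIndicator (hpos n) s t : NNReal) : ℝ) • G t ∂dθ = 0 := fun n =>
    h ⟨_, hc n⟩
  simp only [h0]
  exact tendsto_const_nhds

variable (V) in
/-- The pairing `(φ, u) ↦ ∫ φ u` of `C(S¹)` with `L^p(S¹, V)`. -/
noncomputable def pair (p : ENNReal) [Fact (1 ≤ p)] : C(S1, ℝ) →L[ℝ] Lp V p dθ →L[ℝ] V :=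
  have hint : ∀ u : Lp V p dθ, Integrable u dθ := fun u =>
    ((Lp.memLp u).mono_exponent (Fact.out : 1 ≤ p)).integrable le_rfl
  have hint' : ∀ (φ : C(S1, ℝ)) (u : Lp V p dθ), Integrable (fun t => φ t • u t) dθ := fun φ u =>
    (hint u).bdd_smul ‖φ‖ φ.continuous.aestronglyMeasurable
      (Filter.Eventually.of_forall fun t => φ.norm_coe_le_norm t)
  LinearMap.mkContinuous₂
    (LinearMap.mk₂ ℝ (fun φ u => ∫ t, φ t • u t ∂dθ)
      (fun φ φ' u => by
        simp only [ContinuousMap.add_apply, add_smul]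
        exact integral_add (hint' φ u) (hint' φ' u))
      (fun c φ u => by
        simp only [ContinuousMap.smul_apply, smul_assoc]
        exact integral_smul c _)
      (fun φ u u' => by
        rw [← integral_add (hint' φ u) (hint' φ u')]
        refine integral_congr_ae ?_
        filter_upwards [Lp.coeFn_add u u'] with t ht
        rw [ht, Pi.add_apply, smul_add])
      (fun c φ u => by
        rw [← integral_smul]
        refine integral_congr_ae ?_
        filter_upwards [Lp.coeFn_smul c u] with t ht
        rw [ht, Pi.smul_apply, smul_comm])) 1
    (fun φ u => by
      rw [one_mul]
      refine (norm_integral_le_of_norm_le ((hint u).norm.const_mul ‖φ‖)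
        (Filter.Eventually.of_forall fun t => ?_)).trans ?_
      · rw [norm_smul]
        exact mul_le_mul_of_nonneg_right (φ.norm_coe_le_norm t) (norm_nonneg _)
      · rw [integral_const_mul]
        refine mul_le_mul_of_nonneg_left ?_ (norm_nonneg _)
        rw [integral_norm_eq_lintegral_enorm (hint u).aestronglyMeasurable, Lp.norm_def,
          ← eLpNorm_one_eq_lintegral_enorm]
        exact ENNReal.toReal_mono (Lp.eLpNorm_ne_top u)
          (eLpNorm_le_eLpNorm_of_exponent_le Fact.out (Lp.aestronglyMeasurable u)))

variable {p : ENNReal} [Fact (1 ≤ p)]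

omit [CompleteSpace V] in
theorem pair_apply (φ : C(S1, ℝ)) (u : Lp V p dθ) : pair V p φ u = ∫ t, φ t • u t ∂dθ := rfl

omit [CompleteSpace V] in
theorem pair_toLpC (φ : C(S1, ℝ)) (f : C(S1, V)) :
    pair V p φ (toLpC V p f) = ∫ t, φ t • f t ∂dθ := by
  rw [pair_apply]
  refine integral_congr_ae ?_
  filter_upwards [ContinuousMap.coeFn_toLp (p := p) (𝕜 := ℝ) dθ f] with t ht
  exact congrArg _ ht

theorem conv_comm (φ ψ : C(S1, ℝ)) : conv φ ψ = conv ψ φ := by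
  ext θ
  rw [conv_apply, conv_apply']
  simp only [smul_eq_mul]
  congr 1
  ext t
  rw [mul_comm (φ t)]

/-- An `L^p` function all of whose Fourier modes vanish is zero: it is orthogonal to the modes of
every smooth function, so to smooth and then to continuous functions. -/
theorem eq_zero_of_forall_pair_cosk {u : Lp V p dθ}
    (h : ∀ (k : ℤ) (θ : S1), pair V p (trans (-θ) (cosk k)) u = 0) : u = 0 := by
  have h1 : ∀ (k : ℤ) (φ : C(S1, ℝ)), pair V p (modeC k φ) u = 0 := by
    intro k φ
    have := map_conv ((pair V p).flip u) φ (cosk k)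
    rw [conv_comm] at this
    simpa [modeC, h] using this
  have h2 : ∀ φ : C(S1, ℝ), IsSmooth φ → pair V p φ u = 0 := by
    intro φ hφ
    have := hφ.hasSum_modeC.mapL ((pair V p).flip u)
    simp only [ContinuousLinearMap.flip_apply, h1] at this
    exact this.unique hasSum_zero
  have h3 : ∀ φ : C(S1, ℝ), pair V p φ u = 0 := fun φ =>
    dense_isSmooth.induction (P := fun φ => pair V p φ u = 0) h2
      (isClosed_eq ((pair V p).flip u).continuous continuous_const) φ
  refine (Lp.eq_zero_iff_ae_eq_zero).2 (ae_eq_zero_of_forall_integral_continuous ?_ h3)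
  exact ((Lp.memLp u).mono_exponent (Fact.out : 1 ≤ p)).integrable le_rfl

theorem pair_trans_cosk_toLpC (k : ℤ) (θ : S1) (f : C(S1, V)) :
    pair V p (trans (-θ) (cosk k)) (toLpC V p f) = modeC k f θ := by
  rw [pair_toLpC, modeC, conv_apply']
  congr 1
  ext t
  rw [trans_apply, cosk_apply, cosk_apply, ← sub_eq_add_neg, ← neg_sub θ t]
  congr 1
  rw [← cosk_apply, ← cosk_apply]
  obtain ⟨x, hx⟩ := QuotientAddGroup.mk_surjective (θ - t)
  rw [← hx]
  change cosk k ((-x : ℝ) : S1) = cosk k (x : S1)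
  rw [cosk_coe, cosk_coe, mul_neg, Real.cos_neg]

end Density

/-! ### Sobolev functions as continuous functions -/

section SobolevSpace

/-- The range `1 < p < ∞`, `1 < sp` of exponents for which Sobolev functions on the circle are
continuous and form an algebra. -/
class SobolevRange (s : ℝ) (p : ENNReal) : Prop where
  one_lt : 1 < p
  lt_top : p < ⊤
  inv_lt : 1 / p.toReal < s

variable {V : Type*} [NormedAddCommGroup V] [NormedSpace ℝ V]
variable {s : ℝ} {p : ENNReal} [Fact (1 ≤ p)]

variable (V) in
/-- The subspace of smooth functions in `C(S¹, V)`. -/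
def smoothSub : Submodule ℝ C(S1, V) where
  carrier := {f | IsSmooth f}
  add_mem' {f g} (hf : IsSmooth f) (hg : IsSmooth g) := ContDiff.add hf hg
  zero_mem' := show IsSmooth _ from contDiff_const
  smul_mem' c f (hf : IsSmooth f) := ContDiff.const_smul c hf

theorem fracLap_add [CompleteSpace V] {f g : C(S1, V)} (hf : IsSmooth f) (hg : IsSmooth g) :
    fracLap s (f + g) = fracLap s f + fracLap s g := by
  have h : IsSmooth (f + g : C(S1, V)) := ContDiff.add hf hg
  refine (h.hasSum_fracLap s).unique ?_
  simpa only [map_add, smul_add] using (hf.hasSum_fracLap s).add (hg.hasSum_fracLap s)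

theorem fracLap_smul [CompleteSpace V] (c : ℝ) {f : C(S1, V)} (hf : IsSmooth f) :
    fracLap s (c • f) = c • fracLap s f := by
  have h : IsSmooth (c • f : C(S1, V)) := ContDiff.const_smul c hf
  refine (h.hasSum_fracLap s).unique ?_
  simpa only [map_smul, smul_comm c] using (hf.hasSum_fracLap s).const_smul c

theorem modeC_fracLap [CompleteSpace V] {f : C(S1, V)} (hf : IsSmooth f) (k : ℤ) :
    modeC k (fracLap s f) = |(k : ℝ)| ^ s • modeC k f := by
  have h := (hf.hasSum_fracLap s).mapL (modeC k : C(S1, V) →L[ℝ] C(S1, V))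
  refine h.unique ?_
  have h1 := ((hasSum_ite_eq k (|(k : ℝ)| ^ s * (1 / 2))).add
    (hasSum_ite_eq (-k) (|(k : ℝ)| ^ s * (1 / 2)))).smul_const (modeC k f)
  rw [← mul_add, add_halves, mul_one] at h1
  refine h1.congr_fun fun l => ?_
  have h2 : modeC k (modeC l f) = ((if l = k then (1 / 2 : ℝ) else 0) +
      (if l = -k then (1 / 2 : ℝ) else 0)) • modeC k f := by
    rw [modeC, modeC, conv_conv_comm, conv_conv, conv_cosk_cosk, map_smul, smul_apply]
  rw [map_smul, h2, smul_smul, mul_add]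
  congr 2
  · split_ifs with h
    · rw [h]
    · simp
  · split_ifs with h
    · rw [h, Int.cast_neg, abs_neg]
    · simp

theorem mem_smoothGraph [CompleteSpace V] {f : C(S1, V)} (hf : IsSmooth f) :
    WithLp.toLp 1 (toLpC V p f, toLpC V p (fracLap s f)) ∈ smoothGraph V s p :=
  ⟨f, fracLap s f, hf, hf.hasFracLaplacian s,
    ContinuousMap.coeFn_toLp (p := p) (𝕜 := ℝ) dθ f,
    ContinuousMap.coeFn_toLp (p := p) (𝕜 := ℝ) dθ (fracLap s f)⟩

variable (V s p) in
/-- The inclusion of smooth functions in the Sobolev space. -/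
noncomputable def ofSmooth [CompleteSpace V] : smoothSub V →ₗ[ℝ] W V s p where
  toFun f := ⟨WithLp.toLp 1 (toLpC V p f, toLpC V p (fracLap s f)),
    Submodule.le_topologicalClosure _ (mem_smoothGraph f.2)⟩
  map_add' f g := by
    refine Subtype.ext ?_
    change WithLp.toLp 1 (toLpC V p (f + g), toLpC V p (fracLap s (f + g))) =
      WithLp.toLp 1 (toLpC V p f, toLpC V p (fracLap s f)) +
      WithLp.toLp 1 (toLpC V p g, toLpC V p (fracLap s g))
    rw [fracLap_add f.2 g.2, map_add, map_add]
    rfl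
  map_smul' c f := by
    refine Subtype.ext ?_
    change WithLp.toLp 1 (toLpC V p (c • f), toLpC V p (fracLap s (c • f))) =
      c • WithLp.toLp 1 (toLpC V p f, toLpC V p (fracLap s f))
    rw [fracLap_smul c f.2, map_smul, map_smul]
    rfl

/-- The component `f` of an element `(f, Δ^{s/2} f)` of the Sobolev space. -/
noncomputable def fstL : W V s p →L[ℝ] Lp V p dθ :=
  (WithLp.fstL 1 ℝ (Lp V p dθ) (Lp V p dθ)).comp
    (smoothGraph V s p).topologicalClosure.subtypeL

/-- The component `Δ^{s/2} f` of an element `(f, Δ^{s/2} f)` of the Sobolev space. -/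
noncomputable def sndL : W V s p →L[ℝ] Lp V p dθ :=
  (WithLp.sndL 1 ℝ (Lp V p dθ) (Lp V p dθ)).comp
    (smoothGraph V s p).topologicalClosure.subtypeL

theorem W.ext_fstL {x y : W V s p} (h1 : fstL x = fstL y) (h2 : sndL x = sndL y) : x = y := by
  refine Subtype.ext ?_
  have : x.1.ofLp = y.1.ofLp := Prod.ext h1 h2
  exact WithLp.ofLp_injective 1 this

variable [CompleteSpace V]

theorem norm_ofSmooth (f : smoothSub V) : ‖ofSmooth V s p f‖ = sobNorm s p f.1 := by
  change ‖WithLp.toLp 1 (toLpC V p f.1, toLpC V p (fracLap s f.1))‖ = _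
  rw [WithLp.prod_norm_eq_of_L1, add_comm]
  rfl

theorem fstL_ofSmooth (f : smoothSub V) : fstL (ofSmooth V s p f) = toLpC V p f.1 := rfl

theorem sndL_ofSmooth (f : smoothSub V) : sndL (ofSmooth V s p f) = toLpC V p (fracLap s f.1) := rfl

theorem denseRange_ofSmooth : DenseRange (ofSmooth V s p) := by
  intro x
  rw [Metric.mem_closure_iff]
  intro ε hε
  obtain ⟨y, hy, hxy⟩ := Metric.mem_closure_iff.1 x.2 ε hε
  obtain ⟨f, g, hf, hg, h1, h2⟩ := hy
  refine ⟨_, ⟨⟨⟨f, hf.continuous⟩, hf⟩, rfl⟩, ?_⟩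
  refine lt_of_le_of_lt (le_of_eq ?_) hxy
  change dist x.1 _ = dist x.1 y
  congr 1
  refine WithLp.ofLp_injective 1 (Prod.ext (Lp.ext ?_) (Lp.ext ?_))
  · exact (ContinuousMap.coeFn_toLp (p := p) (𝕜 := ℝ) dθ _).trans h1.symm
  · refine (ContinuousMap.coeFn_toLp (p := p) (𝕜 := ℝ) dθ _).trans ?_
    have : g = fracLap s ⟨f, hf.continuous⟩ := by
      ext θ
      exact (hg θ).unique (IsSmooth.hasFracLaplacian (f := ⟨f, hf.continuous⟩) hf s θ)
    rw [this] at h2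
    exact h2.symm

variable [SobolevRange s p]

theorem exists_norm_le_ofSmooth (V : Type*) [NormedAddCommGroup V] [NormedSpace ℝ V]
    [CompleteSpace V] : ∃ C, ∀ f : smoothSub V,
    ‖(smoothSub V).subtype f‖ ≤ C * ‖ofSmooth V s p f‖ := by
  obtain ⟨C, -, h⟩ := exists_norm_le_sobNorm (s := s) V (SobolevRange.one_lt s (p := p))
    (SobolevRange.lt_top s) SobolevRange.inv_lt
  refine ⟨C, fun f => ?_⟩
  rw [norm_ofSmooth]
  exact h f.1 f.2

/-- The continuous representative of a Sobolev function. -/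
noncomputable def ev : W V s p →L[ℝ] C(S1, V) :=
  (smoothSub V).subtype.extendOfNorm (ofSmooth V s p)

@[simp] theorem ev_ofSmooth (f : smoothSub V) : ev (ofSmooth V s p f) = f.1 := by
  have h := LinearMap.extendOfNorm_eq (f := (smoothSub V).subtype) (e := ofSmooth V s p)
    denseRange_ofSmooth (exists_norm_le_ofSmooth V) f
  exact h

theorem fstL_eq (x : W V s p) : fstL x = toLpC V p (ev x) := by
  refine denseRange_ofSmooth.induction_on (p := fun x => fstL x = toLpC V p (ev x)) x
    (isClosed_eq fstL.continuous ((toLpC V p).continuous.comp ev.continuous)) fun f => ?_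
  rw [ev_ofSmooth, fstL_ofSmooth]

theorem W.fn_ae_eq (x : W V s p) : x.fn =ᵐ[dθ] ev x := by
  have := ContinuousMap.coeFn_toLp (p := p) (𝕜 := ℝ) dθ (ev x)
  change (fstL x : S1 → V) =ᵐ[dθ] _
  rw [fstL_eq]
  exact this

/-- The modes of `Δ^{s/2} x`, understood as the second component of the pair `x`. -/
theorem pair_cosk_sndL (k : ℤ) (θ : S1) (x : W V s p) :
    pair V p (trans (-θ) (cosk k)) (sndL x) = |(k : ℝ)| ^ s • modeC k (ev x) θ := by
  refine denseRange_ofSmooth.induction_on (p := fun x =>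
    pair V p (trans (-θ) (cosk k)) (sndL x) = |(k : ℝ)| ^ s • modeC k (ev x) θ) x
    (isClosed_eq (by fun_prop) (by fun_prop)) fun f => ?_
  rw [ev_ofSmooth, sndL_ofSmooth, pair_trans_cosk_toLpC]
  rw [modeC_fracLap f.2, ContinuousMap.smul_apply]

/-- A Sobolev function is determined by its continuous representative: the operator `Δ^{s/2}` is
closable, since the modes of `Δ^{s/2} f` are determined by those of `f`. -/
theorem ev_injective : Function.Injective (ev : W V s p →L[ℝ] C(S1, V)) := by
  rw [injective_iff_map_eq_zero]
  intro x hx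
  refine W.ext_fstL ?_ ?_
  · rw [fstL_eq, hx, map_zero, map_zero]
  · rw [map_zero]
    refine eq_zero_of_forall_pair_cosk fun k θ => ?_
    rw [pair_cosk_sndL, hx, map_zero, ContinuousMap.zero_apply, smul_zero]

theorem W.ext {x y : W V s p} (h : ev x = ev y) : x = y := ev_injective h

/-- A closed condition on the values holds almost everywhere for a Sobolev function if and only if
it holds everywhere for the continuous representative. -/
theorem W.ae_mem_iff {M : Set V} (hM : IsClosed M) (x : W V s p) :
    (∀ᵐ θ ∂dθ, x.fn θ ∈ M) ↔ ∀ θ, ev x θ ∈ M := by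
  constructor
  · intro h
    have h1 : ∀ᵐ θ ∂dθ, ev x θ ∈ M := by
      filter_upwards [h, W.fn_ae_eq x] with θ h1 h2
      rwa [← h2]
    have h2 : Dense (ev x ⁻¹' M) := Measure.dense_of_ae h1
    intro θ
    have h3 := h2 θ
    rwa [(hM.preimage (ev x).continuous).closure_eq] at h3
  · intro h
    filter_upwards [W.fn_ae_eq x] with θ h2
    rw [h2]
    exact h θ

end SobolevSpace

/-! ### Products of Sobolev functions -/

/-- A bounded bilinear map defined on dense subspaces extends. -/
theorem exists_bilinear_extension {E₁ E₂ F₁ F₂ F₃ : Type*} [AddCommGroup E₁] [Module ℝ E₁]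
    [AddCommGroup E₂] [Module ℝ E₂] [NormedAddCommGroup F₁] [NormedSpace ℝ F₁]
    [NormedAddCommGroup F₂] [NormedSpace ℝ F₂] [NormedAddCommGroup F₃] [NormedSpace ℝ F₃]
    [CompleteSpace F₃] (e₁ : E₁ →ₗ[ℝ] F₁) (e₂ : E₂ →ₗ[ℝ] F₂) (h₁ : DenseRange e₁)
    (h₂ : DenseRange e₂) (β : E₁ →ₗ[ℝ] E₂ →ₗ[ℝ] F₃) {C : ℝ} (hC : 0 ≤ C)
    (h : ∀ f g, ‖β f g‖ ≤ C * ‖e₁ f‖ * ‖e₂ g‖) :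
    ∃ b : F₁ →L[ℝ] F₂ →L[ℝ] F₃, ∀ f g, b (e₁ f) (e₂ g) = β f g := by
  have hβ : ∀ f g, (β f).extendOfNorm e₂ (e₂ g) = β f g := fun f =>
    LinearMap.extendOfNorm_eq h₂ ⟨_, h f⟩
  let φ : E₁ →ₗ[ℝ] F₂ →L[ℝ] F₃ :=
    { toFun := fun f => (β f).extendOfNorm e₂
      map_add' := fun f f' => by
        refine LinearMap.extendOfNorm_unique h₂ _ (h _) _ ?_
        ext1 g
        change (β f).extendOfNorm e₂ (e₂ g) + (β f').extendOfNorm e₂ (e₂ g) = _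
        rw [hβ, hβ, map_add, LinearMap.add_apply]
      map_smul' := fun c f => by
        refine LinearMap.extendOfNorm_unique h₂ _ (h _) _ ?_
        ext1 g
        change c • (β f).extendOfNorm e₂ (e₂ g) = _
        rw [hβ, map_smul, LinearMap.smul_apply] }
  have hφ : ∀ f, ‖φ f‖ ≤ C * ‖e₁ f‖ := fun f =>
    LinearMap.opNorm_extendOfNorm_le h₂ (by positivity) (h f)
  refine ⟨φ.extendOfNorm e₁, fun f g => ?_⟩
  rw [LinearMap.extendOfNorm_eq h₁ ⟨C, hφ⟩]
  exact hβ f g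

section SobolevProduct

variable {V V₁ V₂ V₃ : Type*} [NormedAddCommGroup V] [NormedSpace ℝ V] [CompleteSpace V]
  [NormedAddCommGroup V₁] [NormedSpace ℝ V₁] [CompleteSpace V₁]
  [NormedAddCommGroup V₂] [NormedSpace ℝ V₂] [CompleteSpace V₂]
  [NormedAddCommGroup V₃] [NormedSpace ℝ V₃] [CompleteSpace V₃]
variable {s : ℝ} {p : ENNReal} [Fact (1 ≤ p)]

instance W.instCompleteSpaceOfComplete : CompleteSpace (W V s p) :=
  (smoothGraph V s p).isClosed_topologicalClosure.completeSpace_coe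

variable (s p) in
/-- The product of smooth functions, as a bilinear map to the Sobolev space. -/
noncomputable def smoothMul (B : V₁ →L[ℝ] V₂ →L[ℝ] V₃) :
    smoothSub V₁ →ₗ[ℝ] smoothSub V₂ →ₗ[ℝ] W V₃ s p :=
  (LinearMap.mk₂ ℝ (fun (f : smoothSub V₁) (g : smoothSub V₂) =>
      (⟨pmul B f.1 g.1, IsSmooth.pmul B f.2 g.2⟩ : smoothSub V₃))
    (fun f f' g => Subtype.ext (by ext; simp)) (fun c f g => Subtype.ext (by ext; simp))
    (fun f g g' => Subtype.ext (by ext; simp)) (fun c f g => Subtype.ext (by ext; simp))).compr₂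
    (ofSmooth V₃ s p)

variable [SobolevRange s p]

theorem exists_norm_smoothMul_le (B : V₁ →L[ℝ] V₂ →L[ℝ] V₃) :
    ∃ C, 0 ≤ C ∧ ∀ f g, ‖smoothMul s p B f g‖ ≤
      C * ‖ofSmooth V₁ s p f‖ * ‖ofSmooth V₂ s p g‖ := by
  obtain ⟨C, hC, h⟩ := exists_sobNorm_pmul_le (s := s) B (SobolevRange.one_lt s (p := p))
    (SobolevRange.lt_top s) SobolevRange.inv_lt
  refine ⟨C, hC, fun f g => ?_⟩
  rw [norm_ofSmooth, norm_ofSmooth]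
  refine le_of_eq_of_le (norm_ofSmooth _) (h f.1 g.1 f.2 g.2)

theorem exists_bil (B : V₁ →L[ℝ] V₂ →L[ℝ] V₃) :
    ∃ b : W V₁ s p →L[ℝ] W V₂ s p →L[ℝ] W V₃ s p, ∀ f g,
      b (ofSmooth V₁ s p f) (ofSmooth V₂ s p g) = smoothMul s p B f g := by
  obtain ⟨C, hC, h⟩ := exists_norm_smoothMul_le (s := s) (p := p) B
  have := exists_bilinear_extension _ _ (denseRange_ofSmooth (V := V₁) (s := s) (p := p))
    (denseRange_ofSmooth (V := V₂) (s := s) (p := p)) (smoothMul s p B) hC h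
  exact this

/-- The pointwise product `B(x, y)` of Sobolev functions for a continuous bilinear map `B`. -/
noncomputable def W.bil (B : V₁ →L[ℝ] V₂ →L[ℝ] V₃) : W V₁ s p →L[ℝ] W V₂ s p →L[ℝ] W V₃ s p :=
  (exists_bil B).choose

@[simp] theorem ev_bil (B : V₁ →L[ℝ] V₂ →L[ℝ] V₃) (x : W V₁ s p) (y : W V₂ s p) :
    ev (W.bil B x y) = pmul B (ev x) (ev y) := by
  refine denseRange_ofSmooth.induction_on
    (p := fun x => ev (W.bil B x y) = pmul B (ev x) (ev y)) x
    (isClosed_eq (by fun_prop) (by fun_prop)) fun f => ?_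
  refine denseRange_ofSmooth.induction_on
    (p := fun y => ev (W.bil B (ofSmooth V₁ s p f) y) = pmul B (ev (ofSmooth V₁ s p f)) (ev y)) y
    (isClosed_eq (by fun_prop) (by fun_prop)) fun g => ?_
  have h : W.bil B (ofSmooth V₁ s p f) (ofSmooth V₂ s p g) = smoothMul s p B f g :=
    (exists_bil B).choose_spec f g
  rw [h, ev_ofSmooth, ev_ofSmooth]
  exact ev_ofSmooth _

/-- The constant function `v` in the Sobolev space. -/
noncomputable def W.const (v : V) : W V s p :=
  ofSmooth V s p ⟨ContinuousMap.const S1 v, show IsSmooth _ from contDiff_const⟩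

@[simp] theorem ev_const (v : V) : ev (W.const v : W V s p) = ContinuousMap.const S1 v :=
  ev_ofSmooth _

/-- The pointwise image of Sobolev functions under a linear map `T`. -/
noncomputable def W.map (T : V₁ →L[ℝ] V₂) : W V₁ s p →L[ℝ] W V₂ s p :=
  W.bil ((ContinuousLinearMap.lsmul ℝ ℝ).flip.comp T).flip (W.const (1 : ℝ))

@[simp] theorem ev_map (T : V₁ →L[ℝ] V₂) (x : W V₁ s p) (θ : S1) :
    ev (W.map T x) θ = T (ev x θ) := by
  rw [W.map, ev_bil]
  simp

end SobolevProduct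

/-! ### Continuous representations of a compact Lie group are smooth -/

section Representation

variable {E : Type*} [NormedAddCommGroup E] [NormedSpace ℝ E]
  {G : Type*} [TopologicalSpace G] [Group G] [ChartedSpace E G] [LieGroup 𝓘(ℝ, E) ∞ G]

theorem contMDiffAt_chart_symm (g : G) {y : E} (hy : y ∈ (chartAt E g).target) :
    ContMDiffAt 𝓘(ℝ, E) 𝓘(ℝ, E) ∞ (chartAt E g).symm y :=
  contMDiffOn_chart_symm.contMDiffAt ((chartAt E g).open_target.mem_nhds hy)

theorem contMDiffAt_chart (g : G) {x : G} (hx : x ∈ (chartAt E g).source) :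
    ContMDiffAt 𝓘(ℝ, E) 𝓘(ℝ, E) ∞ (chartAt E g) x :=
  contMDiffOn_chart.contMDiffAt ((chartAt E g).open_source.mem_nhds hx)

/-- In charts at `g` and `g'`, the map `(y, z) ↦ y⁻¹ z` to `G` is smooth. -/
theorem contMDiffAt_inv_mul_chart (g g' : G) {q : E × E} (h1 : q.1 ∈ (chartAt E g).target)
    (h2 : q.2 ∈ (chartAt E g').target) :
    ContMDiffAt 𝓘(ℝ, E × E) 𝓘(ℝ, E) ∞
      (fun q : E × E => ((chartAt E g).symm q.1)⁻¹ * (chartAt E g').symm q.2) q := by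
  have hfst : ContMDiffAt 𝓘(ℝ, E × E) 𝓘(ℝ, E) ∞ (Prod.fst : E × E → E) q :=
    contDiffAt_fst.contMDiffAt
  have hsnd : ContMDiffAt 𝓘(ℝ, E × E) 𝓘(ℝ, E) ∞ (Prod.snd : E × E → E) q :=
    contDiffAt_snd.contMDiffAt
  exact ((contMDiffAt_chart_symm g h1).comp q hfst).inv.mul
    ((contMDiffAt_chart_symm g' h2).comp q hsnd)

/-- The function `y ↦ φ(y⁻¹ g)`, read in the chart at `1`, is differentiable with a derivative that
is continuous in `g` and `y`. -/
theorem fderiv_inv_mul_chart {φ : G → ℝ} (hφ : ContMDiff 𝓘(ℝ, E) 𝓘(ℝ, ℝ) ∞ φ) (g : G)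
    {y : E} (hy : y ∈ (chartAt E (1 : G)).target) :
    DifferentiableAt ℝ (fun y => φ (((chartAt E (1 : G)).symm y)⁻¹ * g)) y ∧
    ContinuousAt (fun q : G × E =>
      fderiv ℝ (fun y => φ (((chartAt E (1 : G)).symm y)⁻¹ * q.1)) q.2) (g, y) := by
  set h : E → E → ℝ := fun z y => φ (((chartAt E (1 : G)).symm y)⁻¹ * (chartAt E g).symm z)
    with hh
  set z := chartAt E g g with hz
  have hzt : z ∈ (chartAt E g).target := mem_chart_target E g
  have h1 : ContDiffAt ℝ ∞ (fun q : E × E => h q.2 q.1) (y, z) :=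
    contMDiffAt_iff_contDiffAt.1
      (hφ.contMDiffAt.comp (y, z) (contMDiffAt_inv_mul_chart (1 : G) g (q := (y, z)) hy hzt))
  constructor
  · have h2 : ContDiffAt ℝ ∞ (fun y => h z y) y :=
      ContDiffAt.comp (g := fun q : E × E => h q.2 q.1) y h1 (contDiffAt_id.prodMk contDiffAt_const)
    have h3 := h2.differentiableAt (by simp)
    simpa [hh, hz] using h3
  · have h4 : ContDiffAt ℝ 0 (fun q : E × E => fderiv ℝ (h q.1) q.2) (z, y) := by
      refine ContDiffAt.fderiv (n := ∞) (f := fun q : E × E => h q.1) ?_ contDiffAt_snd (by simp)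
      exact ContDiffAt.comp (g := fun q : E × E => h q.2 q.1) ((z, y), y) h1
        (contDiffAt_snd.prodMk (contDiffAt_fst.comp _ contDiffAt_fst))
    have h5 : ContinuousAt (fun q : G × E => (chartAt E g q.1, q.2)) (g, y) :=
      (((chartAt E g).continuousAt (mem_chart_source E g)).comp continuousAt_fst).prodMk
        continuousAt_snd
    refine (ContinuousAt.comp (f := fun q : G × E => (chartAt E g q.1, q.2))
      h4.continuousAt h5).congr ?_
    have h6 : ∀ᶠ q : G × E in nhds (g, y), q.1 ∈ (chartAt E g).source :=
      continuousAt_fst.eventually ((chartAt E g).open_source.mem_nhds (mem_chart_source E g))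
    filter_upwards [h6] with q hq
    simp [hh, (chartAt E g).left_inv hq]

variable [FiniteDimensional ℝ E] [CompactSpace G]
  {𝔸 : Type*} [NormedRing 𝔸] [NormedAlgebra ℝ 𝔸] [FiniteDimensional ℝ 𝔸] [CompleteSpace 𝔸]

/-- A continuous representation is differentiable at `1`: up to an invertible factor, it is the
convolution `x ↦ ∫ φ(x⁻¹ g) ρ(g) dg` with a bump function `φ` at `1`. -/
theorem differentiableAt_rep_chart [T2Space G] (ρ : G →* 𝔸) (hρ : Continuous ρ) :
    DifferentiableAt ℝ (fun y => ρ ((chartAt E (1 : G)).symm y)) (chartAt E (1 : G) 1) := by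
  have : IsTopologicalGroup G := topologicalGroup_of_lieGroup 𝓘(ℝ, E) ∞
  have : ProperSpace E := FiniteDimensional.proper ℝ E
  borelize G
  set μ : Measure G := Measure.haar
  set e := chartAt E (1 : G) with he
  set y₀ := e 1 with hy₀
  have hy₀t : y₀ ∈ e.target := mem_chart_target E (1 : G)
  have hint : ∀ {u : G → 𝔸}, Continuous u → Integrable u μ :=
    fun hu => hu.integrable_of_hasCompactSupport (HasCompactSupport.of_compactSpace _)
  have hintr : ∀ {u : G → ℝ}, Continuous u → Integrable u μ :=
    fun hu => hu.integrable_of_hasCompactSupport (HasCompactSupport.of_compactSpace _)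
  obtain ⟨φ, -, hφ⟩ := (SmoothBumpFunction.nhds_basis_tsupport (I := 𝓘(ℝ, E)) (1 : G)).mem_iff.1
    (show {g : G | ‖ρ g - 1‖ < 1 / 2} ∈ nhds (1 : G) from by
      refine (isOpen_lt (by fun_prop) continuous_const).mem_nhds ?_
      simp)
  have hφc : Continuous φ := φ.continuous
  have hφs : ContMDiff 𝓘(ℝ, E) 𝓘(ℝ, ℝ) ∞ φ := φ.contMDiff
  set c : ℝ := ∫ g, φ g ∂μ with hc
  have hc0 : 0 < c := hφc.integral_pos_of_hasCompactSupport_nonneg_nonzero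
    (HasCompactSupport.of_compactSpace _) (fun _ => φ.nonneg) (x := 1) (by simp)
  set A : 𝔸 := ∫ g, φ g • ρ g ∂μ with hA
  have hA1 : ‖A - c • (1 : 𝔸)‖ ≤ c * (1 / 2) := by
    have h1 : A - c • (1 : 𝔸) = ∫ g, φ g • (ρ g - 1) ∂μ := by
      rw [hA, hc, ← integral_smul_const, ← integral_sub (hint (by fun_prop)) (hint (by fun_prop))]
      simp only [smul_sub]
    rw [h1, hc, ← integral_mul_const]
    refine norm_integral_le_of_norm_le ((hintr hφc).mul_const _)
      (Filter.Eventually.of_forall fun g => ?_)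
    rw [norm_smul, Real.norm_of_nonneg φ.nonneg]
    by_cases hg : φ g = 0
    · simp [hg]
    · exact mul_le_mul_of_nonneg_left (hφ (subset_tsupport _ hg)).le φ.nonneg
  -- `A` is invertible as `ρ` is close to `1` on the support of `φ`
  have hAu : IsUnit A := by
    have h1 : ‖(1 : 𝔸) - c⁻¹ • A‖ < 1 := by
      have h2 : (1 : 𝔸) - c⁻¹ • A = -(c⁻¹ • (A - c • (1 : 𝔸))) := by
        rw [smul_sub, smul_smul, inv_mul_cancel₀ hc0.ne', one_smul, neg_sub]
      rw [h2, norm_neg, norm_smul, Real.norm_of_nonneg (by positivity)]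
      calc c⁻¹ * ‖A - c • (1 : 𝔸)‖ ≤ c⁻¹ * (c * (1 / 2)) := by gcongr
        _ = 1 / 2 := by field_simp
        _ < 1 := by norm_num
    have h2 : IsUnit (c⁻¹ • A) := by
      have := (Units.oneSub _ h1).isUnit
      simpa using this
    have h3 := h2.smul (Units.mk0 c hc0.ne')
    rwa [Units.smul_mk0, smul_smul, mul_inv_cancel₀ hc0.ne', one_smul] at h3
  obtain ⟨B, hB⟩ := hAu.exists_right_inv
  -- by invariance of the Haar measure
  have hconv : ∀ x : G, ρ x = (∫ g, φ (x⁻¹ * g) • ρ g ∂μ) * B := by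
    intro x
    have h1 : ∫ g, φ (x⁻¹ * g) • ρ g ∂μ = ρ x * A := by
      rw [← integral_mul_left_eq_self _ x, hA,
        ← ContinuousLinearMap.mul_apply' ℝ 𝔸, ← ContinuousLinearMap.integral_comp_comm _
          (hint (by fun_prop))]
      simp
    rw [h1, mul_assoc, hB, mul_one]
  obtain ⟨r, hr, hrt⟩ := Metric.nhds_basis_closedBall.mem_iff.1 (e.open_target.mem_nhds hy₀t)
  set D : E → G → E →L[ℝ] ℝ := fun y g => fderiv ℝ (fun y => φ ((e.symm y)⁻¹ * g)) y with hD
  have hcont : ContinuousOn (fun q : G × E => D q.2 q.1)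
      (Set.univ ×ˢ Metric.closedBall y₀ r) := fun q hq =>
    (fderiv_inv_mul_chart hφs q.1 (hrt hq.2)).2.continuousWithinAt
  obtain ⟨C, hC⟩ := (isCompact_univ.prod (isCompact_closedBall y₀ r)).exists_bound_of_continuousOn
    hcont
  have hDc : Continuous (D y₀) := continuous_iff_continuousAt.2 fun g =>
    ContinuousAt.comp (f := fun g : G => (g, y₀)) (x := g)
      (fderiv_inv_mul_chart hφs g hy₀t).2 (by fun_prop)
  -- differentiation under the integral sign
  have hF := hasFDerivAt_integral_of_dominated_of_fderiv_le (μ := μ) (𝕜 := ℝ)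
    (F := fun y g => φ ((e.symm y)⁻¹ * g) • ρ g)
    (F' := fun y g => (D y g).smulRight (ρ g)) (bound := fun g => C * ‖ρ g‖)
    (Metric.ball_mem_nhds y₀ hr)
    (Filter.Eventually.of_forall fun y => (hint (by fun_prop)).aestronglyMeasurable)
    (hint (by fun_prop))
    (Continuous.integrable_of_hasCompactSupport
      ((ContinuousLinearMap.smulRightL ℝ E 𝔸).continuous₂.comp (hDc.prodMk hρ))
      (HasCompactSupport.of_compactSpace _)).aestronglyMeasurable
    (Filter.Eventually.of_forall fun g y hy => by
      rw [ContinuousLinearMap.norm_smulRight_apply]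
      exact mul_le_mul_of_nonneg_right
        (hC (g, y) ⟨Set.mem_univ _, Metric.ball_subset_closedBall hy⟩) (norm_nonneg _))
    (hintr (by fun_prop))
    (Filter.Eventually.of_forall fun g y hy =>
      (fderiv_inv_mul_chart hφs g
        (hrt (Metric.ball_subset_closedBall hy))).1.hasFDerivAt.smul_const (ρ g))
  have h := hF.differentiableAt.mul_const B
  exact h.congr_of_eventuallyEq (Filter.Eventually.of_forall fun y => hconv _)

end Representation

section RepresentationSmooth

variable {E : Type*} [NormedAddCommGroup E] [NormedSpace ℝ E]
  {G : Type*} [TopologicalSpace G] [Group G] [ChartedSpace E G]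

variable (E G) in
/-- The chart at `1`. -/
noncomputable abbrev oneChart : OpenPartialHomeomorph G E := chartAt E (1 : G)

variable (G) in
/-- The translate `y ↦ y₁⁻¹ y`, read in the chart at `1`. -/
noncomputable def chartTransl (y₁ y : E) : E :=
  oneChart E G (((oneChart E G).symm y₁)⁻¹ * (oneChart E G).symm y)

variable (G) in
/-- The derivative of `y ↦ y₁⁻¹ y` at `y₁`, that is, the Maurer-Cartan form, read in the chart at
`1`. -/
noncomputable def maurerCartan (y : E) : E →L[ℝ] E := fderiv ℝ (chartTransl G y) y

section

variable [LieGroup 𝓘(ℝ, E) ∞ G]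

theorem contDiffAt_chartTransl {y : E} (hy : y ∈ (oneChart E G).target) :
    ContDiffAt ℝ ∞ (Function.uncurry (chartTransl G)) (y, y) := by
  refine contMDiffAt_iff_contDiffAt.1 ?_
  refine ContMDiffAt.comp (g := oneChart E G) (y, y) ?_
    (contMDiffAt_inv_mul_chart (1 : G) (1 : G) (q := (y, y)) hy hy)
  refine contMDiffAt_chart (1 : G) ?_
  rw [inv_mul_cancel]
  exact mem_chart_source E (1 : G)

theorem contDiffAt_maurerCartan {y : E} (hy : y ∈ (oneChart E G).target) :
    ContDiffAt ℝ ∞ (maurerCartan G) y :=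
  ContDiffAt.fderiv (n := ∞) (g := fun y => y) (contDiffAt_chartTransl hy) contDiffAt_id (by simp)

theorem hasFDerivAt_chartTransl {y : E} (hy : y ∈ (oneChart E G).target) :
    HasFDerivAt (chartTransl G y) (maurerCartan G y) y := by
  have h : ContDiffAt ℝ ∞ (chartTransl G y) y :=
    ContDiffAt.comp (g := Function.uncurry (chartTransl G)) y (contDiffAt_chartTransl hy)
      (contDiffAt_const.prodMk contDiffAt_id)
  exact (h.differentiableAt (by simp)).hasFDerivAt

theorem chartTransl_self (y : E) : chartTransl G y y = oneChart E G 1 := by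
  rw [chartTransl, inv_mul_cancel]

theorem maurerCartan_one : maurerCartan G (oneChart E G 1) = 1 := by
  have h : chartTransl G (oneChart E G 1) =ᶠ[nhds (oneChart E G 1)] id := by
    filter_upwards [(oneChart E G).open_target.mem_nhds (mem_chart_target E (1 : G))] with y hy
    rw [chartTransl, (oneChart E G).left_inv (mem_chart_source E (1 : G)), inv_one, one_mul,
      (oneChart E G).right_inv hy, id]
  rw [maurerCartan, h.fderiv_eq, fderiv_id]
  rfl

variable [FiniteDimensional ℝ E] [CompactSpace G]
  {𝔸 : Type*} [NormedRing 𝔸] [NormedAlgebra ℝ 𝔸] [FiniteDimensional ℝ 𝔸] [CompleteSpace 𝔸]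

variable (E) in
/-- A representation, read in the chart at `1`. -/
noncomputable def repChart (ρ : G →* 𝔸) (y : E) : 𝔸 := ρ ((oneChart E G).symm y)

variable (E) in
/-- The derivative at `1` of a representation, read in the chart at `1`. -/
noncomputable def repDeriv (ρ : G →* 𝔸) : E →L[ℝ] 𝔸 := fderiv ℝ (repChart E ρ) (oneChart E G 1)

omit [LieGroup 𝓘(ℝ, E) ∞ G] [FiniteDimensional ℝ E] [CompactSpace G] [FiniteDimensional ℝ 𝔸]
  [CompleteSpace 𝔸] in
theorem repChart_one (ρ : G →* 𝔸) : repChart E ρ (oneChart E G 1) = 1 := by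
  rw [repChart, (oneChart E G).left_inv (mem_chart_source E (1 : G)), map_one]

variable [T2Space G]

/-- The differential equation `dρ = ρ · L(θ)` satisfied by a representation `ρ` with derivative `L`
at `1`, where `θ` is the Maurer-Cartan form. -/
theorem hasFDerivAt_repChart (ρ : G →* 𝔸) (hρ : Continuous ρ) {y : E}
    (hy : y ∈ (oneChart E G).target) :
    HasFDerivAt (repChart E ρ) ((ContinuousLinearMap.mul ℝ 𝔸 (repChart E ρ y)).comp
      ((repDeriv E ρ).comp (maurerCartan G y))) y := by
  have h1 : HasFDerivAt (repChart E ρ) (repDeriv E ρ) (chartTransl G y y) := by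
    rw [chartTransl_self]
    exact (differentiableAt_rep_chart (E := E) ρ hρ).hasFDerivAt
  have h2 := ((ContinuousLinearMap.mul ℝ 𝔸 (repChart E ρ y)).hasFDerivAt).comp y
    (h1.comp y (hasFDerivAt_chartTransl hy))
  refine h2.congr_of_eventuallyEq ?_
  have h3 : ContinuousAt (fun z => ((oneChart E G).symm y)⁻¹ * (oneChart E G).symm z) y := by
    have : IsTopologicalGroup G := topologicalGroup_of_lieGroup 𝓘(ℝ, E) ∞
    exact continuousAt_const.mul ((oneChart E G).continuousAt_symm hy)
  have h4 := h3.eventually ((oneChart E G).open_source.mem_nhds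
    (by beta_reduce; rw [inv_mul_cancel]; exact mem_chart_source E (1 : G)))
  filter_upwards [h4] with z hz
  simp only [Function.comp, ContinuousLinearMap.mul_apply', repChart, chartTransl]
  rw [(oneChart E G).left_inv hz, ← map_mul, mul_inv_cancel_left]

/-- By its differential equation, a representation is as smooth as needed in the chart at `1`. -/
theorem contDiffOn_repChart (ρ : G →* 𝔸) (hρ : Continuous ρ) :
    ContDiffOn ℝ ∞ (repChart E ρ) (oneChart E G).target := by
  have hd : DifferentiableOn ℝ (repChart E ρ) (oneChart E G).target := fun y hy =>
    (hasFDerivAt_repChart ρ hρ hy).differentiableAt.differentiableWithinAt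
  refine contDiffOn_infty.2 fun m => ?_
  induction m with
  | zero => exact contDiffOn_zero.2 hd.continuousOn
  | succ m ih =>
    rw [Nat.cast_add_one, contDiffOn_succ_iff_fderiv_of_isOpen (oneChart E G).open_target]
    refine ⟨hd, by simp, ?_⟩
    have h : ContDiffOn ℝ m (fun y => (ContinuousLinearMap.mul ℝ 𝔸 (repChart E ρ y)).comp
        ((repDeriv E ρ).comp (maurerCartan G y))) (oneChart E G).target := by
      refine ContDiffOn.clm_comp ((ContinuousLinearMap.mul ℝ 𝔸).contDiff.comp_contDiffOn ih)
        (contDiffOn_const.clm_comp fun y hy => ?_)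
      exact ((contDiffAt_maurerCartan hy).of_le (by exact_mod_cast le_top)).contDiffWithinAt
    exact h.congr fun y hy => (hasFDerivAt_repChart ρ hρ hy).fderiv

theorem contMDiff_rep (ρ : G →* 𝔸) (hρ : Continuous ρ) : ContMDiff 𝓘(ℝ, E) 𝓘(ℝ, 𝔸) ∞ ρ := by
  have h1 : ContMDiffAt 𝓘(ℝ, E) 𝓘(ℝ, 𝔸) ∞ ρ 1 := by
    have h2 := ((contDiffOn_repChart (E := E) ρ hρ).contDiffAt
      ((oneChart E G).open_target.mem_nhds (mem_chart_target E (1 : G)))).contMDiffAt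
    refine (h2.comp (1 : G) (contMDiffAt_chart (1 : G)
      (mem_chart_source E (1 : G)))).congr_of_eventuallyEq ?_
    filter_upwards [(oneChart E G).open_source.mem_nhds (mem_chart_source E (1 : G))] with x hx
    rw [Function.comp, repChart, (oneChart E G).left_inv hx]
  intro g
  have h2 : ContMDiffAt 𝓘(ℝ, E) 𝓘(ℝ, 𝔸) ∞ ρ (g⁻¹ * g) := by rwa [inv_mul_cancel]
  have h3 := h2.comp g (contMDiff_mul_left (I := 𝓘(ℝ, E)) (n := ∞) (a := g⁻¹)).contMDiffAt
  have h4 := (ContinuousLinearMap.mul ℝ 𝔸 (ρ g)).contMDiff.contMDiffAt.comp g h3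
  refine h4.congr_of_eventuallyEq (Filter.Eventually.of_forall fun x => ?_)
  simp only [Function.comp, ContinuousLinearMap.mul_apply']
  rw [← map_mul, mul_inv_cancel_left]

/-- The one-parameter subgroups of `G`, as far as the representation `ρ` sees them: they are the
integral curves of left-invariant vector fields. -/
theorem exists_integral_curve (ρ : G →* 𝔸) (hρ : Continuous ρ) (v : E) :
    ∃ α : ℝ → E, α 0 = oneChart E G 1 ∧ HasDerivAt α v 0 ∧
      ∀ᶠ t : ℝ in nhds 0, α t ∈ (oneChart E G).target ∧
        repChart E ρ (α t) = NormedSpace.exp (t • repDeriv E ρ v) := by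
  set y₀ := oneChart E G 1 with hy₀
  have hy₀t : y₀ ∈ (oneChart E G).target := mem_chart_target E (1 : G)
  set X := repDeriv E ρ v with hX
  have hJ : ContDiffAt ℝ ∞ (maurerCartan G) y₀ := contDiffAt_maurerCartan hy₀t
  have hJ1 : maurerCartan G y₀ = ((1 : (E →L[ℝ] E)ˣ) : E →L[ℝ] E) := maurerCartan_one
  have : CompleteSpace E := FiniteDimensional.complete ℝ E
  -- the left-invariant vector field with value `v` at `1`
  set F : E → E := fun y => Ring.inverse (maurerCartan G y) v with hF
  have hFc : ContDiffAt ℝ ∞ F y₀ := by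
    have h1 : ContDiffAt ℝ ∞ (Ring.inverse : (E →L[ℝ] E) → (E →L[ℝ] E)) (maurerCartan G y₀) := by
      rw [hJ1]
      exact contDiffAt_ringInverse ℝ _
    exact (h1.comp y₀ hJ).clm_apply contDiffAt_const
  have hF0 : F y₀ = v := by simp [hF, hJ1]
  obtain ⟨r, hr, ε, hε, hα⟩ :=
    ContDiffAt.exists_forall_mem_closedBall_exists_eq_forall_mem_Ioo_hasDerivAt
      (hFc.of_le (m := 1) (by exact_mod_cast le_top)) 0
  obtain ⟨α, hα0, hα⟩ := hα y₀ (Metric.mem_closedBall_self hr.le)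
  have hα' : HasDerivAt α v 0 := by
    have := hα 0 ⟨by linarith, by linarith⟩
    rwa [hα0, hF0] at this
  refine ⟨α, hα0, hα', ?_⟩
  have hev : ∀ᶠ t in nhds (0 : ℝ), α t ∈ (oneChart E G).target ∧ IsUnit (maurerCartan G (α t)) ∧
      t ∈ Set.Ioo (0 - ε) (0 + ε) := by
    have h1 := hα'.continuousAt.eventually
      (by rw [hα0]; exact (oneChart E G).open_target.mem_nhds hy₀t)
    have h2 : ∀ᶠ y in nhds y₀, IsUnit (maurerCartan G y) :=
      hJ.continuousAt.eventually (by rw [hJ1]; exact Units.nhds 1)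
    have h3 := hα'.continuousAt.eventually (by rw [hα0]; exact h2)
    exact h1.and (h3.and (Ioo_mem_nhds (by linarith) (by linarith)))
  obtain ⟨δ, hδ, hball⟩ := Metric.eventually_nhds_iff_ball.1 hev
  have hderiv : ∀ t ∈ Metric.ball (0 : ℝ) δ,
      HasDerivAt (fun t => repChart E ρ (α t) * NormedSpace.exp (t • (-X))) 0 t := by
    intro t ht
    obtain ⟨h1, h2, h3⟩ := hball t ht
    have h4 := (hasFDerivAt_repChart ρ hρ h1).comp_hasDerivAt t (hα t h3)
    have h5 : maurerCartan G (α t) (F (α t)) = v := by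
      rw [hF, ← mul_apply_eq_comp, Ring.mul_inverse_cancel _ h2, one_apply_eq_self]
    simp only [ContinuousLinearMap.comp_apply, h5, ContinuousLinearMap.mul_apply'] at h4
    have h6 := h4.mul (hasDerivAt_exp_smul_const' (𝕂 := ℝ) (-X) t)
    refine h6.congr_deriv ?_
    simp only [Function.comp, ← hX]
    noncomm_ring
  refine Metric.eventually_nhds_iff_ball.2 ⟨δ, hδ, fun t ht => ⟨(hball t ht).1, ?_⟩⟩
  have hconst := Metric.isOpen_ball.is_const_of_deriv_eq_zero
    (convex_ball (0 : ℝ) δ).isPreconnected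
    (fun t ht => (hderiv t ht).differentiableAt.differentiableWithinAt)
    (fun t ht => (hderiv t ht).deriv) ht (Metric.mem_ball_self hδ)
  simp only [zero_smul, NormedSpace.exp_zero, mul_one, hα0] at hconst
  rw [repChart_one] at hconst
  have hexp : NormedSpace.exp (t • -X) * NormedSpace.exp (t • X) = 1 := by
    let _ : NormedAlgebra ℚ 𝔸 := NormedAlgebra.restrictScalars ℚ ℝ 𝔸
    rw [← NormedSpace.exp_add_of_commute]
    · simp
    · exact ((Commute.refl X).neg_left.smul_left t).smul_right t
  calc repChart E ρ (α t)
      = repChart E ρ (α t) * (NormedSpace.exp (t • -X) * NormedSpace.exp (t • X)) := by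
        rw [hexp, mul_one]
    _ = _ := by rw [← mul_assoc, hconst, one_mul]

/-- A faithful representation is an immersion: a vector in the kernel of its derivative gives a
constant one-parameter subgroup. -/
theorem repDeriv_injective (ρ : G →* 𝔸) (hρ : Continuous ρ) (hinj : Function.Injective ρ) :
    Function.Injective (repDeriv E ρ) := by
  rw [injective_iff_map_eq_zero]
  intro v hv
  obtain ⟨α, hα0, hα, hev⟩ := exists_integral_curve (E := E) ρ hρ v
  have h : α =ᶠ[nhds 0] fun _ => oneChart E G 1 := by
    filter_upwards [hev] with t ⟨ht, h⟩
    rw [hv, smul_zero, NormedSpace.exp_zero, repChart, ← map_one ρ] at h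
    rw [← hinj h, (oneChart E G).right_inv ht]
  exact (hα.congr_of_eventuallyEq h.symm).unique (hasDerivAt_const _ _)

/-- The one-parameter subgroups exist for small times, and then for all times by taking powers. -/
theorem exp_repDeriv_mem_range (ρ : G →* 𝔸) (hρ : Continuous ρ) (v : E) :
    NormedSpace.exp (repDeriv E ρ v) ∈ Set.range ρ := by
  obtain ⟨α, -, -, hev⟩ := exists_integral_curve (E := E) ρ hρ v
  have hlim : Filter.Tendsto (fun n : ℕ => 1 / ((n : ℝ) + 1)) Filter.atTop (nhds 0) :=
    tendsto_one_div_add_atTop_nhds_zero_nat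
  obtain ⟨n, -, hn⟩ := (hlim.eventually hev).exists
  refine ⟨((oneChart E G).symm (α (1 / ((n : ℝ) + 1)))) ^ (n + 1), ?_⟩
  rw [map_pow]
  let _ : NormedAlgebra ℚ 𝔸 := NormedAlgebra.restrictScalars ℚ ℝ 𝔸
  change repChart E ρ _ ^ (n + 1) = _
  rw [hn, ← NormedSpace.exp_nsmul, ← Nat.cast_smul_eq_nsmul ℝ, smul_smul]
  have : ((n + 1 : ℕ) : ℝ) * (1 / ((n : ℝ) + 1)) = 1 := by
    rw [Nat.cast_add_one]
    exact mul_one_div_cancel (by positivity)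
  rw [this, one_smul]

end

end RepresentationSmooth

/-! ### The exponential map and linear groups -/

/-- The inverse function theorem, including the regularity of the inverse. -/
theorem exists_local_inverse {E F : Type*} [NormedAddCommGroup E] [NormedSpace ℝ E]
    [CompleteSpace E] [NormedAddCommGroup F] [NormedSpace ℝ F] {f : E → F} (f' : E ≃L[ℝ] F)
    {a : E} {n : ℕ∞ω} (hn : n ≠ 0) (hf : ContDiffAt ℝ n f a)
    (hf' : HasFDerivAt f (f' : E →L[ℝ] F) a) :
    ∃ g : F → E, g (f a) = a ∧ ContDiffAt ℝ n g (f a) ∧ (∀ᶠ x in nhds a, g (f x) = x) ∧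
      ∀ᶠ y in nhds (f a), f (g y) = y := by
  have hs : HasStrictFDerivAt f (f' : E →L[ℝ] F) a := hf.hasStrictFDerivAt' hf' hn
  exact ⟨hs.localInverse f f' a, hs.localInverse_apply_image,
    hf.to_localInverse hf' hn, hs.eventually_left_inverse, hs.eventually_right_inverse⟩

section Exp

variable (𝔸 : Type*) [NormedRing 𝔸] [NormedAlgebra ℝ 𝔸] [CompleteSpace 𝔸]

theorem contDiff_exp : ContDiff ℝ ω (NormedSpace.exp : 𝔸 → 𝔸) := by
  rw [contDiff_omega_iff_analyticOnNhd]
  exact fun x _ => NormedSpace.exp_analytic x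

theorem exists_log : ∃ g : 𝔸 → 𝔸, g 1 = 0 ∧ ContDiffAt ℝ ω g 1 ∧
    (∀ᶠ x in nhds (0 : 𝔸), g (NormedSpace.exp x) = x) ∧
      ∀ᶠ y in nhds (1 : 𝔸), NormedSpace.exp (g y) = y := by
  have h := exists_local_inverse (ContinuousLinearEquiv.refl ℝ 𝔸) (n := ω) (by simp)
    (contDiff_exp 𝔸).contDiffAt (hasFDerivAt_exp_zero (𝕂 := ℝ))
  simpa only [NormedSpace.exp_zero] using h

/-- The logarithm in a Banach algebra, near `1`. -/
noncomputable def log : 𝔸 → 𝔸 := (exists_log 𝔸).choose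

theorem log_one : log 𝔸 1 = 0 := (exists_log 𝔸).choose_spec.1

theorem contDiffAt_log : ContDiffAt ℝ ω (log 𝔸) 1 := (exists_log 𝔸).choose_spec.2.1

theorem eventually_log_exp : ∀ᶠ x in nhds (0 : 𝔸), log 𝔸 (NormedSpace.exp x) = x :=
  (exists_log 𝔸).choose_spec.2.2.1

theorem eventually_exp_log : ∀ᶠ y in nhds (1 : 𝔸), NormedSpace.exp (log 𝔸 y) = y :=
  (exists_log 𝔸).choose_spec.2.2.2

end Exp

section RepLog

variable {E : Type*} [NormedAddCommGroup E] [NormedSpace ℝ E] [FiniteDimensional ℝ E]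
  {G : Type*} [TopologicalSpace G] [Group G] [ChartedSpace E G] [LieGroup 𝓘(ℝ, E) ∞ G]
  [CompactSpace G] [T2Space G]
  {𝔸 : Type*} [NormedRing 𝔸] [NormedAlgebra ℝ 𝔸] [FiniteDimensional ℝ 𝔸] [CompleteSpace 𝔸]
  {ρ : G →* 𝔸}

variable (E ρ) in
/-- The Lie algebra of the image of a representation. -/
noncomputable abbrev repAlg : Submodule ℝ 𝔸 := LinearMap.range (repDeriv E ρ).toLinearMap

/-- A smooth map `u` on the algebra that recovers the coordinates of `g` near `1` from `ρ(g)`; it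
only uses a projection of `ρ(g) - 1` to the Lie algebra. -/
theorem exists_coordinates (hρ : Continuous ρ) (hinj : Function.Injective ρ)
    (π : 𝔸 →L[ℝ] repAlg E ρ) (hπ : ∀ x : repAlg E ρ, π x = x) :
    ∃ u : repAlg E ρ → E, ContDiffAt ℝ ∞ u 0 ∧ u 0 = oneChart E G 1 ∧
      ∀ᶠ a in nhds (1 : 𝔸), ∀ g : G, ρ g = a →
        g ∈ (oneChart E G).source ∧ u (π (a - 1)) = oneChart E G g := by
  set y₀ := oneChart E G 1 with hy₀
  have hy₀t : y₀ ∈ (oneChart E G).target := mem_chart_target E (1 : G)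
  have : CompleteSpace E := FiniteDimensional.complete ℝ E
  set f : E → (repAlg E ρ) := fun y => π (repChart E ρ y - 1) with hf
  have hfc : ContDiffAt ℝ ∞ f y₀ := π.contDiff.contDiffAt.comp y₀
    ((((contDiffOn_repChart ρ hρ).contDiffAt ((oneChart E G).open_target.mem_nhds hy₀t))).sub
      contDiffAt_const)
  have hf0 : f y₀ = 0 := by
    simp only [hf]
    rw [repChart_one, sub_self, map_zero]
  let Lequiv : E ≃L[ℝ] repAlg E ρ := LinearEquiv.toContinuousLinearEquiv
    (LinearEquiv.ofInjective (repDeriv E ρ).toLinearMap (repDeriv_injective ρ hρ hinj))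
  have hf' : HasFDerivAt f (Lequiv : E →L[ℝ] repAlg E ρ) y₀ := by
    have h1 : HasFDerivAt (repChart E ρ) (repDeriv E ρ) y₀ :=
      (differentiableAt_rep_chart (E := E) ρ hρ).hasFDerivAt
    refine (π.hasFDerivAt.comp y₀ (h1.sub_const 1)).congr_fderiv ?_
    ext v : 1
    exact hπ ⟨repDeriv E ρ v, v, rfl⟩
  obtain ⟨u, hu0, huc, hu1, -⟩ := exists_local_inverse Lequiv (by simp) hfc hf'
  rw [hf0] at hu0 huc
  refine ⟨u, huc, hu0, ?_⟩
  have hemb : nhds (1 : G) = Filter.comap ρ (nhds 1) := by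
    rw [(hρ.isClosedEmbedding hinj).isInducing.nhds_eq_comap, map_one]
  have hg : ∀ᶠ g in nhds (1 : G), g ∈ (oneChart E G).source ∧
      u (f (oneChart E G g)) = oneChart E G g :=
    Filter.Eventually.and ((oneChart E G).open_source.mem_nhds (mem_chart_source E (1 : G)))
      (((oneChart E G).continuousAt (mem_chart_source E (1 : G))).eventually hu1)
  rw [hemb, Filter.eventually_comap] at hg
  filter_upwards [hg] with a ha g hga
  obtain ⟨h1, h2⟩ := ha g hga
  refine ⟨h1, ?_⟩
  have h3 : repChart E ρ (oneChart E G g) = a := by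
    rw [repChart, (oneChart E G).left_inv h1, hga]
  rw [← h2]
  simp only [hf, h3]

omit [CompleteSpace 𝔸] in
theorem exists_projection (k : Submodule ℝ 𝔸) : ∃ π : 𝔸 →L[ℝ] k, ∀ x : k, π x = x := by
  obtain ⟨π, hπ⟩ := k.subtype.exists_leftInverse_of_injective k.ker_subtype
  exact ⟨π.toContinuousLinearMap, fun x => LinearMap.congr_fun hπ x⟩

/-- Near `0`, only elements of the Lie algebra have their exponential in the group. -/
theorem eventually_mem_of_exp_mem_range (hρ : Continuous ρ) (hinj : Function.Injective ρ) :
    ∀ᶠ Z in nhds (0 : 𝔸), NormedSpace.exp Z ∈ Set.range ρ → Z ∈ repAlg E ρ := by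
  obtain ⟨π, hπ⟩ := exists_projection (repAlg E ρ)
  obtain ⟨u, -, -, hu⟩ := exists_coordinates hρ hinj π hπ
  -- `exp Z` and `exp X` have the same coordinates for some `X` in the Lie algebra, so they are
  -- equal if they are in the group
  have hexp : ContDiff ℝ ω fun X : repAlg E ρ => π (NormedSpace.exp (X : 𝔸) - 1) :=
    π.contDiff.comp (((contDiff_exp 𝔸).comp (Submodule.subtypeL (repAlg E ρ)).contDiff).sub
      contDiff_const)
  have hexp' : HasFDerivAt (fun X : repAlg E ρ => π (NormedSpace.exp (X : 𝔸) - 1))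
      ((ContinuousLinearEquiv.refl ℝ (repAlg E ρ) : repAlg E ρ ≃L[ℝ] repAlg E ρ) :
        repAlg E ρ →L[ℝ] repAlg E ρ) 0 := by
    have h1 : HasFDerivAt (NormedSpace.exp : 𝔸 → 𝔸) (1 : 𝔸 →L[ℝ] 𝔸)
        (Submodule.subtypeL (repAlg E ρ) 0) := by
      rw [map_zero]
      exact hasFDerivAt_exp_zero
    refine (π.hasFDerivAt.comp (0 : repAlg E ρ)
      ((h1.comp (0 : repAlg E ρ)
        (Submodule.subtypeL (repAlg E ρ)).hasFDerivAt).sub_const 1)).congr_fderiv ?_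
    ext X : 1
    exact hπ X
  obtain ⟨v, hv0, hvc, -, hv⟩ := exists_local_inverse _ (by simp) hexp.contDiffAt hexp'
  simp only [ZeroMemClass.coe_zero, NormedSpace.exp_zero, sub_self, map_zero] at hv0 hvc hv
  have he : Filter.Tendsto (NormedSpace.exp : 𝔸 → 𝔸) (nhds 0) (nhds 1) := by
    have := (contDiff_exp 𝔸).continuous.tendsto 0
    rwa [NormedSpace.exp_zero] at this
  have hw : Filter.Tendsto (fun Z : 𝔸 => π (NormedSpace.exp Z - 1)) (nhds 0) (nhds 0) := by
    have := (π.continuous.tendsto _).comp (he.sub_const 1)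
    rwa [sub_self, map_zero] at this
  have hX : Filter.Tendsto (fun Z : 𝔸 => ((v (π (NormedSpace.exp Z - 1)) : repAlg E ρ) : 𝔸))
      (nhds 0) (nhds 0) := by
    have h1 : Filter.Tendsto v (nhds 0) (nhds 0) := by
      have := hvc.continuousAt.tendsto
      rwa [hv0] at this
    exact (continuous_subtype_val.tendsto (0 : repAlg E ρ)).comp (h1.comp hw)
  filter_upwards [he.eventually hu, (he.comp hX).eventually hu, hw.eventually hv,
    eventually_log_exp 𝔸, hX.eventually (eventually_log_exp 𝔸)] with Z h1 h2 h3 h4 h5 ⟨g, hg⟩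
  obtain ⟨w, hw⟩ := (v (π (NormedSpace.exp Z - 1))).2
  obtain ⟨g', hg'⟩ := exp_repDeriv_mem_range (E := E) ρ hρ w
  have hw' : repDeriv E ρ w = ((v (π (NormedSpace.exp Z - 1)) : repAlg E ρ) : 𝔸) := hw
  rw [hw'] at hg'
  obtain ⟨h1s, h1u⟩ := h1 g hg
  obtain ⟨h2s, h2u⟩ := h2 g' hg'
  simp only [Function.comp, h3] at h2u
  have hgg : g = g' := (oneChart E G).injOn h1s h2s (h1u.symm.trans h2u)
  have hZ : Z = ((v (π (NormedSpace.exp Z - 1)) : repAlg E ρ) : 𝔸) := by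
    refine h4.symm.trans (Eq.trans ?_ h5)
    exact congrArg (log 𝔸) (hg.symm.trans ((congrArg ρ hgg).trans hg'))
  rw [hZ]
  exact Subtype.mem _

/-- A loop in `G` is smooth if its image under a faithful representation is smooth. -/
theorem contMDiff_of_rep_comp (hρ : Continuous ρ) (hinj : Function.Injective ρ) {γ : ℝ → G}
    (hγ : ContDiff ℝ ∞ fun x => ρ (γ x)) : ContMDiff 𝓘(ℝ, ℝ) 𝓘(ℝ, E) ∞ γ := by
  obtain ⟨π, hπ⟩ := exists_projection (repAlg E ρ)
  obtain ⟨u, hu, hu0, hev⟩ := exists_coordinates hρ hinj π hπ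
  intro x₀
  set g := γ x₀ with hg
  set a : ℝ → 𝔸 := fun x => ρ (g⁻¹ * γ x) with ha
  have hac : ContDiff ℝ ∞ a := by
    simp only [ha, map_mul]
    exact contDiff_const.mul hγ
  have ha0 : a x₀ = 1 := by
    simp only [ha, ← hg, inv_mul_cancel, map_one]
  have h1 : ContDiffAt ℝ ∞ (fun x => u (π (a x - 1))) x₀ := by
    refine ContDiffAt.comp x₀ ?_ (π.contDiff.comp (hac.sub contDiff_const)).contDiffAt
    rwa [ha0, sub_self, map_zero]
  have h2 : ContMDiffAt 𝓘(ℝ, ℝ) 𝓘(ℝ, E) ∞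
      (fun x => g * (oneChart E G).symm (u (π (a x - 1)))) x₀ := by
    refine (contMDiff_mul_left (I := 𝓘(ℝ, E)) (n := ∞) (a := g)).contMDiffAt.comp x₀ ?_
    refine ContMDiffAt.comp x₀ (contMDiffAt_chart_symm (1 : G) ?_) h1.contMDiffAt
    rw [ha0, sub_self, map_zero, hu0]
    exact mem_chart_target E (1 : G)
  refine h2.congr_of_eventuallyEq ?_
  have h3 : Filter.Tendsto a (nhds x₀) (nhds 1) := by
    have := hac.continuous.tendsto x₀
    rwa [ha0] at this
  filter_upwards [h3.eventually hev] with x hx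
  obtain ⟨h4, h5⟩ := hx (g⁻¹ * γ x) rfl
  rw [h5, (oneChart E G).left_inv h4, mul_inv_cancel_left]

end RepLog

section LinearGroup

variable {𝔸 : Type*} [NormedRing 𝔸] [NormedAlgebra ℝ 𝔸] [CompleteSpace 𝔸]

/-- A compact group `H` in a Banach algebra, with Lie algebra `k`. The inverse of elements of `H`
is required to be given by a linear map `T`. -/
structure IsLinearGroup (H : Set 𝔸) (k : Submodule ℝ 𝔸) (T : 𝔸 →L[ℝ] 𝔸) : Prop where
  isCompact : IsCompact H
  one_mem : 1 ∈ H
  mul_mem : ∀ {a b}, a ∈ H → b ∈ H → a * b ∈ H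
  inv_mem : ∀ {a}, a ∈ H → T a ∈ H
  mul_inv : ∀ {a}, a ∈ H → a * T a = 1
  inv_mul : ∀ {a}, a ∈ H → T a * a = 1
  exp_mem : ∀ {X}, X ∈ k → NormedSpace.exp X ∈ H
  eventually_mem : ∀ᶠ Z in nhds (0 : 𝔸), NormedSpace.exp Z ∈ H → Z ∈ k

theorem isLinearGroup_range {E : Type*} [NormedAddCommGroup E] [NormedSpace ℝ E]
    [FiniteDimensional ℝ E] {G : Type*} [TopologicalSpace G] [Group G] [ChartedSpace E G]
    [LieGroup 𝓘(ℝ, E) ∞ G] [CompactSpace G] [T2Space G] [FiniteDimensional ℝ 𝔸] {ρ : G →* 𝔸}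
    (hρ : Continuous ρ) (hinj : Function.Injective ρ) {T : 𝔸 →L[ℝ] 𝔸}
    (hT : ∀ g, ρ g⁻¹ = T (ρ g)) : IsLinearGroup (Set.range ρ) (repAlg E ρ) T where
  isCompact := isCompact_range hρ
  one_mem := ⟨1, map_one ρ⟩
  mul_mem := by
    rintro _ _ ⟨g, rfl⟩ ⟨h, rfl⟩
    exact ⟨g * h, map_mul ρ g h⟩
  inv_mem := by
    rintro _ ⟨g, rfl⟩
    exact ⟨g⁻¹, hT g⟩
  mul_inv := by
    rintro _ ⟨g, rfl⟩
    rw [← hT, ← map_mul, mul_inv_cancel, map_one]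
  inv_mul := by
    rintro _ ⟨g, rfl⟩
    rw [← hT, ← map_mul, inv_mul_cancel, map_one]
  exp_mem := by
    rintro _ ⟨v, rfl⟩
    exact exp_repDeriv_mem_range ρ hρ v
  eventually_mem := eventually_mem_of_exp_mem_range hρ hinj

/-- By averaging a Hermitian form over the group, the inverse of the elements of a compact matrix
group is seen to be a conjugate of the Hermitian adjoint. -/
theorem exists_linear_inverse {G : Type*} [TopologicalSpace G] [Group G] [IsTopologicalGroup G]
    [CompactSpace G] [T2Space G] {n : ℕ} (ρ : G →* Matrix (Fin n) (Fin n) ℂ)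
    (hρ : Continuous ρ) :
    ∃ T : Matrix (Fin n) (Fin n) ℂ →L[ℝ] Matrix (Fin n) (Fin n) ℂ, ∀ g, ρ g⁻¹ = T (ρ g) := by
  classical
  borelize G
  set μ : Measure G := Measure.haar
  have hc : Continuous fun g : G => (ρ g⁻¹).conjTranspose * ρ g⁻¹ := by fun_prop
  have hint := hc.integrable_of_hasCompactSupport (μ := μ) (HasCompactSupport.of_compactSpace _)
  set P := ∫ g, (ρ g⁻¹).conjTranspose * ρ g⁻¹ ∂μ with hP
  have hinv : ∀ h : G, (ρ h).conjTranspose * P * ρ h = P := by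
    intro h
    let C : Matrix (Fin n) (Fin n) ℂ →L[ℝ] Matrix (Fin n) (Fin n) ℂ :=
      (ContinuousLinearMap.mul ℝ _ (ρ h).conjTranspose).comp
        ((ContinuousLinearMap.mul ℝ _).flip (ρ h))
    have h1 : (ρ h).conjTranspose * P * ρ h = C P := by
      simp [C, mul_assoc]
    rw [h1, hP, ← ContinuousLinearMap.integral_comp_comm _ hint,
      ← integral_mul_left_eq_self _ h]
    congr 1
    ext1 g
    simp only [C, ContinuousLinearMap.comp_apply, ContinuousLinearMap.flip_apply,
      ContinuousLinearMap.mul_apply', mul_inv_rev, map_mul, Matrix.conjTranspose_mul]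
    have h2 : ρ h⁻¹ * ρ h = 1 := by rw [← map_mul, inv_mul_cancel, map_one]
    have h3 : (ρ h).conjTranspose * (ρ h⁻¹).conjTranspose = 1 := by
      rw [← Matrix.conjTranspose_mul, h2, Matrix.conjTranspose_one]
    calc _ = ((ρ h).conjTranspose * (ρ h⁻¹).conjTranspose) * (ρ g⁻¹).conjTranspose *
          (ρ g⁻¹ * (ρ h⁻¹ * ρ h)) := by simp only [mul_assoc]
      _ = _ := by rw [h2, h3, one_mul, mul_one]
  -- `P` is positive definite
  have hdet : P.det ≠ 0 := by
    intro h0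
    obtain ⟨v, hv, hPv⟩ := Matrix.exists_mulVec_eq_zero_iff.2 h0
    let Λ : Matrix (Fin n) (Fin n) ℂ →ₗ[ℝ] ℝ :=
      { toFun := fun X => (star v ⬝ᵥ (X.mulVec v)).re
        map_add' := fun X Y => by simp [Matrix.add_mulVec, dotProduct_add]
        map_smul' := fun c X => by simp [Matrix.smul_mulVec, dotProduct_smul] }
    have hΛ : ∀ A : Matrix (Fin n) (Fin n) ℂ,
        Λ (A.conjTranspose * A) = ∑ i, ‖A.mulVec v i‖ ^ 2 := by
      intro A
      change (star v ⬝ᵥ ((A.conjTranspose * A).mulVec v)).re = _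
      rw [← Matrix.mulVec_mulVec, Matrix.dotProduct_mulVec, Matrix.vecMul_conjTranspose, star_star,
        dotProduct, Complex.re_sum]
      refine Finset.sum_congr rfl fun i _ => ?_
      rw [Pi.star_apply, Complex.star_def, ← Complex.normSq_eq_conj_mul_self, Complex.ofReal_re,
        Complex.normSq_eq_norm_sq]
    have h1 : Λ P = ∫ g, Λ ((ρ g⁻¹).conjTranspose * ρ g⁻¹) ∂μ :=
      (Λ.toContinuousLinearMap.integral_comp_comm hint).symm
    have h2 : Λ P = 0 := by
      change (star v ⬝ᵥ (P.mulVec v)).re = 0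
      rw [hPv, dotProduct_zero, Complex.zero_re]
    obtain ⟨i, hi⟩ := Function.ne_iff.1 hv
    have h3 : 0 < ∫ g, Λ ((ρ g⁻¹).conjTranspose * ρ g⁻¹) ∂μ := by
      refine Continuous.integral_pos_of_hasCompactSupport_nonneg_nonzero (x := 1)
        (Λ.toContinuousLinearMap.continuous.comp hc) (HasCompactSupport.of_compactSpace _)
        (fun g => ?_) ?_
      · rw [hΛ]
        exact Finset.sum_nonneg fun _ _ => by positivity
      · rw [hΛ, inv_one, map_one, Matrix.one_mulVec]
        refine (Finset.sum_pos' (fun _ _ => by positivity) ⟨i, Finset.mem_univ _, ?_⟩).ne'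
        have : 0 < ‖v i‖ := norm_pos_iff.2 hi
        positivity
    linarith
  have hPu : P⁻¹ * P = 1 := Matrix.nonsing_inv_mul P (Ne.isUnit hdet)
  let T : Matrix (Fin n) (Fin n) ℂ →ₗ[ℝ] Matrix (Fin n) (Fin n) ℂ :=
    { toFun := fun X => P⁻¹ * X.conjTranspose * P
      map_add' := fun X Y => by rw [Matrix.conjTranspose_add, mul_add, add_mul]
      map_smul' := fun c X => by simp }
  refine ⟨T.toContinuousLinearMap, fun g => ?_⟩
  change ρ g⁻¹ = P⁻¹ * (ρ g).conjTranspose * P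
  have h1 : ρ g * ρ g⁻¹ = 1 := by rw [← map_mul, mul_inv_cancel, map_one]
  calc ρ g⁻¹ = P⁻¹ * P * ρ g⁻¹ := by rw [hPu, one_mul]
    _ = P⁻¹ * ((ρ g).conjTranspose * P * ρ g) * ρ g⁻¹ := by rw [hinv]
    _ = P⁻¹ * (ρ g).conjTranspose * P * (ρ g * ρ g⁻¹) := by simp only [mul_assoc]
    _ = _ := by rw [h1, mul_one]

variable {k : Submodule ℝ 𝔸} (π : 𝔸 →L[ℝ] k)

/-- For a projection `π` of the algebra to the Lie algebra, the local diffeomorphism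
`X + Y ↦ exp(X) (1 + Y)`, where `X` is in the Lie algebra and `Y` in the kernel of `π`. -/
noncomputable def tubular (Z : 𝔸) : 𝔸 := NormedSpace.exp (π Z : 𝔸) * (1 + (Z - π Z))

theorem contDiff_tubular : ContDiff ℝ ω (tubular π) :=
  ((contDiff_exp 𝔸).comp (k.subtypeL.contDiff.comp π.contDiff)).mul
    (contDiff_const.add (contDiff_id.sub (k.subtypeL.contDiff.comp π.contDiff)))

theorem exists_tubular_inverse : ∃ ψ : 𝔸 → 𝔸, ψ 1 = 0 ∧ ContDiffAt ℝ ω ψ 1 ∧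
    (∀ᶠ Z in nhds (0 : 𝔸), ψ (tubular π Z) = Z) ∧
    ∀ᶠ a in nhds (1 : 𝔸), tubular π (ψ a) = a := by
  have h0 : tubular π 0 = 1 := by simp [tubular]
  have hd : HasFDerivAt (tubular π) ((ContinuousLinearEquiv.refl ℝ 𝔸 : 𝔸 ≃L[ℝ] 𝔸) : 𝔸 →L[ℝ] 𝔸)
      0 := by
    set P := k.subtypeL.comp π with hP
    have h1 : HasFDerivAt (NormedSpace.exp : 𝔸 → 𝔸) (1 : 𝔸 →L[ℝ] 𝔸) (P 0) := by
      rw [map_zero]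
      exact hasFDerivAt_exp_zero
    have h2 := (h1.comp (0 : 𝔸) P.hasFDerivAt).mul'
      (((hasFDerivAt_id (0 : 𝔸)).sub P.hasFDerivAt).const_add 1)
    refine h2.congr_fderiv ?_
    ext Z
    simp
  have h := exists_local_inverse _ (by simp) (contDiff_tubular π).contDiffAt hd
  rwa [h0] at h

variable {H : Set 𝔸} {T : 𝔸 →L[ℝ] 𝔸}

/-- If a smooth path `F` is a product `γ (1 + Y)`, where `γ` is a continuous path in the group and
`Y` is small and transversal to the Lie algebra, then `γ` is smooth: it is the projection of `F` to
the group in a tubular neighbourhood. -/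
theorem IsLinearGroup.exists_contDiff_factor (hH : IsLinearGroup H k T)
    (hπ : ∀ x : k, π x = x) :
    ∃ δ > 0, ∀ γ Y F : ℝ → 𝔸, Continuous γ → (∀ x, γ x ∈ H) → ContDiff ℝ ∞ F →
      (∀ x, F x = γ x * (1 + Y x)) → (∀ x, π (Y x) = 0) → (∀ x, ‖Y x‖ < δ) →
      ContDiff ℝ ∞ γ := by
  obtain ⟨ψ, hψ0, hψ, hψ1, -⟩ := exists_tubular_inverse π
  have htub : Filter.Tendsto (tubular π) (nhds 0) (nhds 1) := by
    have := (contDiff_tubular π).continuous.tendsto 0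
    rwa [show tubular π 0 = 1 by simp [tubular]] at this
  obtain ⟨δ, hδ, hball⟩ := Metric.eventually_nhds_iff_ball.1
    (hψ1.and (htub.eventually (hψ.eventually (by simp))))
  refine ⟨δ / 2, by positivity, fun γ Y F hγ hγH hF hFe hY hYδ => ?_⟩
  rw [contDiff_iff_contDiffAt]
  intro x₀
  set a : ℝ → 𝔸 := fun x => T (γ x₀) * γ x with ha
  have ha0 : Filter.Tendsto a (nhds x₀) (nhds 1) := by
    rw [← hH.inv_mul (hγH x₀)]
    exact (continuous_const.mul hγ).tendsto x₀
  have hlog : Filter.Tendsto (log 𝔸) (nhds 1) (nhds 0) := by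
    rw [← log_one 𝔸]
    exact (contDiffAt_log 𝔸).continuousAt
  set b : ℝ → 𝔸 := fun x => T (γ x₀) * F x with hb
  -- the decomposition of `γ(x₀)⁻¹ F(x)` for `x` near `x₀`
  have key : ∀ᶠ x in nhds x₀, log 𝔸 (a x) ∈ k ∧ NormedSpace.exp (log 𝔸 (a x)) = a x ∧
      ‖log 𝔸 (a x)‖ < δ / 2 := by
    have h1 := (hlog.comp ha0).eventually hH.eventually_mem
    have h2 := ha0.eventually (eventually_exp_log 𝔸)
    have h3 := (hlog.comp ha0).eventually (Metric.ball_mem_nhds (0 : 𝔸) (half_pos hδ))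
    filter_upwards [h1, h2, h3] with x h1 h2 h3
    refine ⟨h1 ?_, h2, by simpa using h3⟩
    rw [Function.comp, h2]
    exact hH.mul_mem (hH.inv_mem (hγH x₀)) (hγH x)
  have key2 : ∀ᶠ x in nhds x₀, ((π (ψ (b x)) : k) : 𝔸) = log 𝔸 (a x) ∧
      ContDiffAt ℝ ω ψ (b x) := by
    filter_upwards [key] with x ⟨h1, h2, h3⟩
    have h4 : π (log 𝔸 (a x)) = ⟨log 𝔸 (a x), h1⟩ := hπ ⟨log 𝔸 (a x), h1⟩
    have h5 : π (log 𝔸 (a x) + Y x) = ⟨log 𝔸 (a x), h1⟩ := by rw [map_add, h4, hY, add_zero]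
    have h6 : tubular π (log 𝔸 (a x) + Y x) = b x := by
      rw [tubular, h5]
      change NormedSpace.exp (log 𝔸 (a x)) * (1 + (log 𝔸 (a x) + Y x - log 𝔸 (a x))) =
        T (γ x₀) * F x
      rw [add_sub_cancel_left, h2, hFe, ← mul_assoc]
    have h7 : log 𝔸 (a x) + Y x ∈ Metric.ball (0 : 𝔸) δ := by
      rw [mem_ball_zero_iff]
      calc _ ≤ ‖log 𝔸 (a x)‖ + ‖Y x‖ := norm_add_le _ _
        _ < δ / 2 + δ / 2 := add_lt_add h3 (hYδ x)
        _ = δ := add_halves δ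
    obtain ⟨h8, h9⟩ := hball _ h7
    rw [h6] at h8 h9
    exact ⟨by rw [h8, h5], h9⟩
  have hsm : ContDiffAt ℝ ∞ (fun x => γ x₀ * NormedSpace.exp ((π (ψ (b x)) : k) : 𝔸)) x₀ := by
    have h1 : ContDiffAt ℝ ∞ (fun x => ψ (b x)) x₀ :=
      (key2.self_of_nhds.2.of_le le_top).comp x₀ (contDiff_const.mul hF).contDiffAt
    refine contDiffAt_const.mul ?_
    exact (((contDiff_exp 𝔸).of_le le_top).contDiffAt).comp x₀
      ((k.subtypeL.contDiff.comp π.contDiff).contDiffAt.comp x₀ h1)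
  refine hsm.congr_of_eventuallyEq ?_
  filter_upwards [key, key2] with x ⟨_, h2, _⟩ ⟨h3, _⟩
  rw [h3, h2, ha, ← mul_assoc, hH.mul_inv (hγH x₀), one_mul]

end LinearGroup

/-! ### The algebra of Sobolev functions and its exponential map -/

section SobolevAlgebra

variable {𝔸 : Type*} [NormedRing 𝔸] [NormedAlgebra ℝ 𝔸] [CompleteSpace 𝔸]
variable {s : ℝ} {p : ENNReal} [Fact (1 ≤ p)] [SobolevRange s p]

variable (𝔸 s p) in
/-- The pointwise product as a bilinear map. -/
noncomputable def W.mulL : W 𝔸 s p →L[ℝ] W 𝔸 s p →L[ℝ] W 𝔸 s p :=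
  W.bil (ContinuousLinearMap.mul ℝ 𝔸)

theorem ev_mulL (x y : W 𝔸 s p) (θ : S1) : ev (W.mulL 𝔸 s p x y) θ = ev x θ * ev y θ := by
  rw [W.mulL, ev_bil]
  rfl

/-- Pointwise multiplication; associativity and the unit laws hold since they do for the continuous
representatives. -/
noncomputable instance W.instMonoid : Monoid (W 𝔸 s p) where
  mul x y := W.mulL 𝔸 s p x y
  one := W.const 1
  mul_assoc x y z := W.ext <| ContinuousMap.ext fun θ =>
    ((ev_mulL (W.mulL 𝔸 s p x y) z θ).trans (by rw [ev_mulL, mul_assoc, ← ev_mulL, ← ev_mulL]) :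
      ev (W.mulL 𝔸 s p (W.mulL 𝔸 s p x y) z) θ = ev (W.mulL 𝔸 s p x (W.mulL 𝔸 s p y z)) θ)
  one_mul x := W.ext <| ContinuousMap.ext fun θ =>
    ((ev_mulL (W.const 1) x θ).trans (by rw [ev_const, ContinuousMap.const_apply, one_mul]) :
      ev (W.mulL 𝔸 s p (W.const 1) x) θ = ev x θ)
  mul_one x := W.ext <| ContinuousMap.ext fun θ =>
    ((ev_mulL x (W.const 1) θ).trans (by rw [ev_const, ContinuousMap.const_apply, mul_one]) :
      ev (W.mulL 𝔸 s p x (W.const 1)) θ = ev x θ)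

@[simp] theorem ev_mul (x y : W 𝔸 s p) (θ : S1) : ev (x * y) θ = ev x θ * ev y θ := ev_mulL x y θ

@[simp] theorem ev_one (θ : S1) : ev (1 : W 𝔸 s p) θ = 1 := by
  change ev (W.const 1) θ = 1
  rw [ev_const, ContinuousMap.const_apply]

theorem W.contDiff_mul {E : Type*} [NormedAddCommGroup E] [NormedSpace ℝ E] {n : ℕ∞ω}
    {f g : E → W 𝔸 s p} {x : E} (hf : ContDiffAt ℝ n f x) (hg : ContDiffAt ℝ n g x) :
    ContDiffAt ℝ n (fun x => f x * g x) x :=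
  ((W.mulL 𝔸 s p).isBoundedBilinearMap.contDiff (n := n)).contDiffAt.comp x (hf.prodMk hg)

theorem W.continuous_mul : Continuous fun q : W 𝔸 s p × W 𝔸 s p => q.1 * q.2 :=
  (W.mulL 𝔸 s p).continuous₂

/-- The exponential map of the algebra of Sobolev functions, defined through the regular
representation. -/
noncomputable def W.exp (X : W 𝔸 s p) : W 𝔸 s p := NormedSpace.exp (W.mulL 𝔸 s p X) 1

@[simp] theorem ev_exp (X : W 𝔸 s p) (θ : S1) : ev (W.exp X) θ = NormedSpace.exp (ev X θ) := by
  have h1 := NormedSpace.exp_series_hasSum_exp' (𝕂 := ℝ) (W.mulL 𝔸 s p X)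
  have h2 := h1.mapL ((((ContinuousMap.evalCLM ℝ θ).comp (ev : W 𝔸 s p →L[ℝ] C(S1, 𝔸))).comp
    (ContinuousLinearMap.apply ℝ (W 𝔸 s p) (1 : W 𝔸 s p))))
  refine h2.unique ((NormedSpace.exp_series_hasSum_exp' (𝕂 := ℝ) (ev X θ)).congr_fun fun n => ?_)
  have h3 : ev ((W.mulL 𝔸 s p X ^ n) 1) θ = ev X θ ^ n := by
    induction n with
    | zero => simp
    | succ n ih => rw [pow_succ', mul_apply_eq_comp, ev_mulL, ih, pow_succ']
  rw [map_smul]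
  exact congrArg _ h3

theorem W.exp_zero : W.exp (0 : W 𝔸 s p) = 1 := W.ext <| ContinuousMap.ext fun θ => by simp

theorem W.contDiff_exp : ContDiff ℝ ω (W.exp : W 𝔸 s p → W 𝔸 s p) :=
  ((SobolevLoops.contDiff_exp _).comp (W.mulL 𝔸 s p).contDiff).clm_apply contDiff_const

theorem W.hasFDerivAt_exp : HasFDerivAt (W.exp : W 𝔸 s p → W 𝔸 s p)
    ((ContinuousLinearEquiv.refl ℝ (W 𝔸 s p) : W 𝔸 s p ≃L[ℝ] W 𝔸 s p) :
      W 𝔸 s p →L[ℝ] W 𝔸 s p) 0 := by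
  have h1 : HasFDerivAt (NormedSpace.exp : (W 𝔸 s p →L[ℝ] W 𝔸 s p) → _)
      (1 : (W 𝔸 s p →L[ℝ] W 𝔸 s p) →L[ℝ] _) (W.mulL 𝔸 s p 0) := by
    rw [map_zero]
    exact hasFDerivAt_exp_zero
  have h2 := (h1.comp (0 : W 𝔸 s p) (W.mulL 𝔸 s p).hasFDerivAt).clm_apply
    (hasFDerivAt_const (1 : W 𝔸 s p) (0 : W 𝔸 s p))
  refine h2.congr_fderiv ?_
  ext X : 1
  have h3 : W.mulL 𝔸 s p X 1 = X := mul_one X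
  simpa using h3

theorem W.exists_log : ∃ g : W 𝔸 s p → W 𝔸 s p, g 1 = 0 ∧ ContDiffAt ℝ ω g 1 ∧
    (∀ᶠ x in nhds (0 : W 𝔸 s p), g (W.exp x) = x) ∧
      ∀ᶠ y in nhds (1 : W 𝔸 s p), W.exp (g y) = y := by
  have h := exists_local_inverse _ (n := ω) (by simp)
    W.contDiff_exp.contDiffAt (W.hasFDerivAt_exp (𝔸 := 𝔸) (s := s) (p := p))
  rwa [W.exp_zero] at h

/-- The logarithm of Sobolev functions near `1`. -/
noncomputable def W.log : W 𝔸 s p → W 𝔸 s p := W.exists_log.choose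

theorem W.log_one : W.log (1 : W 𝔸 s p) = 0 := W.exists_log.choose_spec.1

theorem W.contDiffAt_log : ContDiffAt ℝ ω (W.log : W 𝔸 s p → W 𝔸 s p) 1 :=
  W.exists_log.choose_spec.2.1

theorem W.eventually_log_exp : ∀ᶠ x in nhds (0 : W 𝔸 s p), W.log (W.exp x) = x :=
  W.exists_log.choose_spec.2.2.1

theorem W.eventually_exp_log : ∀ᶠ y in nhds (1 : W 𝔸 s p), W.exp (W.log y) = y :=
  W.exists_log.choose_spec.2.2.2

end SobolevAlgebra

section ChartDomain

variable {𝔸 : Type*} [NormedRing 𝔸] [NormedAlgebra ℝ 𝔸] [CompleteSpace 𝔸]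
variable {s : ℝ} {p : ENNReal} [Fact (1 ≤ p)] [SobolevRange s p]
variable {H : Set 𝔸} {k : Submodule ℝ 𝔸} [CompleteSpace k] {T : 𝔸 →L[ℝ] 𝔸}

variable (s p k) in
/-- The inclusion of Sobolev functions with values in `k`. -/
noncomputable def W.incl : W k s p →L[ℝ] W 𝔸 s p := W.map k.subtypeL

@[simp] theorem ev_incl (X : W k s p) (θ : S1) : ev (W.incl s p k X) θ = (ev X θ : 𝔸) :=
  ev_map _ _ _

theorem W.incl_map {π : 𝔸 →L[ℝ] k} (hπ : ∀ x : k, π x = x) {Z : W 𝔸 s p}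
    (hZ : ∀ θ, ev Z θ ∈ k) : W.incl s p k (W.map π Z) = Z := by
  refine W.ext (ContinuousMap.ext fun θ => ?_)
  rw [ev_incl, ev_map]
  exact congrArg Subtype.val (hπ ⟨ev Z θ, hZ θ⟩)

theorem W.map_incl {π : 𝔸 →L[ℝ] k} (hπ : ∀ x : k, π x = x) (X : W k s p) :
    W.map π (W.incl s p k X) = X := by
  refine W.ext (ContinuousMap.ext fun θ => ?_)
  rw [ev_map, ev_incl, hπ]

omit [SobolevRange s p] in
/-- A property that holds near a value `v` of the algebra holds for all values of Sobolev functions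
near the constant function `v`. -/
theorem W.eventually_ev {P : 𝔸 → Prop} {f : W 𝔸 s p} {v : 𝔸} (hf : ∀ θ, ev f θ = v)
    (h : ∀ᶠ x in nhds v, P x) : ∀ᶠ g in nhds f, ∀ θ, P (ev g θ) := by
  obtain ⟨ε, hε, hball⟩ := Metric.eventually_nhds_iff_ball.1 h
  filter_upwards [(ev : W 𝔸 s p →L[ℝ] C(S1, 𝔸)).continuous.continuousAt.eventually
    (Metric.ball_mem_nhds (ev f) hε)] with g hg θ
  refine hball _ ?_
  rw [← hf θ]
  exact lt_of_le_of_lt (ContinuousMap.dist_apply_le_dist θ) hg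

/-- The neighbourhoods of `1` and `0` between which the exponential map gives a chart. The logarithm
of a loop near `1` has values in the Lie algebra since this holds pointwise. -/
theorem exists_chartDomain (hH : IsLinearGroup H k T) :
    ∃ (U : Set (W 𝔸 s p)) (V : Set (W k s p)), (IsOpen U ∧ 1 ∈ U ∧ ∀ a ∈ U,
      ContDiffAt ℝ ω W.log a ∧ W.exp (W.log a) = a ∧
        ((∀ θ, ev a θ ∈ H) → ∀ θ, ev (W.log a) θ ∈ k)) ∧
      IsOpen V ∧ 0 ∈ V ∧ ∀ X ∈ V, W.log (W.exp (W.incl s p k X)) = W.incl s p k X := by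
  have h1 : ∀ᶠ a in nhds (1 : W 𝔸 s p), ContDiffAt ℝ ω W.log a ∧ W.exp (W.log a) = a ∧
      ((∀ θ, ev a θ ∈ H) → ∀ θ, ev (W.log a) θ ∈ k) := by
    have hlog : Filter.Tendsto (W.log : W 𝔸 s p → W 𝔸 s p) (nhds 1) (nhds 0) := by
      rw [← W.log_one]
      exact W.contDiffAt_log.continuousAt
    have h2 := hlog.eventually (W.eventually_ev (v := 0) (by simp) hH.eventually_mem)
    filter_upwards [W.contDiffAt_log.eventually (by simp), W.eventually_exp_log, h2]
      with a h3 h4 h5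
    refine ⟨h3, h4, fun h6 θ => h5 θ ?_⟩
    rw [← ev_exp, h4]
    exact h6 θ
  have h2 : ∀ᶠ X in nhds (0 : W k s p), W.log (W.exp (W.incl s p k X)) = W.incl s p k X := by
    have : Filter.Tendsto (W.incl s p k) (nhds 0) (nhds 0) := by
      have := (W.incl s p k).continuous.tendsto 0
      rwa [map_zero] at this
    exact this.eventually W.eventually_log_exp
  obtain ⟨U, hU1, hU2, hU3⟩ := eventually_nhds_iff.1 h1
  obtain ⟨V, hV1, hV2, hV3⟩ := eventually_nhds_iff.1 h2
  exact ⟨U, V, ⟨hU2, hU3, hU1⟩, hV2, hV3, hV1⟩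

end ChartDomain

/-! ### The Lie group of Sobolev loops -/

section LoopGroup

variable {𝔸 : Type*} [NormedRing 𝔸] [NormedAlgebra ℝ 𝔸] [CompleteSpace 𝔸]
variable {s : ℝ} {p : ENNReal} [Fact (1 ≤ p)] [SobolevRange s p]
variable {H : Set 𝔸} {k : Submodule ℝ 𝔸} {T : 𝔸 →L[ℝ] 𝔸}

theorem IsLinearGroup.ev_mem (hH : IsLinearGroup H k T) (f : WMaps s p H) (θ : S1) :
    ev f.1 θ ∈ H :=
  (W.ae_mem_iff hH.isCompact.isClosed f.1).1 f.2 θ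

/-- A Sobolev function with values in `H`, as an element of the loop group. -/
def IsLinearGroup.mkLoop (hH : IsLinearGroup H k T) (f : W 𝔸 s p) (hf : ∀ θ, ev f θ ∈ H) :
    WMaps s p H := ⟨f, (W.ae_mem_iff hH.isCompact.isClosed f).2 hf⟩

theorem IsLinearGroup.map_mul_self (hH : IsLinearGroup H k T) (f : WMaps s p H) :
    W.map T f.1 * f.1 = 1 :=
  W.ext <| ContinuousMap.ext fun θ => by
    rw [ev_mul, ev_map, ev_one, hH.inv_mul (hH.ev_mem f θ)]

theorem IsLinearGroup.mul_map_self (hH : IsLinearGroup H k T) (f : WMaps s p H) :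
    f.1 * W.map T f.1 = 1 :=
  W.ext <| ContinuousMap.ext fun θ => by
    rw [ev_mul, ev_map, ev_one, hH.mul_inv (hH.ev_mem f θ)]

/-- The group structure of the loop group: pointwise multiplication. -/
@[reducible] noncomputable def loopGroup (hH : IsLinearGroup H k T) : Group (WMaps s p H) where
  mul f g := hH.mkLoop (f.1 * g.1) fun θ => by
    rw [ev_mul]
    exact hH.mul_mem (hH.ev_mem f θ) (hH.ev_mem g θ)
  one := hH.mkLoop 1 fun θ => by
    rw [ev_one]
    exact hH.one_mem
  inv f := hH.mkLoop (W.map T f.1) fun θ => by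
    rw [ev_map]
    exact hH.inv_mem (hH.ev_mem f θ)
  mul_assoc f g h := Subtype.ext (mul_assoc f.1 g.1 h.1)
  one_mul f := Subtype.ext (one_mul f.1)
  mul_one f := Subtype.ext (mul_one f.1)
  inv_mul_cancel f := Subtype.ext (hH.map_mul_self f)

variable [CompleteSpace k]

/-- The domain of `1` in the algebra, on which the chart at the constant loop `1` is defined. -/
noncomputable def chartU (s : ℝ) (p : ENNReal) [Fact (1 ≤ p)] [SobolevRange s p]
    (hH : IsLinearGroup H k T) : Set (W 𝔸 s p) := (exists_chartDomain hH).choose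

/-- The domain of `0` in the Lie algebra, on which the inverse of the chart at the constant loop `1`
is defined. -/
noncomputable def chartV (s : ℝ) (p : ENNReal) [Fact (1 ≤ p)] [SobolevRange s p]
    (hH : IsLinearGroup H k T) : Set (W k s p) := (exists_chartDomain hH).choose_spec.choose

theorem chartU_spec (hH : IsLinearGroup H k T) : IsOpen (chartU s p hH) ∧ 1 ∈ chartU s p hH ∧
    ∀ a ∈ chartU s p hH, ContDiffAt ℝ ω W.log a ∧ W.exp (W.log a) = a ∧
      ((∀ θ, ev a θ ∈ H) → ∀ θ, ev (W.log a) θ ∈ k) :=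
  (exists_chartDomain hH).choose_spec.choose_spec.1

theorem chartV_spec (hH : IsLinearGroup H k T) : IsOpen (chartV s p hH) ∧ 0 ∈ chartV s p hH ∧
    ∀ X ∈ chartV s p hH, W.log (W.exp (W.incl s p k X)) = W.incl s p k X :=
  (exists_chartDomain hH).choose_spec.choose_spec.2

theorem contDiffAt_mul_exp (f : W 𝔸 s p) (X : W k s p) :
    ContDiffAt ℝ ω (fun X => f * W.exp (W.incl s p k X)) X :=
  W.contDiff_mul contDiffAt_const
    (W.contDiff_exp.contDiffAt.comp X (W.incl s p k).contDiff.contDiffAt)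

theorem contDiffAt_map_log (hH : IsLinearGroup H k T) (π : 𝔸 →L[ℝ] k) (f g : W 𝔸 s p)
    (hg : f * g ∈ chartU s p hH) : ContDiffAt ℝ ω (fun g => W.map π (W.log (f * g))) g :=
  (W.map π).contDiff.contDiffAt.comp g
    (((chartU_spec hH).2.2 _ hg).1.comp g (W.contDiff_mul contDiffAt_const contDiffAt_id))

variable {π : 𝔸 →L[ℝ] k}

/-- The chart of the loop group at `f`: it maps `g` to `log(f⁻¹ g)`, seen as a function with values
in the Lie algebra by means of the projection `π`; its inverse is `X ↦ f exp(X)`. -/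
noncomputable def loopChart (hH : IsLinearGroup H k T) (hπ : ∀ x : k, π x = x)
    (f : WMaps s p H) : OpenPartialHomeomorph (WMaps s p H) (W k s p) where
  toFun g := W.map π (W.log (W.map T f.1 * g.1))
  invFun X := hH.mkLoop (f.1 * W.exp (W.incl s p k X)) fun θ => by
    rw [ev_mul, ev_exp, ev_incl]
    exact hH.mul_mem (hH.ev_mem f θ) (hH.exp_mem (ev X θ).2)
  source := {g | W.map T f.1 * g.1 ∈ chartU s p hH ∧
    W.map π (W.log (W.map T f.1 * g.1)) ∈ chartV s p hH}
  target := {X | X ∈ chartV s p hH ∧ W.exp (W.incl s p k X) ∈ chartU s p hH}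
  map_source' := by
    rintro g ⟨h1, h2⟩
    refine ⟨h2, ?_⟩
    obtain ⟨-, h3, h4⟩ := (chartU_spec hH).2.2 _ h1
    rw [W.incl_map hπ, h3]
    · exact h1
    · refine h4 fun θ => ?_
      rw [ev_mul, ev_map]
      exact hH.mul_mem (hH.inv_mem (hH.ev_mem f θ)) (hH.ev_mem g θ)
  map_target' := by
    rintro X ⟨h1, h2⟩
    have h3 : W.map T f.1 * (f.1 * W.exp (W.incl s p k X)) = W.exp (W.incl s p k X) := by
      rw [← mul_assoc, hH.map_mul_self, one_mul]
    change W.map T f.1 * (f.1 * W.exp (W.incl s p k X)) ∈ chartU s p hH ∧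
      W.map π (W.log (W.map T f.1 * (f.1 * W.exp (W.incl s p k X)))) ∈ chartV s p hH
    rw [h3, (chartV_spec hH).2.2 X h1, W.map_incl hπ]
    exact ⟨h2, h1⟩
  left_inv' := by
    rintro g ⟨h1, h2⟩
    obtain ⟨-, h3, h4⟩ := (chartU_spec hH).2.2 _ h1
    refine Subtype.ext ?_
    change f.1 * W.exp (W.incl s p k (W.map π (W.log (W.map T f.1 * g.1)))) = g.1
    rw [W.incl_map hπ, h3, ← mul_assoc, hH.mul_map_self, one_mul]
    refine h4 fun θ => ?_
    rw [ev_mul, ev_map]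
    exact hH.mul_mem (hH.inv_mem (hH.ev_mem f θ)) (hH.ev_mem g θ)
  right_inv' := by
    rintro X ⟨h1, h2⟩
    change W.map π (W.log (W.map T f.1 * (f.1 * W.exp (W.incl s p k X)))) = X
    rw [← mul_assoc, hH.map_mul_self, one_mul, (chartV_spec hH).2.2 X h1, W.map_incl hπ]
  open_source := by
    rw [isOpen_iff_mem_nhds]
    rintro g ⟨h1, h2⟩
    have h3 : ContinuousAt (fun g : WMaps s p H => W.map T f.1 * g.1) g :=
      (W.continuous_mul.comp (continuous_const.prodMk continuous_subtype_val)).continuousAt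
    have h4 : ContinuousAt (fun g : WMaps s p H => W.map π (W.log (W.map T f.1 * g.1))) g :=
      (contDiffAt_map_log hH π _ _ h1).continuousAt.comp continuousAt_subtype_val
    exact Filter.inter_mem (h3 ((chartU_spec hH).1.mem_nhds h1))
      (h4 ((chartV_spec hH).1.mem_nhds h2))
  open_target := (chartV_spec hH).1.inter ((chartU_spec hH).1.preimage
    (W.contDiff_exp.continuous.comp (W.incl s p k).continuous))
  continuousOn_toFun := fun g hg => ContinuousAt.continuousWithinAt
    ((contDiffAt_map_log hH π _ _ hg.1).continuousAt.comp continuousAt_subtype_val)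
  continuousOn_invFun := Continuous.continuousOn (Continuous.subtype_mk
    (continuous_iff_continuousAt.2 fun X => (contDiffAt_mul_exp f.1 X).continuousAt) _)

theorem mem_loopChart_source (hH : IsLinearGroup H k T) (hπ : ∀ x : k, π x = x)
    (f : WMaps s p H) : f ∈ (loopChart hH hπ f).source := by
  change W.map T f.1 * f.1 ∈ chartU s p hH ∧
    W.map π (W.log (W.map T f.1 * f.1)) ∈ chartV s p hH
  rw [hH.map_mul_self, W.log_one, map_zero]
  exact ⟨(chartU_spec hH).2.1, (chartV_spec hH).2.1⟩

/-- The manifold structure of the loop group. -/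
@[reducible] noncomputable def loopChartedSpace (hH : IsLinearGroup H k T) (hπ : ∀ x : k, π x = x) :
    ChartedSpace (W k s p) (WMaps s p H) where
  atlas := Set.range (loopChart hH hπ)
  chartAt := loopChart hH hπ
  mem_chart_source := mem_loopChart_source hH hπ
  chart_mem_atlas f := ⟨f, rfl⟩

theorem isManifold_loop (hH : IsLinearGroup H k T) (hπ : ∀ x : k, π x = x) :
    letI := loopChartedSpace (s := s) (p := p) hH hπ
    IsManifold 𝓘(ℝ, W k s p) ω (WMaps s p H) := by
  let _ := loopChartedSpace (s := s) (p := p) hH hπ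
  refine isManifold_of_contDiffOn _ _ _ ?_
  rintro _ _ ⟨f, rfl⟩ ⟨f', rfl⟩ X ⟨⟨-, hX⟩, -⟩
  refine ContDiffAt.contDiffWithinAt ?_
  have h := ContDiffAt.comp (g := fun g => W.map π (W.log (W.map T f'.1 * g))) X
    (contDiffAt_map_log hH π (W.map T f'.1) (f.1 * W.exp (W.incl s p k X)) hX.1)
    (contDiffAt_mul_exp f.1 X)
  exact h

theorem contMDiff_val (hH : IsLinearGroup H k T) (hπ : ∀ x : k, π x = x) :
    letI := loopChartedSpace (s := s) (p := p) hH hπ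
    ContMDiff 𝓘(ℝ, W k s p) 𝓘(ℝ, W 𝔸 s p) ω (Subtype.val : WMaps s p H → W 𝔸 s p) := by
  let _ := loopChartedSpace (s := s) (p := p) hH hπ
  have := isManifold_loop (s := s) (p := p) hH hπ
  intro f
  have h1 : ContMDiffAt 𝓘(ℝ, W k s p) 𝓘(ℝ, W k s p) ω (loopChart hH hπ f) f :=
    contMDiffOn_chart.contMDiffAt ((loopChart hH hπ f).open_source.mem_nhds
      (mem_loopChart_source hH hπ f))
  refine ((contDiffAt_mul_exp f.1 _).contMDiffAt.comp f h1).congr_of_eventuallyEq ?_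
  filter_upwards [(loopChart hH hπ f).open_source.mem_nhds (mem_loopChart_source hH hπ f)] with g hg
  exact congrArg Subtype.val ((loopChart hH hπ f).left_inv hg).symm

/-- A map to the loop group is analytic if it is so as a map to the algebra. -/
theorem contMDiff_of_val_comp (hH : IsLinearGroup H k T) (hπ : ∀ x : k, π x = x)
    {E' H' N : Type*} [NormedAddCommGroup E'] [NormedSpace ℝ E'] [TopologicalSpace H']
    {J : ModelWithCorners ℝ E' H'} [TopologicalSpace N] [ChartedSpace H' N]
    {F : N → WMaps s p H} (hF : ContMDiff J 𝓘(ℝ, W 𝔸 s p) ω fun x => (F x).1) :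
    letI := loopChartedSpace (s := s) (p := p) hH hπ
    ContMDiff J 𝓘(ℝ, W k s p) ω F := by
  let _ := loopChartedSpace (s := s) (p := p) hH hπ
  intro x
  rw [contMDiffAt_iff_target]
  refine ⟨(hF.continuous.subtype_mk fun x => (F x).2).continuousAt, ?_⟩
  have h : W.map T (F x).1 * (F x).1 ∈ chartU s p hH := by
    rw [hH.map_mul_self]
    exact (chartU_spec hH).2.1
  exact ContMDiffAt.comp (g := fun g => W.map π (W.log (W.map T (F x).1 * g))) x
    (contDiffAt_map_log hH π (W.map T (F x).1) (F x).1 h).contMDiffAt hF.contMDiffAt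

theorem lieGroup_loop (hH : IsLinearGroup H k T) (hπ : ∀ x : k, π x = x) :
    letI := loopGroup (s := s) (p := p) hH
    letI := loopChartedSpace (s := s) (p := p) hH hπ
    LieGroup 𝓘(ℝ, W k s p) ω (WMaps s p H) := by
  let _ := loopGroup (s := s) (p := p) hH
  let _ := loopChartedSpace (s := s) (p := p) hH hπ
  have hval := contMDiff_val (s := s) (p := p) hH hπ
  have hmul : ContMDiff (𝓘(ℝ, W k s p).prod 𝓘(ℝ, W k s p)) 𝓘(ℝ, W 𝔸 s p) ω
      fun q : WMaps s p H × WMaps s p H => W.mulL 𝔸 s p q.1.1 q.2.1 :=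
    ((W.mulL 𝔸 s p).contMDiff.comp (hval.comp contMDiff_fst)).clm_apply (hval.comp contMDiff_snd)
  exact
    { toIsManifold := isManifold_loop hH hπ
      contMDiff_mul := contMDiff_of_val_comp hH hπ hmul
      contMDiff_inv := contMDiff_of_val_comp hH hπ ((W.map T).contMDiff.comp hval) }

end LoopGroup

/-! ### The Lie algebra of the loop group -/

section Bracket

open VectorField

variable {E : Type*} [NormedAddCommGroup E] [NormedSpace ℝ E] [CompleteSpace E]
  {M : Type*} [TopologicalSpace M] [Group M] [ChartedSpace E M]
  {A : Type*} [NormedAddCommGroup A] [NormedSpace ℝ A]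

/-- The derivative at `1` of a smooth homomorphism of a Lie group to an algebra maps brackets to
commutators: left-invariant vector fields are mapped to the vector fields `a ↦ a X`. -/
theorem mfderiv_bracket [LieGroup 𝓘(ℝ, E) ω M] {F : M → A} (hF : ContMDiff 𝓘(ℝ, E) 𝓘(ℝ, A) ω F)
    (μ : A →L[ℝ] A →L[ℝ] A) (hmul : ∀ g h, F (g * h) = μ (F g) (F h))
    (hone : ∀ a, μ (F 1) a = a) (X Y : GroupLieAlgebra 𝓘(ℝ, E) M) :
    (mfderiv 𝓘(ℝ, E) 𝓘(ℝ, A) F 1 ⁅X, Y⁆ : A) =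
      μ (mfderiv 𝓘(ℝ, E) 𝓘(ℝ, A) F 1 X) (mfderiv 𝓘(ℝ, E) 𝓘(ℝ, A) F 1 Y) -
        μ (mfderiv 𝓘(ℝ, E) 𝓘(ℝ, A) F 1 Y) (mfderiv 𝓘(ℝ, E) 𝓘(ℝ, A) F 1 X) := by
  have : LieGroup 𝓘(ℝ, E) (minSmoothness ℝ 3) M := LieGroup.of_le (n := ω) le_top
  have : IsManifold 𝓘(ℝ, E) 1 M := IsManifold.of_le (n := ω) le_top
  have hFd : MDifferentiable 𝓘(ℝ, E) 𝓘(ℝ, A) F := hF.mdifferentiable (by simp)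
  set L : E →L[ℝ] A := mfderiv 𝓘(ℝ, E) 𝓘(ℝ, A) F 1 with hL
  set c := extChartAt 𝓘(ℝ, E) (1 : M) with hc
  have h1t : c 1 ∈ c.target := mem_extChartAt_target (1 : M)
  set j : E → A := fun y => F (c.symm y) with hj
  -- the left-invariant vector fields, read in the chart at `1`
  let V : E → E → E := fun X => mpullbackWithin 𝓘(ℝ, E) 𝓘(ℝ, E) c.symm
    (mulInvariantVectorField (G := M) (I := 𝓘(ℝ, E)) X) (Set.range 𝓘(ℝ, E))
  have hrange : Set.range 𝓘(ℝ, E) = Set.univ := 𝓘(ℝ, E).range_eq_univ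
  have htn : c.target ∈ nhds (c 1) := extChartAt_target_mem_nhds (1 : M)
  have hjc : ContDiffAt ℝ ω j (c 1) := by
    have h1 : ContMDiffWithinAt 𝓘(ℝ, E) 𝓘(ℝ, E) ω c.symm c.target (c 1) :=
      contMDiffOn_extChartAt_symm (1 : M) _ h1t
    exact (hF.contMDiffAt.comp (c 1) (h1.contMDiffAt htn)).contDiffAt
  let D : E → E →L[ℝ] A := fun y => (mfderiv 𝓘(ℝ, E) 𝓘(ℝ, A) F (c.symm y)).comp
    (mfderivWithin 𝓘(ℝ, E) 𝓘(ℝ, E) c.symm (Set.range 𝓘(ℝ, E)) y)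
  have hjd : ∀ y ∈ c.target, HasFDerivAt j (D y) y := by
    intro y hy
    change HasFDerivAt j ((mfderiv 𝓘(ℝ, E) 𝓘(ℝ, A) F (c.symm y)).comp
      (mfderivWithin 𝓘(ℝ, E) 𝓘(ℝ, E) c.symm (Set.range 𝓘(ℝ, E)) y)) y
    have h1 := (hFd (c.symm y)).hasMFDerivAt.comp_hasMFDerivWithinAt y
      (mdifferentiableWithinAt_extChartAt_symm (I := 𝓘(ℝ, E)) hy).hasMFDerivWithinAt
    rw [hrange, hasMFDerivWithinAt_univ] at h1
    rw [hrange]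
    exact h1.hasFDerivAt
  have hVd : ∀ X, DifferentiableAt ℝ (V X) (c 1) := by
    intro X
    have h := (mdifferentiableAt_mulInvariantVectorField (I := 𝓘(ℝ, E)) (G := M) X
      (g := 1)).mdifferentiableWithinAt (s := Set.univ)
    have h2 := h.differentiableWithinAt_mpullbackWithin_vectorField
    have h3 : (extChartAt 𝓘(ℝ, E) (1 : M)).symm ⁻¹' Set.univ ∩ Set.range 𝓘(ℝ, E) = Set.univ := by
      rw [hrange, Set.preimage_univ, Set.univ_inter]
    rw [h3] at h2
    exact differentiableWithinAt_univ.1 h2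
  -- `F` maps a left-invariant vector field to `a ↦ a X`
  have hleft : ∀ (g : M) (X : E), mfderiv 𝓘(ℝ, E) 𝓘(ℝ, A) F g
      (mulInvariantVectorField (G := M) (I := 𝓘(ℝ, E)) X g) = μ (F g) (L X) := by
    intro g X
    have h1 : HasMFDerivAt 𝓘(ℝ, E) 𝓘(ℝ, E) (fun x => g * x) 1
        (mfderiv 𝓘(ℝ, E) 𝓘(ℝ, E) (fun x => g * x) 1) :=
      ((contMDiff_mul_left (I := 𝓘(ℝ, E)) (n := ω) (a := g)).mdifferentiable (by simp)
        1).hasMFDerivAt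
    have h0 : HasMFDerivAt 𝓘(ℝ, E) 𝓘(ℝ, A) F (g * 1) (mfderiv 𝓘(ℝ, E) 𝓘(ℝ, A) F (g * 1)) :=
      (hFd (g * 1)).hasMFDerivAt
    have h2 := h0.comp 1 h1
    have h3 := ((μ (F g)).hasFDerivAt (x := F 1)).hasMFDerivAt.comp 1 (hFd 1).hasMFDerivAt
    have h4 : F ∘ (fun x => g * x) = μ (F g) ∘ F := funext fun x => hmul g x
    rw [h4] at h2
    have h5 := hasMFDerivAt_unique h2 h3
    have h6 := DFunLike.congr_fun h5 X
    rw [mul_one] at h6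
    exact h6
  have hrel : ∀ X, ∀ y ∈ c.target, fderiv ℝ j y (V X y) = μ (j y) (L X) := by
    intro X y hy
    rw [(hjd y hy).fderiv]
    have h1 := (isInvertible_mfderivWithin_extChartAt_symm (I := 𝓘(ℝ, E)) hy).self_apply_inverse
      (mulInvariantVectorField (G := M) (I := 𝓘(ℝ, E)) X (c.symm y))
    exact (congrArg (mfderiv 𝓘(ℝ, E) 𝓘(ℝ, A) F (c.symm y)) h1).trans (hleft _ X)
  have hj1 : j (c 1) = F 1 := congrArg F (extChartAt_to_inv (I := 𝓘(ℝ, E)) (1 : M))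
  have key := fderiv_apply_lieBracket (𝕜 := ℝ) (V := V X) (W := V Y) hjc le_top (hVd Y) (hVd X)
  have hR : ∀ X Y : E, fderiv ℝ (fun y => fderiv ℝ j y (V Y y)) (c 1) (V X (c 1)) =
      μ (L X) (L Y) := by
    intro X Y
    have h1 : (fun y => fderiv ℝ j y (V Y y)) =ᶠ[nhds (c 1)] fun y => μ (j y) (L Y) := by
      filter_upwards [htn] with y hy using hrel Y y hy
    have h2 : HasFDerivAt (fun y => μ (j y) (L Y))
        (((μ.flip (L Y))).comp (fderiv ℝ j (c 1))) (c 1) :=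
      (μ.flip (L Y)).hasFDerivAt.comp (c 1) (hjc.differentiableAt (by simp)).hasFDerivAt
    rw [h1.fderiv_eq, h2.fderiv, ContinuousLinearMap.comp_apply, hrel X _ h1t, hj1, hone]
    rfl
  have hL' : ∀ v : E, L v = fderiv ℝ j (c 1) (mfderiv 𝓘(ℝ, E) 𝓘(ℝ, E) c (1 : M) v) := by
    intro v
    have h1 : HasMFDerivAt 𝓘(ℝ, E) 𝓘(ℝ, E) c (1 : M) (mfderiv 𝓘(ℝ, E) 𝓘(ℝ, E) c (1 : M)) :=
      (mdifferentiableAt_extChartAt (mem_chart_source E (1 : M))).hasMFDerivAt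
    have h2 := (hjc.differentiableAt (by simp)).hasFDerivAt.hasMFDerivAt.comp (1 : M) h1
    have h3 : F =ᶠ[nhds 1] j ∘ c := by
      filter_upwards [extChartAt_source_mem_nhds (I := 𝓘(ℝ, E)) (1 : M)] with x hx
      exact (congrArg F (c.left_inv hx)).symm
    exact DFunLike.congr_fun (hasMFDerivAt_unique (hFd 1).hasMFDerivAt
      (h2.congr_of_eventuallyEq h3)) v
  have h3 : (extChartAt 𝓘(ℝ, E) (1 : M)).symm ⁻¹' Set.univ ∩ Set.range 𝓘(ℝ, E) = Set.univ := by
    rw [hrange, Set.preimage_univ, Set.univ_inter]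
  -- the bracket is defined by means of the chart at `1`
  have h4 : mfderiv 𝓘(ℝ, E) 𝓘(ℝ, E) c (1 : M) (⁅X, Y⁆ : GroupLieAlgebra 𝓘(ℝ, E) M) =
      lieBracket ℝ (V X) (V Y) (c 1) := by
    rw [GroupLieAlgebra.bracket_def, mlieBracket, mlieBracketWithin_apply, h3]
    have h5 : lieBracketWithin ℝ (V X) (V Y) Set.univ = lieBracket ℝ (V X) (V Y) :=
      lieBracketWithin_univ
    exact ((isInvertible_mfderiv_extChartAt
      (mem_extChartAt_source (I := 𝓘(ℝ, E)) (1 : M))).self_apply_inverse _).trans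
        (congrFun h5 (c 1))
  refine (hL' _).trans ((congrArg (fderiv ℝ j (c 1)) h4).trans (key.trans ?_))
  exact congrArg₂ (· - ·) (hR X Y) (hR Y X)

end Bracket

section LoopLieAlgebra

variable {𝔸 : Type*} [NormedRing 𝔸] [NormedAlgebra ℝ 𝔸] [CompleteSpace 𝔸]
variable {s : ℝ} {p : ENNReal} [Fact (1 ≤ p)] [SobolevRange s p]
variable {H : Set 𝔸} {k : Submodule ℝ 𝔸} [CompleteSpace k] {T : 𝔸 →L[ℝ] 𝔸} {π : 𝔸 →L[ℝ] k}

/-- In the chart at `1`, the inclusion of the loop group is the exponential map, whose derivative at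
`0` is the inclusion of the Lie algebra. -/
theorem hasMFDerivAt_val_one (hH : IsLinearGroup H k T) (hπ : ∀ x : k, π x = x) :
    letI := loopGroup (s := s) (p := p) hH
    letI := loopChartedSpace (s := s) (p := p) hH hπ
    HasMFDerivAt 𝓘(ℝ, W k s p) 𝓘(ℝ, W 𝔸 s p) (Subtype.val : WMaps s p H → W 𝔸 s p)
      (1 : WMaps s p H) (W.incl s p k) := by
  let _ := loopGroup (s := s) (p := p) hH
  let _ := loopChartedSpace (s := s) (p := p) hH hπ
  refine ⟨continuousAt_subtype_val, HasFDerivAt.hasFDerivWithinAt ?_⟩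
  have h0 : loopChart hH hπ (1 : WMaps s p H) 1 = 0 := by
    change W.map π (W.log (W.map T (1 : WMaps s p H).1 * (1 : WMaps s p H).1)) = 0
    rw [hH.map_mul_self, W.log_one, map_zero]
  change HasFDerivAt (fun X => (1 : W 𝔸 s p) * W.exp (W.incl s p k X)) (W.incl s p k)
    (loopChart hH hπ (1 : WMaps s p H) 1)
  rw [h0]
  simp only [one_mul]
  have h1 : HasFDerivAt (W.exp : W 𝔸 s p → W 𝔸 s p)
      ((ContinuousLinearEquiv.refl ℝ (W 𝔸 s p) : W 𝔸 s p ≃L[ℝ] W 𝔸 s p) :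
        W 𝔸 s p →L[ℝ] W 𝔸 s p) (W.incl s p k 0) := by
    rw [map_zero]
    exact W.hasFDerivAt_exp
  exact h1.comp (0 : W k s p) (W.incl s p k).hasFDerivAt

end LoopLieAlgebra

/-! ### Smooth loops are dense -/

section Density

variable {𝔸 : Type*} [NormedRing 𝔸] [NormedAlgebra ℝ 𝔸] [CompleteSpace 𝔸]
variable {s : ℝ} {p : ENNReal} [Fact (1 ≤ p)] [SobolevRange s p]
variable {H : Set 𝔸} {k : Submodule ℝ 𝔸} [CompleteSpace k] {T : 𝔸 →L[ℝ] 𝔸} {π : 𝔸 →L[ℝ] k}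

omit [CompleteSpace k] in
/-- `exists_contDiff_factor` for loops. -/
theorem IsLinearGroup.exists_isSmooth_factor (hH : IsLinearGroup H k T)
    (hπ : ∀ x : k, π x = x) :
    ∃ δ > 0, ∀ γ Y F : S1 → 𝔸, Continuous γ → (∀ θ, γ θ ∈ H) → IsSmooth F →
      (∀ θ, F θ = γ θ * (1 + Y θ)) → (∀ θ, π (Y θ) = 0) → (∀ θ, ‖Y θ‖ < δ) → IsSmooth γ := by
  obtain ⟨δ, hδ, h⟩ := hH.exists_contDiff_factor π hπ
  exact ⟨δ, hδ, fun γ Y F hγ hγH hF hFe hY hYδ =>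
    h _ (fun x => Y x) _ (hγ.comp (AddCircle.continuous_mk' _)) (fun x => hγH x) hF
      (fun x => hFe x) (fun x => hY x) fun x => hYδ x⟩

/-- The tubular neighbourhood of the loop group at `1`, in the Sobolev norm. -/
theorem W.exists_tubular_inverse (π : 𝔸 →L[ℝ] k) : ∃ ψ : W 𝔸 s p → W 𝔸 s p, ψ 1 = 0 ∧
    ContinuousAt ψ 1 ∧ ∀ᶠ a in nhds (1 : W 𝔸 s p),
      W.exp (W.incl s p k (W.map π (ψ a))) * (1 + (ψ a - W.incl s p k (W.map π (ψ a)))) = a := by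
  set P : W 𝔸 s p →L[ℝ] W 𝔸 s p := (W.incl s p k).comp (W.map π) with hP
  set f : W 𝔸 s p → W 𝔸 s p := fun Z => W.exp (P Z) * (1 + (Z - P Z)) with hf
  have hf0 : f 0 = 1 := by
    simp only [hf, map_zero, W.exp_zero, sub_zero, add_zero, mul_one]
  have hc : ContDiffAt ℝ ω f 0 := W.contDiff_mul
    (W.contDiff_exp.contDiffAt.comp 0 P.contDiff.contDiffAt)
    (contDiffAt_const.add (contDiffAt_id.sub P.contDiff.contDiffAt))
  have hd : HasFDerivAt f ((ContinuousLinearEquiv.refl ℝ (W 𝔸 s p) : W 𝔸 s p ≃L[ℝ] W 𝔸 s p) :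
        W 𝔸 s p →L[ℝ] W 𝔸 s p) 0 := by
    have h1 : HasFDerivAt (W.exp : W 𝔸 s p → W 𝔸 s p)
        ((ContinuousLinearEquiv.refl ℝ (W 𝔸 s p) : W 𝔸 s p ≃L[ℝ] W 𝔸 s p) :
          W 𝔸 s p →L[ℝ] W 𝔸 s p) (P 0) := by
      rw [map_zero]
      exact W.hasFDerivAt_exp
    have h2 := (W.mulL 𝔸 s p).hasFDerivAt_of_bilinear (h1.comp (0 : W 𝔸 s p) P.hasFDerivAt)
      (((hasFDerivAt_id (0 : W 𝔸 s p)).sub P.hasFDerivAt).const_add (1 : W 𝔸 s p))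
    refine h2.congr_fderiv ?_
    ext Z : 1
    have h3 : ∀ x, W.mulL 𝔸 s p 1 x = x := fun x => one_mul x
    have h4 : W.mulL 𝔸 s p (P Z) 1 = P Z := mul_one _
    simp [W.exp_zero, h3, h4]
  obtain ⟨ψ, hψ0, hψ, -, hψ1⟩ := exists_local_inverse _ (by simp) hc hd
  rw [hf0] at hψ0 hψ hψ1
  exact ⟨ψ, hψ0, hψ.continuousAt, hψ1⟩

/-- Smooth loops are dense: a smooth function close to a loop `f` is projected to the group in a
tubular neighbourhood of it. -/
theorem dense_isSmooth_loop (hH : IsLinearGroup H k T) (hπ : ∀ x : k, π x = x) :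
    Dense {f : WMaps s p H | IsSmooth (ev f.1)} := by
  intro f
  obtain ⟨δ, hδ, hfac⟩ := hH.exists_isSmooth_factor hπ
  obtain ⟨ψ, hψ0, hψ, htub⟩ := W.exists_tubular_inverse (s := s) (p := p) π
  set P : W 𝔸 s p →L[ℝ] W 𝔸 s p := (W.incl s p k).comp (W.map π) with hP
  set Z : W 𝔸 s p → W 𝔸 s p := fun F => ψ (W.map T f.1 * F) with hZ
  have h1 : Filter.Tendsto (fun F => W.map T f.1 * F) (nhds f.1) (nhds 1) := by
    rw [← hH.map_mul_self f]
    exact (W.continuous_mul.comp (continuous_const.prodMk continuous_id)).tendsto f.1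
  have hZ0 : Filter.Tendsto Z (nhds f.1) (nhds 0) := by
    have := hψ.tendsto
    rw [hψ0] at this
    exact this.comp h1
  set Γ : W 𝔸 s p → WMaps s p H := fun F =>
    hH.mkLoop (f.1 * W.exp (W.incl s p k (W.map π (Z F)))) fun θ => by
      rw [ev_mul, ev_exp, ev_incl]
      exact hH.mul_mem (hH.ev_mem f θ) (hH.exp_mem (ev (W.map π (Z F)) θ).2) with hΓ
  have hPZ : Filter.Tendsto (fun F => P (Z F)) (nhds f.1) (nhds 0) := by
    have := (P.continuous.tendsto 0).comp hZ0
    rwa [map_zero] at this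
  have hΓf : Filter.Tendsto Γ (nhds f.1) (nhds f) := by
    refine tendsto_subtype_rng.2 ?_
    have h2 := (W.contDiff_exp.continuous.tendsto (0 : W 𝔸 s p)).comp hPZ
    rw [W.exp_zero] at h2
    have h3 : Filter.Tendsto (fun a => f.1 * a) (nhds 1) (nhds (f.1 * 1)) :=
      (W.continuous_mul.comp (continuous_const.prodMk continuous_id)).tendsto 1
    rw [mul_one] at h3
    exact h3.comp h2
  have hsm : ∀ᶠ F in nhds f.1, IsSmooth (ev F) → IsSmooth (ev (Γ F).1) := by
    have h2 : Filter.Tendsto (fun F => Z F - P (Z F)) (nhds f.1) (nhds 0) := by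
      have := hZ0.sub hPZ
      rwa [sub_zero] at this
    have h3 := h2.eventually (W.eventually_ev (v := 0) (by simp) (Metric.ball_mem_nhds (0 : 𝔸) hδ))
    filter_upwards [h1.eventually htub, h3] with F hF hFδ hFs
    refine hfac _ (ev (Z F - P (Z F))) _ (ev (Γ F).1).continuous (hH.ev_mem _) hFs (fun θ => ?_)
      (fun θ => ?_) fun θ => mem_ball_zero_iff.1 (hFδ θ)
    · have h4 : F = (Γ F).1 * (1 + (Z F - P (Z F))) := by
        change F = f.1 * W.exp (W.incl s p k (W.map π (Z F))) * _
        rw [mul_assoc]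
        change F = f.1 * (W.exp (W.incl s p k (W.map π (ψ (W.map T f.1 * F)))) *
          (1 + (ψ (W.map T f.1 * F) - W.incl s p k (W.map π (ψ (W.map T f.1 * F))))))
        rw [hF, ← mul_assoc, hH.mul_map_self, one_mul]
      conv_lhs => rw [h4]
      rw [ev_mul, map_add, ContinuousMap.add_apply, ev_one]
    · rw [map_sub, ContinuousMap.sub_apply, map_sub, hP, ContinuousLinearMap.comp_apply, ev_incl,
        ev_map, hπ, sub_self]
  have hfreq : ∃ᶠ F in nhds f.1, IsSmooth (ev F) := by
    refine mem_closure_iff_frequently.1 ?_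
    refine closure_mono ?_ (denseRange_ofSmooth f.1)
    rintro _ ⟨u, rfl⟩
    change IsSmooth (ev (ofSmooth 𝔸 s p u))
    rw [ev_ofSmooth]
    exact u.2
  exact mem_closure_iff_frequently.2
    (hΓf.frequently ((hfreq.and_eventually hsm).mono fun F hF => hF.2 hF.1))

end Density

/-! ### Connectedness of the loop group -/

section Connected

variable {𝔸 : Type*} [NormedRing 𝔸] [NormedAlgebra ℝ 𝔸] [CompleteSpace 𝔸]
variable {s : ℝ} {p : ENNReal} [Fact (1 ≤ p)] [SobolevRange s p]
variable {H : Set 𝔸} {k : Submodule ℝ 𝔸} [CompleteSpace k] {T : 𝔸 →L[ℝ] 𝔸} {π : 𝔸 →L[ℝ] k}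

omit [CompleteSpace 𝔸] [CompleteSpace k] in
theorem IsLinearGroup.exists_norm_le (hH : IsLinearGroup H k T) : ∃ C > 0, ∀ a ∈ H, ‖a‖ ≤ C :=
  let ⟨C, hC, h⟩ := hH.isCompact.isBounded.exists_pos_norm_le
  ⟨C, hC, h⟩

omit [CompleteSpace k] in
/-- A smooth function with values in `H`, as an element of the loop group. -/
theorem IsLinearGroup.exists_ev_eq (hH : IsLinearGroup H k T) {γ : C(S1, 𝔸)} (hγ : IsSmooth γ)
    (hγH : ∀ θ, γ θ ∈ H) : ∃ f : WMaps s p H, ev f.1 = γ := by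
  refine ⟨hH.mkLoop (ofSmooth 𝔸 s p ⟨γ, hγ⟩) fun θ => ?_, ev_ofSmooth _⟩
  rw [ev_ofSmooth]
  exact hγH θ

/-- Uniformly close smooth loops `f` and `g` are joined by the path `t ↦ f exp(t log(f⁻¹ g))`. As
`log(f⁻¹ g)` is smooth, this is a path in the Sobolev loop group, although the distance of `f` and
`g` in the Sobolev norm is not assumed to be small. -/
theorem IsLinearGroup.exists_mem_connectedComponent (hH : IsLinearGroup H k T)
    (hπ : ∀ x : k, π x = x) : ∃ ε > 0, ∀ f g : WMaps s p H, IsSmooth (ev f.1) → IsSmooth (ev g.1) →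
      (∀ θ, ‖ev g.1 θ - ev f.1 θ‖ < ε) → g ∈ connectedComponent f := by
  obtain ⟨C, hC, hCH⟩ := hH.exists_norm_le
  have hlog : Filter.Tendsto (log 𝔸) (nhds 1) (nhds 0) := by
    have := (contDiffAt_log 𝔸).continuousAt.tendsto
    rwa [log_one] at this
  obtain ⟨δ, hδ, hball⟩ := Metric.eventually_nhds_iff_ball.1
    (((contDiffAt_log 𝔸).eventually (by simp)).and
      ((eventually_exp_log 𝔸).and (hlog.eventually hH.eventually_mem)))
  refine ⟨δ / C, by positivity, fun f g hf hg hfg => ?_⟩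
  set a : S1 → 𝔸 := fun θ => T (ev f.1 θ) * ev g.1 θ with ha
  have haH : ∀ θ, a θ ∈ H := fun θ => hH.mul_mem (hH.inv_mem (hH.ev_mem f θ)) (hH.ev_mem g θ)
  have haδ : ∀ θ, a θ ∈ Metric.ball (1 : 𝔸) δ := fun θ => by
    rw [mem_ball_iff_norm, ha]
    have h1 : T (ev f.1 θ) * ev g.1 θ - 1 = T (ev f.1 θ) * (ev g.1 θ - ev f.1 θ) := by
      rw [mul_sub, hH.inv_mul (hH.ev_mem f θ)]
    simp only [h1]
    calc _ ≤ ‖T (ev f.1 θ)‖ * ‖ev g.1 θ - ev f.1 θ‖ := norm_mul_le _ _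
      _ ≤ C * ‖ev g.1 θ - ev f.1 θ‖ := by
          gcongr
          exact hCH _ (hH.inv_mem (hH.ev_mem f θ))
      _ < C * (δ / C) := by
          gcongr
          exact hfg θ
      _ = δ := by field_simp
  have has : IsSmooth a := (T.contDiff.comp hf).mul hg
  have hXs : IsSmooth fun θ => π (log 𝔸 (a θ)) := by
    refine π.contDiff.comp (contDiff_iff_contDiffAt.2 fun x => ?_)
    exact ContDiffAt.comp (g := log 𝔸) x ((hball _ (haδ x)).1.of_le le_top) has.contDiffAt
  set X : W k s p := ofSmooth k s p ⟨⟨_, hXs.continuous⟩, hXs⟩ with hX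
  have hevX : ∀ θ, ((ev X θ : k) : 𝔸) = log 𝔸 (a θ) := fun θ => by
    obtain ⟨-, h2, h3⟩ := hball _ (haδ θ)
    rw [hX, ev_ofSmooth]
    exact congrArg Subtype.val (hπ ⟨log 𝔸 (a θ), h3 (by rw [h2]; exact haH θ)⟩)
  set Γ : ℝ → WMaps s p H := fun t =>
    hH.mkLoop (f.1 * W.exp (W.incl s p k (t • X))) fun θ => by
      rw [ev_mul, ev_exp, ev_incl]
      exact hH.mul_mem (hH.ev_mem f θ) (hH.exp_mem (ev (t • X) θ).2) with hΓ
  have hΓc : Continuous Γ := by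
    refine Continuous.subtype_mk (W.continuous_mul.comp (continuous_const.prodMk ?_)) _
    exact W.contDiff_exp.continuous.comp ((W.incl s p k).continuous.comp (by fun_prop))
  have h0 : Γ 0 = f := by
    refine Subtype.ext ?_
    change f.1 * W.exp (W.incl s p k ((0 : ℝ) • X)) = f.1
    rw [zero_smul, map_zero, W.exp_zero, mul_one]
  have h1 : Γ 1 = g := by
    refine Subtype.ext (W.ext (ContinuousMap.ext fun θ => ?_))
    change ev (f.1 * W.exp (W.incl s p k ((1 : ℝ) • X))) θ = _
    rw [one_smul, ev_mul, ev_exp, ev_incl, hevX, (hball _ (haδ θ)).2.1, ha, ← mul_assoc,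
      hH.mul_inv (hH.ev_mem f θ), one_mul]
  exact (isPreconnected_range hΓc).subset_connectedComponent ⟨0, h0⟩ ⟨1, h1⟩

/-- Continuous loops are uniform limits of smooth loops. -/
theorem IsLinearGroup.exists_isSmooth_near (hH : IsLinearGroup H k T) (hπ : ∀ x : k, π x = x)
    (c : C(S1, 𝔸)) (hc : ∀ θ, c θ ∈ H) {ε : ℝ} (hε : 0 < ε) :
    ∃ g : WMaps s p H, IsSmooth (ev g.1) ∧ ∀ θ, ‖ev g.1 θ - c θ‖ < ε := by
  obtain ⟨C, hC, hCH⟩ := hH.exists_norm_le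
  obtain ⟨δ, hδ, hfac⟩ := hH.exists_isSmooth_factor hπ
  obtain ⟨ψ, hψ0, hψ, -, htub⟩ := exists_tubular_inverse π
  have hψt : Filter.Tendsto ψ (nhds 1) (nhds 0) := by
    have := hψ.continuousAt.tendsto
    rwa [hψ0] at this
  have h1 : ∀ᶠ Z in nhds (0 : 𝔸), ‖Z - π Z‖ < δ ∧ ‖NormedSpace.exp (π Z : 𝔸) - 1‖ < ε / C := by
    have hπc : Continuous fun Z : 𝔸 => (π Z : 𝔸) := continuous_subtype_val.comp π.continuous
    have h2 : Continuous fun Z : 𝔸 => ‖Z - π Z‖ := (continuous_id.sub hπc).norm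
    have h3 : Continuous fun Z : 𝔸 => ‖NormedSpace.exp (π Z : 𝔸) - 1‖ :=
      (((contDiff_exp 𝔸).continuous.comp hπc).sub continuous_const).norm
    refine (h2.continuousAt.eventually_lt continuousAt_const ?_).and
      (h3.continuousAt.eventually_lt continuousAt_const ?_)
    · simpa using hδ
    · simpa using div_pos hε hC
  obtain ⟨η, hη, hball⟩ := Metric.eventually_nhds_iff_ball.1
    ((hψ.eventually (by simp)).and (htub.and (hψt.eventually h1)))
  obtain ⟨u, hus, hu⟩ := exists_isSmooth_dist_le c (show 0 < η / (2 * C) by positivity)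
  set a : S1 → 𝔸 := fun θ => T (c θ) * u θ with ha
  have hac : Continuous a := (T.continuous.comp c.continuous).mul u.continuous
  have haη : ∀ θ, a θ ∈ Metric.ball (1 : 𝔸) η := fun θ => by
    rw [mem_ball_iff_norm, ha]
    have h1 : T (c θ) * u θ - 1 = T (c θ) * (u - c) θ := by
      rw [ContinuousMap.sub_apply, mul_sub, hH.inv_mul (hc θ)]
    simp only [h1]
    calc _ ≤ ‖T (c θ)‖ * ‖(u - c) θ‖ := norm_mul_le _ _
      _ ≤ C * (η / (2 * C)) := by
          gcongr
          · exact hCH _ (hH.inv_mem (hc θ))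
          · exact (ContinuousMap.norm_coe_le_norm _ _).trans hu
      _ = η / 2 := by field_simp
      _ < η := by linarith
  set γ : S1 → 𝔸 := fun θ => c θ * NormedSpace.exp (π (ψ (a θ)) : 𝔸) with hγ
  have hγH : ∀ θ, γ θ ∈ H := fun θ => hH.mul_mem (hc θ) (hH.exp_mem (π (ψ (a θ))).2)
  have hγc : Continuous γ := by
    have h2 : Continuous fun θ => ψ (a θ) := continuous_iff_continuousAt.2 fun θ =>
      ContinuousAt.comp (g := ψ) (hball _ (haη θ)).1.continuousAt hac.continuousAt
    exact c.continuous.mul ((contDiff_exp 𝔸).continuous.comp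
      (continuous_subtype_val.comp (π.continuous.comp h2)))
  have hγs : IsSmooth γ := by
    refine hfac γ (fun θ => ψ (a θ) - π (ψ (a θ))) u hγc hγH hus (fun θ => ?_) (fun θ => ?_)
      fun θ => (hball _ (haη θ)).2.2.1
    · have h2 := (hball _ (haη θ)).2.1
      rw [tubular] at h2
      rw [hγ]
      simp only
      rw [mul_assoc, h2, ha, ← mul_assoc, hH.mul_inv (hc θ), one_mul]
    · rw [map_sub, hπ, sub_self]
  obtain ⟨g, hg⟩ := hH.exists_ev_eq (s := s) (p := p) (γ := ⟨γ, hγc⟩) hγs hγH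
  refine ⟨g, by rw [hg]; exact hγs, fun θ => ?_⟩
  rw [hg]
  have h2 : γ θ - c θ = c θ * (NormedSpace.exp (π (ψ (a θ)) : 𝔸) - 1) := by rw [mul_sub, mul_one]
  calc ‖γ θ - c θ‖ ≤ ‖c θ‖ * ‖NormedSpace.exp (π (ψ (a θ)) : 𝔸) - 1‖ := by
        rw [h2]
        exact norm_mul_le _ _
    _ ≤ C * ‖NormedSpace.exp (π (ψ (a θ)) : 𝔸) - 1‖ := by
        gcongr
        exact hCH _ (hc θ)
    _ < C * (ε / C) := by
        gcongr
        exact (hball _ (haη θ)).2.2.2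
    _ = ε := by field_simp

/-- A homotopy of continuous loops between smooth loops, approximated at each time by a smooth loop,
stays in one connected component of the Sobolev loop group. -/
theorem IsLinearGroup.mem_connectedComponent_of_homotopy (hH : IsLinearGroup H k T)
    (hπ : ∀ x : k, π x = x) (Φ : C(unitInterval, C(S1, 𝔸))) (hΦ : ∀ t θ, Φ t θ ∈ H)
    {f g : WMaps s p H} (hf : IsSmooth (ev f.1)) (hg : IsSmooth (ev g.1)) (h0 : Φ 0 = ev f.1)
    (h1 : Φ 1 = ev g.1) : g ∈ connectedComponent f := by
  obtain ⟨ε, hε, hcomp⟩ := hH.exists_mem_connectedComponent (s := s) (p := p) hπ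
  have hex := fun t => hH.exists_isSmooth_near (s := s) (p := p) hπ (Φ t) (hΦ t)
    (show 0 < ε / 3 by positivity)
  choose F hFs hF using hex
  have hloc : IsLocallyConstant fun t => (F t : ConnectedComponents (WMaps s p H)) := by
    rw [IsLocallyConstant.iff_eventually_eq]
    intro t
    filter_upwards [Φ.continuous.continuousAt.eventually
      (Metric.ball_mem_nhds (Φ t) (show 0 < ε / 3 by positivity))] with t' ht'
    refine ConnectedComponents.coe_eq_coe'.2 (hcomp _ _ (hFs t) (hFs t') fun θ => ?_)
    have h2 : ‖Φ t' θ - Φ t θ‖ < ε / 3 := by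
      rw [← dist_eq_norm]
      exact lt_of_le_of_lt (ContinuousMap.dist_apply_le_dist θ) ht'
    have h3 : ev (F t').1 θ - ev (F t).1 θ =
        (ev (F t').1 θ - Φ t' θ) + (Φ t' θ - Φ t θ) - (ev (F t).1 θ - Φ t θ) := by abel
    rw [h3]
    calc _ ≤ ‖ev (F t').1 θ - Φ t' θ‖ + ‖Φ t' θ - Φ t θ‖ + ‖ev (F t).1 θ - Φ t θ‖ :=
          (norm_sub_le _ _).trans (add_le_add_left (norm_add_le _ _) _)
      _ < ε := by linarith [hF t' θ, hF t θ]
  have h2 : (F 0 : ConnectedComponents (WMaps s p H)) = f :=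
    ConnectedComponents.coe_eq_coe'.2 (hcomp _ _ hf (hFs 0) fun θ => by
      rw [← h0]
      linarith [hF 0 θ])
  have h3 : (F 1 : ConnectedComponents (WMaps s p H)) = g :=
    ConnectedComponents.coe_eq_coe'.2 (hcomp _ _ hg (hFs 1) fun θ => by
      rw [← h1]
      linarith [hF 1 θ])
  refine ConnectedComponents.coe_eq_coe'.1 ?_
  rw [← h3, ← h2]
  exact hloc.apply_eq_of_preconnectedSpace 1 0

/-- The Sobolev loop group is connected if all continuous loops are null-homotopic. -/
theorem connectedSpace_loop (hH : IsLinearGroup H k T) (hπ : ∀ x : k, π x = x)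
    (hnull : ∀ c : C(S1, 𝔸), (∀ θ, c θ ∈ H) → ∃ Φ : C(unitInterval, C(S1, 𝔸)),
      (∀ t θ, Φ t θ ∈ H) ∧ Φ 0 = ContinuousMap.const S1 1 ∧ Φ 1 = c) :
    ConnectedSpace (WMaps s p H) := by
  obtain ⟨e, he⟩ := hH.exists_ev_eq (s := s) (p := p) (γ := ContinuousMap.const S1 1)
    (show IsSmooth _ from contDiff_const) fun _ => hH.one_mem
  rw [connectedSpace_iff_connectedComponent]
  refine ⟨e, (isClosed_connectedComponent.closure_eq).symm.trans ?_⟩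
  refine ((dense_isSmooth_loop hH hπ).mono fun f hf => ?_).closure_eq
  obtain ⟨Φ, hΦ, h0, h1⟩ := hnull (ev f.1) (hH.ev_mem f)
  exact hH.mem_connectedComponent_of_homotopy hπ Φ hΦ
    (by rw [he]; exact contDiff_const) hf (h0.trans he.symm) h1

end Connected

/-! ### Continuous loops in a simply connected space -/

section NullHomotopy

/-- The parametrization `t ↦ 2πt` of the circle by the unit interval. -/
noncomputable def circleParam : C(unitInterval, S1) where
  toFun t := ((2 * Real.pi * (t : ℝ) : ℝ) : S1)
  continuous_toFun := (AddCircle.continuous_mk' _).comp (by fun_prop)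

theorem circleParam_surjective : Function.Surjective circleParam := by
  intro θ
  obtain ⟨x, hx, rfl⟩ : θ ∈ ((↑) : ℝ → S1) '' Set.Icc (0 : ℝ) (0 + 2 * Real.pi) := by
    rw [AddCircle.coe_image_Icc_eq]
    exact Set.mem_univ _
  have hπ := Real.two_pi_pos
  refine ⟨⟨x / (2 * Real.pi), by have := hx.1; positivity, ?_⟩, ?_⟩
  · rw [div_le_one hπ]
    simpa using hx.2
  · change ((2 * Real.pi * (x / (2 * Real.pi)) : ℝ) : S1) = x
    rw [mul_div_cancel₀ _ hπ.ne']

theorem circleParam_zero : circleParam 0 = 0 := by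
  change ((2 * Real.pi * (0 : ℝ) : ℝ) : S1) = 0
  rw [mul_zero, AddCircle.coe_zero]

theorem circleParam_one : circleParam 1 = 0 := by
  change ((2 * Real.pi * (1 : ℝ) : ℝ) : S1) = 0
  rw [mul_one, AddCircle.coe_period]

theorem circleParam_eq_iff {a b : unitInterval} (h : circleParam a = circleParam b) :
    a = b ∨ a = 0 ∧ b = 1 ∨ a = 1 ∧ b = 0 := by
  have h1 : (((2 * Real.pi * (a : ℝ) : ℝ)) : S1) = ((2 * Real.pi * (b : ℝ) : ℝ) : S1) := h
  rw [← sub_eq_zero, ← AddCircle.coe_sub, AddCircle.coe_eq_zero_iff] at h1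
  obtain ⟨m, hm⟩ := h1
  have hm' : (a : ℝ) - b = m := by
    have h2 : 2 * Real.pi * ((m : ℝ) - (a - b)) = 0 := by
      rw [zsmul_eq_mul] at hm
      linear_combination hm
    rcases mul_eq_zero.1 h2 with h3 | h3
    · exact absurd h3 Real.two_pi_pos.ne'
    · linarith
  have ha := a.2
  have hb := b.2
  have h3 : m ≤ 1 := by
    have : (m : ℝ) ≤ 1 := by linarith [ha.2, hb.1]
    exact_mod_cast this
  have h4 : -1 ≤ m := by
    have : (-1 : ℝ) ≤ m := by linarith [ha.1, hb.2]
    exact_mod_cast this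
  interval_cases m
  · refine Or.inr (Or.inl ⟨Subtype.ext ?_, Subtype.ext ?_⟩)
    · push_cast at hm'
      change (a : ℝ) = 0
      linarith [ha.1, hb.2]
    · push_cast at hm'
      change (b : ℝ) = 1
      linarith [ha.1, hb.2]
  · refine Or.inl (Subtype.ext ?_)
    push_cast at hm'
    linarith
  · refine Or.inr (Or.inr ⟨Subtype.ext ?_, Subtype.ext ?_⟩)
    · push_cast at hm'
      change (a : ℝ) = 1
      linarith [ha.2, hb.1]
    · push_cast at hm'
      change (b : ℝ) = 0
      linarith [ha.2, hb.1]

variable {X : Type*} [TopologicalSpace X] [SimplyConnectedSpace X]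

/-- A loop on the circle in a simply connected space is freely null-homotopic: the homotopy of paths
descends to the quotient `[0, 1] → S¹`, which is still a quotient after taking the product with
`[0, 1]` as it is a closed map. -/
theorem homotopic_const_of_simplyConnected (γ : C(S1, X)) :
    γ.Homotopic (ContinuousMap.const S1 (γ 0)) := by
  let P : Path (γ 0) (γ 0) :=
    { toContinuousMap := γ.comp circleParam
      source' := congrArg γ circleParam_zero
      target' := congrArg γ circleParam_one }
  obtain ⟨F⟩ := SimplyConnectedSpace.paths_homotopic P (Path.refl (γ 0))
  let q : C(unitInterval × unitInterval, unitInterval × S1) :=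
    (ContinuousMap.id unitInterval).prodMap circleParam
  have hsurj : Function.Surjective q := Function.surjective_id.prodMap circleParam_surjective
  have hq : Topology.IsQuotientMap q := q.continuous.isClosedMap.isQuotientMap q.continuous hsurj
  have hF : ∀ x y, q x = q y → F x = F y := by
    rintro ⟨t, a⟩ ⟨t', b⟩ h
    obtain ⟨rfl, h2⟩ : t = t' ∧ circleParam a = circleParam b := Prod.mk.inj h
    rcases circleParam_eq_iff h2 with rfl | ⟨rfl, rfl⟩ | ⟨rfl, rfl⟩
    · rfl
    · rw [F.source, F.target]
    · rw [F.source, F.target]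
  have hlift : ∀ t a, hq.lift F.toContinuousMap hF (t, circleParam a) = F (t, a) := fun t a =>
    ContinuousMap.congr_fun (hq.lift_comp F.toContinuousMap hF) (t, a)
  refine ⟨⟨hq.lift F.toContinuousMap hF, fun θ => ?_, fun θ => ?_⟩⟩
  · obtain ⟨a, rfl⟩ := circleParam_surjective θ
    exact (hlift 0 a).trans (F.apply_zero a)
  · obtain ⟨a, rfl⟩ := circleParam_surjective θ
    exact (hlift 1 a).trans (F.apply_one a)

/-- Loops in a simply connected space are homotopic to any given constant. -/
theorem exists_homotopy_of_simplyConnected (γ : C(S1, X)) (x : X) :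
    ∃ Φ : C(unitInterval, C(S1, X)), Φ 0 = ContinuousMap.const S1 x ∧ Φ 1 = γ := by
  have h1 : (ContinuousMap.const S1 x).Homotopic γ :=
    (ContinuousMap.homotopic_const_iff.2 (PathConnectedSpace.joined x (γ 0))).trans
      (homotopic_const_of_simplyConnected γ).symm
  obtain ⟨F⟩ := h1
  exact ⟨F.curry, ContinuousMap.ext F.apply_zero, ContinuousMap.ext F.apply_one⟩

/-- Continuous loops in the image of a simply connected compact space under an embedding are
null-homotopic in that image. -/
theorem exists_homotopy_in_range [CompactSpace X] {Y : Type*} [TopologicalSpace Y] [T2Space Y]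
    (ρ : C(X, Y)) (hinj : Function.Injective ρ) (x : X) (c : C(S1, Y))
    (hc : ∀ θ, c θ ∈ Set.range ρ) :
    ∃ Φ : C(unitInterval, C(S1, Y)), (∀ t θ, Φ t θ ∈ Set.range ρ) ∧
      Φ 0 = ContinuousMap.const S1 (ρ x) ∧ Φ 1 = c := by
  choose γ hγ using hc
  have hγc : Continuous γ := by
    rw [(ρ.continuous.isClosedEmbedding hinj).isInducing.continuous_iff]
    exact (funext hγ : ρ ∘ γ = c) ▸ c.continuous
  obtain ⟨Φ, h0, h1⟩ := exists_homotopy_of_simplyConnected (⟨γ, hγc⟩ : C(S1, X)) x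
  refine ⟨⟨fun t => ρ.comp (Φ t), ρ.continuous_postcomp.comp Φ.continuous⟩,
    fun t θ => ⟨_, rfl⟩, ?_, ?_⟩
  · change ρ.comp (Φ 0) = _
    rw [h0]
    rfl
  · change ρ.comp (Φ 1) = _
    rw [h1]
    exact ContinuousMap.ext hγ

end NullHomotopy

/-! ### Loop groups of compact matrix groups -/

/-- The Lie algebra defined with the derivative on the manifold is the one defined in the chart at
`1`. -/
theorem repLieAlgebra_eq {d n : ℕ} {G : Type*} [TopologicalSpace G] [Group G]
    [ChartedSpace (EuclideanSpace ℝ (Fin d)) G] [LieGroup (𝓡 d) ∞ G] [CompactSpace G] [T2Space G]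
    (ρ : G →* Matrix (Fin n) (Fin n) ℂ) (hρ : Continuous ρ) :
    repLieAlgebra d ρ = repAlg (EuclideanSpace ℝ (Fin d)) ρ := by
  have h1 : HasMFDerivAt (𝓡 d) 𝓘(ℝ, Matrix (Fin n) (Fin n) ℂ) ρ (1 : G)
      (repDeriv (EuclideanSpace ℝ (Fin d)) ρ) := by
    refine ⟨hρ.continuousAt, HasFDerivAt.hasFDerivWithinAt ?_⟩
    exact (differentiableAt_rep_chart (E := EuclideanSpace ℝ (Fin d)) ρ hρ).hasFDerivAt
  have h2 : dRep d ρ = repDeriv (EuclideanSpace ℝ (Fin d)) ρ := h1.mfderiv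
  rw [repLieAlgebra, repAlg, h2]
  rfl

theorem IsSmoothLoop.isSmooth_rep {d n : ℕ} {G : Type*} [TopologicalSpace G] [Group G]
    [ChartedSpace (EuclideanSpace ℝ (Fin d)) G] [LieGroup (𝓡 d) ∞ G] [CompactSpace G] [T2Space G]
    {ρ : G →* Matrix (Fin n) (Fin n) ℂ} (hρ : Continuous ρ) {γ : S1 → G} (hγ : IsSmoothLoop d γ) :
    IsSmooth fun θ => ρ (γ θ) :=
  contMDiff_iff_contDiff.1
    ((contMDiff_rep (E := EuclideanSpace ℝ (Fin d)) ρ hρ).comp hγ)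

end SobolevLoops

theorem mainTheorem6 {d : ℕ} {G : Type*} [TopologicalSpace G] [Group G]
    [ChartedSpace (EuclideanSpace ℝ (Fin d)) G] [LieGroup (𝓡 d) ∞ G]
    [CompactSpace G] [SimplyConnectedSpace G]
    (hsimple : LieAlgebra.IsSimple ℝ (GroupLieAlgebra (𝓡 d) G))
    {n : ℕ} (ρ : G →* Matrix (Fin n) (Fin n) ℂ)
    (hρ : Continuous ρ) (hρ_inj : Function.Injective ρ)
    (s : ℝ) (p : ENNReal) [Fact (1 ≤ p)] (hp : 1 < p) (hp_top : p < ⊤) (hsp : 1 < s * p.toReal) :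
    -- `W^{s,p}(S¹, G)` is a group for the pointwise product,
    ∃ (_ : Group (WMaps s p (Set.range ρ)))
      -- and a manifold modelled on the Banach space `W^{s,p}(S¹, 𝔤₀)`
      (_ : ChartedSpace (W (repLieAlgebra d ρ) s p)
        (WMaps s p (Set.range ρ))),
      (∀ f g : WMaps s p (Set.range ρ),
        ∀ᵐ θ ∂dθ, (f * g).1.fn θ = f.1.fn θ * g.1.fn θ) ∧
      -- and, with these structures, an analytic Lie group,
      LieGroup 𝓘(ℝ, W (repLieAlgebra d ρ) s p) ω
        (WMaps s p (Set.range ρ)) ∧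
      -- analytically contained in `W^{s,p}(S¹, M_n(ℂ))`.
      ContMDiff 𝓘(ℝ, W (repLieAlgebra d ρ) s p)
        𝓘(ℝ, W (Matrix (Fin n) (Fin n) ℂ) s p) ω
        (Subtype.val : WMaps s p (Set.range ρ) →
          W (Matrix (Fin n) (Fin n) ℂ) s p) ∧
      -- Its Lie algebra is `W^{s,p}(S¹, 𝔤₀)` with the pointwise bracket,
      -- through the derivative at `1` of this inclusion.
      (∃ Φ : GroupLieAlgebra 𝓘(ℝ, W (repLieAlgebra d ρ) s p)
            (WMaps s p (Set.range ρ)) ≃L[ℝ]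
          W (repLieAlgebra d ρ) s p,
        (∀ X, ∀ᵐ θ ∂dθ,
          W.fn (V := Matrix (Fin n) (Fin n) ℂ) (s := s) (p := p)
            (mfderiv 𝓘(ℝ, W (repLieAlgebra d ρ) s p)
              𝓘(ℝ, W (Matrix (Fin n) (Fin n) ℂ) s p)
              (Subtype.val : WMaps s p (Set.range ρ) →
                W (Matrix (Fin n) (Fin n) ℂ) s p) 1 X) θ =
            ((Φ X).fn θ : Matrix (Fin n) (Fin n) ℂ)) ∧
        (∀ X Y, ∀ᵐ θ ∂dθ,
          ((Φ ⁅X, Y⁆).fn θ : Matrix (Fin n) (Fin n) ℂ) =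
            (Φ X).fn θ * (Φ Y).fn θ - (Φ Y).fn θ * (Φ X).fn θ)) ∧
      -- Smooth loops belong to `W^{s,p}(S¹, G)`, and are dense in it.
      (∀ γ : S1 → G, IsSmoothLoop d γ →
        ∃ f : WMaps s p (Set.range ρ),
          ∀ᵐ θ ∂dθ, f.1.fn θ = ρ (γ θ)) ∧
      Dense {f : WMaps s p (Set.range ρ) |
        ∃ γ : S1 → G, IsSmoothLoop d γ ∧
          ∀ᵐ θ ∂dθ, f.1.fn θ = ρ (γ θ)} ∧
      ConnectedSpace (WMaps s p (Set.range ρ)) := by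
  have hT2 : T2Space G := T2Space.of_injective_continuous hρ_inj hρ
  have : IsTopologicalGroup G := topologicalGroup_of_lieGroup (𝓡 d) ∞
  have : SobolevRange s p :=
    ⟨hp, hp_top, by
      have h1 : 0 < p.toReal := ENNReal.toReal_pos (zero_lt_one.trans hp).ne' hp_top.ne
      rwa [div_lt_iff₀ h1]⟩
  obtain ⟨T, hT⟩ := exists_linear_inverse ρ hρ
  have hH : IsLinearGroup (Set.range ρ) (repLieAlgebra d ρ) T := by
    rw [repLieAlgebra_eq ρ hρ]
    exact isLinearGroup_range hρ hρ_inj hT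
  obtain ⟨π, hπ⟩ := exists_projection (repLieAlgebra d ρ)
  have hk : CompleteSpace (repLieAlgebra d ρ) := FiniteDimensional.complete ℝ _
  let _ := loopGroup (s := s) (p := p) hH
  let _ := loopChartedSpace (s := s) (p := p) hH hπ
  have hLie := lieGroup_loop (s := s) (p := p) hH hπ
  have hval := contMDiff_val (s := s) (p := p) hH hπ
  have hder := (hasMFDerivAt_val_one (s := s) (p := p) hH hπ).mfderiv
  refine ⟨loopGroup hH, loopChartedSpace hH hπ, fun f g => ?_, hLie, hval,
    -- the tangent space at `1` is by definition the model space
    ⟨ContinuousLinearEquiv.refl ℝ (W (repLieAlgebra d ρ) s p), fun X => ?_, fun X Y => ?_⟩,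
    fun γ hγ => ?_, ?_, ?_⟩
  · filter_upwards [(f.1 * g.1).fn_ae_eq, f.1.fn_ae_eq, g.1.fn_ae_eq] with θ h1 h2 h3
    rw [h2, h3, ← ev_mul]
    exact h1
  · rw [hder]
    filter_upwards [(W.incl s p (repLieAlgebra d ρ) X).fn_ae_eq,
      W.fn_ae_eq (V := repLieAlgebra d ρ) X] with θ h1 h2
    refine h1.trans ((ev_incl _ _).trans ?_)
    exact congrArg Subtype.val h2.symm
  · have hbr := mfderiv_bracket hval (W.mulL (Matrix (Fin n) (Fin n) ℂ) s p) (fun _ _ => rfl)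
      (fun a => one_mul a) X Y
    rw [hder] at hbr
    let Z : W (repLieAlgebra d ρ) s p :=
      (⁅X, Y⁆ : GroupLieAlgebra 𝓘(ℝ, W (repLieAlgebra d ρ) s p) (WMaps s p (Set.range ρ)))
    let X' : W (repLieAlgebra d ρ) s p := X
    let Y' : W (repLieAlgebra d ρ) s p := Y
    have hbr' : W.incl s p (repLieAlgebra d ρ) Z =
        W.incl s p (repLieAlgebra d ρ) X' * W.incl s p (repLieAlgebra d ρ) Y' -
          W.incl s p (repLieAlgebra d ρ) Y' * W.incl s p (repLieAlgebra d ρ) X' := hbr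
    filter_upwards [Z.fn_ae_eq, X'.fn_ae_eq, Y'.fn_ae_eq] with θ h1 h2 h3
    change ((Z.fn θ : repLieAlgebra d ρ) : Matrix (Fin n) (Fin n) ℂ) =
      X'.fn θ * Y'.fn θ - Y'.fn θ * X'.fn θ
    have h4 := congrArg (fun F => ev F θ) hbr'
    simp only [map_sub, ContinuousMap.sub_apply, ev_mul, ev_incl] at h4
    rw [h1, h2, h3, h4]
  · obtain ⟨f, hf⟩ := hH.exists_ev_eq (s := s) (p := p)
      (γ := ⟨fun θ => ρ (γ θ), (hγ.isSmooth_rep hρ).continuous⟩) (hγ.isSmooth_rep hρ)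
      fun θ => ⟨γ θ, rfl⟩
    refine ⟨f, f.1.fn_ae_eq.trans ?_⟩
    rw [hf]
    rfl
  · refine (dense_isSmooth_loop hH hπ).mono fun f hf => ?_
    choose γ hγ using hH.ev_mem f
    refine ⟨γ, contMDiff_of_rep_comp hρ hρ_inj (γ := fun x : ℝ => γ (x : S1)) ?_,
      f.1.fn_ae_eq.trans (.of_forall fun θ => (hγ θ).symm)⟩
    simp only [hγ]
    exact hf
  · refine connectedSpace_loop hH hπ fun c hc => ?_
    have h := exists_homotopy_in_range ⟨ρ, hρ⟩ hρ_inj 1 c hc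
    rwa [ContinuousMap.coe_mk, map_one] at h
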